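/- **Setting.** Let $d\in\mathbb N$, let $\mathfrak s\in[1,\infty)^d$ be a scaling, $|k|_{\mathfrak s}=\sum_i k_i\mathfrak s_i$ for $k\in\mathbb N^d$, and let $|\Xi|_{\mathfrak s}<0<|\mathcal I|_{\mathfrak s}$ be the degrees of a noise type $\Xi$ and a kernel type $\mathcal I$. Edge types are $\Xi_l,\mathcal I_m$ with $l,m\in\mathbb N^d$, $|\Xi_l|_{\mathfrak s}=|\Xi|_{\mathfrak s}-|l|_{\mathfrak s}$, $|\mathcal I_m|_{\mathfrak s}=|\mathcal I|_{\mathfrak s}-|m|_{\mathfrak s}$. Let $\mathfrak T^{\rm ex}$ be the set of (isomorphism classes of) rooted trees $\tau=T^{\mathfrak n,\mathfrak o}_{\mathfrak e}$ with edge decoration $\mathfrak e$ in the edge types and node decorations $\mathfrak n$ in $\mathbb N^d$, $\mathfrak o$ in $\mathbb R$, where the upper node of a noise edge is a leaf with $\mathfrak n=0$, $\mathfrak o=0$. Each tree is uniquely of the form $\tau=\mathbf 1^aX^k\prod_{l\in L}\Xi_l\prod_{j\in J}\mathcal I_{m_j}[\tau_j]$ (with $a,k$ the decorations of the root $\rho_\tau$);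 the tree product joins roots and adds their decorations. Put $|\tau|_{\mathfrak s}=\sum_x|\mathfrak n(x)|_{\mathfrak s}+\sum_e|\mathfrak e(e)|_{\mathfrak s}$ and $|\tau|_+=|\tau|_{\mathfrak s}+\sum_x\mathfrak o(x)$. A tree is planted if it equals $\mathbf 1^p\Xi_l$ or $\mathbf 1^p\mathcal I_m[\sigma]$. For $\tau=T^{\mathfrak n,\mathfrak o}_{\mathfrak e}$, a subforest $A\subset T$ with node and edge sets $N_A,E_A$, a map $\mathfrak n_A:N_A\to\mathbb N^d$ with $\mathfrak n_A\le\mathfrak n$, and $\mathfrak e_A:\partial(A,T)\to\mathbb N^d$ on the set $\partial(A,T)$ of edges not in $A$ whose lower node is in $A$, let $\pi\mathfrak e_A(x)$ be the sum of $\mathfrak e_A$ over the edges of $\partial(A,T)$ with lower node $x$. The extracted forest is $\mathcal E=(A,\mathfrak n_A+\pi\mathfrak e_A,\mathfrak o|_{N_A},\mathfrak e|_{E_A})$. The contracted tree $\mathcal C$ is obtained by contracting every component $B$ of $A$ to a node with polynomial decoration $\sum_{x\in B}(\mathfrak n-\mathfrak n_A)(x)$ and extended decoration $\sum_{x\in B}\mathfrak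 o(x)+\sum_{e\in E_B}|\mathfrak e(e)|_{\mathfrak s}+\sum_{x\in B}|(\mathfrak n_A+\pi\mathfrak e_A)(x)|_{\mathfrak s}$, and replacing $\mathfrak e$ by $\mathfrak e+\mathfrak e_A$ (second components are added). A rule $R$ is a set of finite multisets of edge types. Let $\mathfrak T_\circ$ be the set of trees with $\mathfrak o=0$ such that, for every node, the multiset of types of the edges leaving it upwards is in $R$; let $\mathfrak T_-$ be the set of unplanted $\tau\in\mathfrak T_\circ$ with $|\tau|_{\mathfrak s}<0$ and $\mathfrak n(\rho_\tau)=0$. Assume that $R$ is normal (closed under sub-multisets), subcritical (there are $\mathrm{reg}(\Xi)<|\Xi|_{\mathfrak s}$ and $\mathrm{reg}(\mathcal I)<|\mathcal I|_{\mathfrak s}+\inf_{N\in R}\sum_{\mathfrak t_k\in N}(\mathrm{reg}(\mathfrak t)-|k|_{\mathfrak s})$) and complete (if $\tau\in\mathfrak T_\circ$ and all trees of $\mathcal E(\tau;A,\mathfrak n_A,\mathfrak e_A)$ are in $\mathfrak T_-$, then $\mathcal C(\tau;A,\mathfrak n_A,\mathfrak e_A)$ with its extended decorations set to $0$ is in $\mathfrak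 T_\circ$). Let $\mathfrak T^{\rm ex}_\circ$ be the set of all $\mathcal C(\tau;A,\mathfrak n_A,\mathfrak e_A)$ with $\tau\in\mathfrak T_\circ$ and all trees of $\mathcal E(\tau;A,\mathfrak n_A,\mathfrak e_A)$ in $\mathfrak T_-$; let $\mathfrak T^{\rm ex}_-$ be the set of unplanted $\tau\in\mathfrak T^{\rm ex}_\circ$ with $|\tau|_{\mathfrak s}<0$ and $\mathfrak n(\rho_\tau)=0$. Let $\mathcal T^{\rm ex}$ be the real vector space with basis $\mathfrak T^{\rm ex}_\circ$; $\mathcal F^{\rm ex}_-$ the free commutative algebra generated by $\mathfrak T^{\rm ex}_-$ (unit: the empty forest); $\mathcal T^{\rm ex}_+$ the free commutative algebra generated by $X_1,\dots,X_d$ and all $\mathcal I_m[\tau]$ with $\tau\in\mathfrak T^{\rm ex}_\circ$, $|\mathcal I_m\tau|_+>0$. Let $G^{\rm ex}_\pm$ be the set of characters of $\mathcal T^{\rm ex}_+$, resp. $\mathcal F^{\rm ex}_-$. Define $$\Delta^-_{\rm ex}\tau=\sum_{A\subset T}\sum_{\mathfrak e_A,\mathfrak n_A}\frac1{\mathfrak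 e_A!}\binom{\mathfrak n}{\mathfrak n_A}\,\pi_-\mathcal E(\tau;A,\mathfrak n_A,\mathfrak e_A)\otimes\mathcal C(\tau;A,\mathfrak n_A,\mathfrak e_A),\qquad\tau\in\mathfrak T^{\rm ex}_\circ,$$ where $\pi_-$ annihilates forests containing a tree outside $\mathfrak T^{\rm ex}_-$. Define $\Delta^+_{\rm ex}$ on $\mathcal T^{\rm ex}$ multiplicatively by $\Delta^+_{\rm ex}\mathbf 1^a=\mathbf 1^a\otimes\mathbf 1$, $\Delta^+_{\rm ex}X_i=X_i\otimes\mathbf 1+\mathbf 1\otimes X_i$, $\Delta^+_{\rm ex}\Xi_l=\Xi_l\otimes\mathbf 1$, $\Delta^+_{\rm ex}\mathcal I_m\tau=(\mathcal I_m\otimes\mathrm{id})\Delta^+_{\rm ex}\tau+\sum_{|k|_{\mathfrak s}<|\mathcal I_m\tau|_+}\frac{X^k}{k!}\otimes\mathcal I_{m+k}\tau$, and on $\mathcal T^{\rm ex}_+$ as an algebra morphism by the same formulae with $\mathcal I_m\otimes\mathrm{id}$ replaced by $\pi_+\mathcal I_m\otimes\mathrm{id}$, where $\pi_+$ annihilates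 planted trees of degree $|\cdot|_+\le0$. For $f,\bar f\in G^{\rm ex}_+$ put $f\circ\bar f=(f\otimes\bar f)\Delta^+_{\rm ex}$, $\Gamma^{\rm ex}_f=(\mathrm{id}\otimes f)\Delta^+_{\rm ex}$. For $g\in G^{\rm ex}_-$ put $M_g=(g\otimes\mathrm{id})\Delta^-_{\rm ex}:\mathcal T^{\rm ex}\to\mathcal T^{\rm ex}$. The product of $G^{\rm ex}_-$ is $g\bar g=(\bar g\otimes g)\Delta^-_{\rm ex}$, where $\Delta^-_{\rm ex}:\mathcal F^{\rm ex}_-\to\mathcal F^{\rm ex}_-\otimes\mathcal F^{\rm ex}_-$ is the algebra morphism given on $\mathfrak T^{\rm ex}_-$ by the formula above, in which right factors $\mathbf 1^p$ are replaced by the empty forest and all other right factors outside $\mathfrak T^{\rm ex}_-$ by $0$; its unit is the character vanishing on $\mathfrak T^{\rm ex}_-$. Let $K:\mathbb R^d\to\mathbb R$ be integrable, smooth outside $0$ and supported in $\{0<|z|<1\}$ (for instance a truncation of a locally integrable Green's function). A linear map $\mathbf\Pi:\mathcal T^{\rm ex}\to C^\infty(\mathbb R^d)$ is an *extended admissible map*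 if for some $\xi\in C^\infty(\mathbb R^d)$ and all trees below in $\mathfrak T^{\rm ex}_\circ$: $\mathbf\Pi X^k\tau=(\cdot)^k\,\mathbf\Pi\tau$, $\mathbf\Pi\mathbf 1=1$, $\mathbf\Pi\Xi_l=D^l\xi$, $\mathbf\Pi\mathcal I_m\tau=D^mK*\mathbf\Pi\tau$. For linear $\mathbf\Pi$ and $x\in\mathbb R^d$, the recentred map $\Pi_x$ and the character $f_x\in G^{\rm ex}_+$ are defined recursively by $\Pi_x=\mathbf\Pi\Gamma^{\rm ex}_{f_x}$, $f_x(X_i)=-x_i$ and $$f_x(\mathcal I_m\tau)=-\sum_{|\ell|_{\mathfrak s}<|\mathcal I_m\tau|_+}\frac{(-x)^\ell}{\ell!}\,(D^{m+\ell}K*\Pi_x\tau)(x);$$ also $\Gamma_{xy}=\Gamma^{\rm ex}_{f_x^{-1}\circ f_y}$. Fix $r\in\mathbb N$ with $r>1-|\tau|_+$ for all $\tau\in\mathfrak T^{\rm ex}_\circ$. An extended admissible map is an *extended pre-model* if for every $\tau\in\mathfrak T^{\rm ex}_\circ$ and compact $S\subset\mathbb R^d$ there is $C$ such that $|\int\Pi_x\tau(z)\,\varphi^\lambda_x(z)\,dz|\le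 C\lambda^{|\tau|_+}$ and $|\Gamma_{xy}\tau|_\gamma\le C|x-y|_{\mathfrak s}^{|\tau|_+-\gamma}$ for all $x,y\in S$, $\gamma\le|\tau|_+$, $\lambda\in(0,1]$ and $\varphi\in C^\infty$ supported in the unit ball with $|D^k\varphi|\le1$ for all multi-indices $k$ of order at most $r$. Here $\varphi^\lambda_x(z)=\lambda^{-\sum_i\mathfrak s_i}\varphi\big((\lambda^{-\mathfrak s_i}(z_i-x_i))_i\big)$, $|z|_{\mathfrak s}=\sum_i|z_i|^{1/\mathfrak s_i}$, and $|v|_\gamma$ is the sum of the absolute values of the coefficients of $v$ at the trees $\sigma$ with $|\sigma|_+=\gamma$. **Theorem.** The maps $\Delta^-_{\rm ex}:\mathcal T^{\rm ex}\to\mathcal F^{\rm ex}_-\otimes\mathcal T^{\rm ex}$ and $\Delta^+_{\rm ex}:\mathcal T^{\rm ex}\to\mathcal T^{\rm ex}\otimes\mathcal T^{\rm ex}_+$ are well defined, and all elements of $G^{\rm ex}_+$ and $G^{\rm ex}_-$ have two-sided inverses. If $g\in G^{\rm ex}_-$ and $\mathbf\Pi$ is an extended pre-model, then $\mathbf\Pi^g=(g\otimes\mathbf\Pi)\Delta^-_{\rm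 ex}$ is an extended pre-model. Moreover, with $(\Pi,\Gamma)$ and $(\Pi^g,\Gamma^g)$ the recentred maps and transformations of $\mathbf\Pi$ and $\mathbf\Pi^g$, for all $x,y\in\mathbb R^d$, $$\Pi^g_x=\Pi_xM_g,\qquad\Gamma^g_{xy}=M_{g^{-1}}\Gamma_{xy}M_g .$$ -/

import Mathlib

open scoped TensorProduct ContDiff

noncomputable section

namespace RegStr

/-! ### Multi-indices, scaling and degrees -/

/-- Multi-indices `ℕ^d`. -/
abbrev MIdx (d : ℕ) : Type := Fin d → ℕ

/-- `k! = ∏ i, (k i)!`. -/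
def mfact {d : ℕ} (k : MIdx d) : ℕ := ∏ i, (k i).factorial

/-- `binom n k = ∏ i, binom (n i) (k i)`. -/
def mchoose {d : ℕ} (n k : MIdx d) : ℕ := ∏ i, (n i).choose (k i)

/-- A scaling `s ∈ [1,∞)^d` and a degree map on the two types (noise `Ξ`, kernel `I`), with
`|Ξ| < 0` and `|I| > 0`. -/
structure Degrees (d : ℕ) where
  scaling : Fin d → ℝ
  one_le_scaling : ∀ i, 1 ≤ scaling i
  degNoise : ℝ
  degNoise_neg : degNoise < 0
  degKernel : ℝ
  degKernel_pos : 0 < degKernel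

/-- The scaled degree `|k|_s = ∑ i, k i * s i` of a multi-index. -/
def Degrees.deg {d : ℕ} (P : Degrees d) (k : MIdx d) : ℝ := ∑ i, (k i : ℝ) * P.scaling i

/-- The finite set of multi-indices with `|k|_s < c`; see `mem_below`. -/
def Degrees.below {d : ℕ} (P : Degrees d) (c : ℝ) : Finset (MIdx d) :=
  (Fintype.piFinset fun _ => Finset.range ⌈c⌉₊).filter fun k => P.deg k < c

lemma Degrees.le_deg {d : ℕ} (P : Degrees d) (k : MIdx d) (i : Fin d) : (k i : ℝ) ≤ P.deg k := by
  have h1 : (k i : ℝ) ≤ (k i : ℝ) * P.scaling i :=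
    le_mul_of_one_le_right (by positivity) (P.one_le_scaling i)
  refine h1.trans (Finset.single_le_sum (f := fun i => (k i : ℝ) * P.scaling i) ?_
    (Finset.mem_univ i))
  intro j _
  exact mul_nonneg (by positivity) (zero_le_one.trans (P.one_le_scaling j))

lemma Degrees.deg_nonneg {d : ℕ} (P : Degrees d) (k : MIdx d) : 0 ≤ P.deg k :=
  Finset.sum_nonneg fun j _ =>
    mul_nonneg (by positivity) (zero_le_one.trans (P.one_le_scaling j))

lemma Degrees.deg_add {d : ℕ} (P : Degrees d) (k n : MIdx d) :
    P.deg (k + n) = P.deg k + P.deg n := by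
  simp [Degrees.deg, add_mul, Finset.sum_add_distrib]

lemma Degrees.mem_below {d : ℕ} (P : Degrees d) (c : ℝ) (k : MIdx d) :
    k ∈ P.below c ↔ P.deg k < c := by
  simp only [below, Finset.mem_filter, Fintype.mem_piFinset, Finset.mem_range,
    and_iff_right_iff_imp]
  intro h i
  have := (P.le_deg k i).trans_lt (h.trans_le (Nat.le_ceil c))
  exact_mod_cast this

/-- Edge types: `Ξ_l` or `I_m`. -/
inductive EdgeType (d : ℕ) : Type
  | noise (l : MIdx d) : EdgeType d
  | kern (m : MIdx d) : EdgeType d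

/-- A rule is a set of finite multisets of edge types. -/
abbrev Rule (d : ℕ) : Type := Set (Multiset (EdgeType d))

/-- `R` is normal: it is closed under taking sub-multisets. -/
def Rule.IsNormal {d : ℕ} (R : Rule d) : Prop := ∀ A B : Multiset (EdgeType d), A ≤ B → B ∈ R → A ∈ R

/-- `reg (t, k) = reg t - |k|_s`. -/
def edgeReg {d : ℕ} (P : Degrees d) (regNoise regKernel : ℝ) : EdgeType d → ℝ
  | .noise l => regNoise - P.deg l
  | .kern m => regKernel - P.deg m

/-- Subcriticality: `reg Ξ < |Ξ|` and `reg I < |I| + inf_{N ∈ R} ∑_{o ∈ N} reg o` for some `reg`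
(the infimum being bounded below by the number `c`). -/
def Rule.IsSubcritical {d : ℕ} (P : Degrees d) (R : Rule d) : Prop :=
  ∃ regNoise regKernel c : ℝ, regNoise < P.degNoise ∧
    (∀ N ∈ R, c ≤ (N.map (edgeReg P regNoise regKernel)).sum) ∧ regKernel < P.degKernel + c

/-! ### Rooted decorated trees -/

/-- Planar representatives of the trees with extended decorations.
`root a k` is the one-node tree `𝟏^a X^k`, `noise l t` is `Ξ_l · t` (attach to the root of `t` a
noise edge with decoration `Ξ_l`, whose upper node is a leaf without decorations) and `kern m s t`
is `I_m[s] · t` (attach to the root of `t` a kernel edge with decoration `I_m` which carries `s`).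
So `𝟏^a X^k Ξ_{l₁} ⋯ Ξ_{l_p} ∏_{j ≤ q} I_{m_j}[τ_j]` is represented by successively attaching all
its edges to `root a k`, in any order. -/
inductive PTree (d : ℕ) : Type
  | root (a : ℝ) (k : MIdx d) : PTree d
  | noise (l : MIdx d) (t : PTree d) : PTree d
  | kern (m : MIdx d) (s t : PTree d) : PTree d

namespace PTree

variable {d : ℕ}

/-- Exchange two consecutive edges at some node. -/
inductive Step : PTree d → PTree d → Prop
  | noise_noise (l l' : MIdx d) (t : PTree d) :
      Step (noise l (noise l' t)) (noise l' (noise l t))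
  | noise_kern (l m : MIdx d) (s t : PTree d) :
      Step (noise l (kern m s t)) (kern m s (noise l t))
  | kern_kern (m m' : MIdx d) (s s' t : PTree d) :
      Step (kern m s (kern m' s' t)) (kern m' s' (kern m s t))
  | noise_congr (l : MIdx d) {t t' : PTree d} : Step t t' → Step (noise l t) (noise l t')
  | kern_congr_left (m : MIdx d) {s s' : PTree d} (t : PTree d) :
      Step s s' → Step (kern m s t) (kern m s' t)
  | kern_congr_right (m : MIdx d) (s : PTree d) {t t' : PTree d} :
      Step t t' → Step (kern m s t) (kern m s t')

/-- Multiply by `𝟏^a X^k`. -/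
def addRoot (a : ℝ) (k : MIdx d) : PTree d → PTree d
  | root b n => root (a + b) (k + n)
  | noise l t => noise l (addRoot a k t)
  | kern m s t => kern m s (addRoot a k t)

/-- The tree product: join the roots and add the decorations of the roots. -/
def mul : PTree d → PTree d → PTree d
  | root a k, u => addRoot a k u
  | noise l t, u => noise l (mul t u)
  | kern m s t, u => kern m s (mul t u)

lemma Step.addRoot (a : ℝ) (k : MIdx d) {t t' : PTree d} (h : Step t t') :
    Step (t.addRoot a k) (t'.addRoot a k) := by
  induction h with
  | noise_noise => exact .noise_noise ..
  | noise_kern => exact .noise_kern ..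
  | kern_kern => exact .kern_kern ..
  | noise_congr _ _ ih => exact .noise_congr _ ih
  | kern_congr_left _ _ h _ => exact .kern_congr_left _ _ h
  | kern_congr_right _ _ _ ih => exact .kern_congr_right _ _ ih

lemma Step.mul_right {t t' : PTree d} (h : Step t t') (u : PTree d) :
    Step (t.mul u) (t'.mul u) := by
  induction h with
  | noise_noise => exact .noise_noise ..
  | noise_kern => exact .noise_kern ..
  | kern_kern => exact .kern_kern ..
  | noise_congr _ _ ih => exact .noise_congr _ ih
  | kern_congr_left _ _ h _ => exact .kern_congr_left _ _ h
  | kern_congr_right _ _ _ ih => exact .kern_congr_right _ _ ih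

lemma Step.mul_left (u : PTree d) {t t' : PTree d} (h : Step t t') :
    Step (u.mul t) (u.mul t') := by
  induction u with
  | root a k => exact h.addRoot a k
  | noise l u ih => exact .noise_congr _ ih
  | kern m s u _ ih => exact .kern_congr_right _ _ ih

lemma addRoot_addRoot (a b : ℝ) (k n : MIdx d) (t : PTree d) :
    (t.addRoot b n).addRoot a k = t.addRoot (a + b) (k + n) := by
  induction t with
  | root c p => simp [addRoot, add_assoc]
  | noise l t ih => simp [addRoot, ih]
  | kern m s t _ ih => simp [addRoot, ih]

lemma addRoot_mul (a : ℝ) (k : MIdx d) (t u : PTree d) :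
    (t.addRoot a k).mul u = (t.mul u).addRoot a k := by
  induction t with
  | root c p => simp [addRoot, mul, addRoot_addRoot]
  | noise l t ih => simp [addRoot, mul, ih]
  | kern m s t _ ih => simp [addRoot, mul, ih]

lemma mul_assoc' (t u v : PTree d) : (t.mul u).mul v = t.mul (u.mul v) := by
  induction t with
  | root c p => simp [mul, addRoot_mul]
  | noise l t ih => simp [mul, ih]
  | kern m s t _ ih => simp [mul, ih]

lemma addRoot_zero (t : PTree d) : t.addRoot 0 0 = t := by
  induction t with
  | root c p => simp [addRoot]
  | noise l t ih => simp [addRoot, ih]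
  | kern m s t _ ih => simp [addRoot, ih]

lemma mul_root (a : ℝ) (k : MIdx d) (t : PTree d) : t.mul (root a k) = t.addRoot a k := by
  induction t with
  | root c p => simp [addRoot, mul, add_comm]
  | noise l t ih => simp [addRoot, mul, ih]
  | kern m s t _ ih => simp [addRoot, mul, ih]

end PTree

/-- The set `𝔗^ex` of (combinatorial) rooted trees with polynomial, extended and edge decorations:
planar representatives modulo reordering of the edges at the nodes. -/
def Tree (d : ℕ) : Type := Quot (PTree.Step (d := d))

namespace Tree

variable {d : ℕ}

def mk (t : PTree d) : Tree d := Quot.mk _ t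

/-- `𝟏^a X^k`. -/
def root (a : ℝ) (k : MIdx d) : Tree d := mk (.root a k)

def noise (l : MIdx d) : Tree d → Tree d := Quot.map (PTree.noise l) fun _ _ h => .noise_congr l h

def kern (m : MIdx d) : Tree d → Tree d → Tree d :=
  Quot.map₂ (PTree.kern m) (fun s _ _ h => .kern_congr_right m s h)
    (fun _ _ t h => .kern_congr_left m t h)

/-- The tree product. -/
def mul : Tree d → Tree d → Tree d :=
  Quot.map₂ PTree.mul (fun s _ _ h => h.mul_left s) (fun _ _ t h => h.mul_right t)

lemma mk_mul_noise (l : MIdx d) (t u : PTree d) :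
    mk (t.mul (.noise l u)) = mk (.noise l (t.mul u)) := by
  induction t with
  | root a k => rfl
  | noise l' t ih =>
    exact (congrArg (noise l') ih).trans (Quot.sound (.noise_noise ..))
  | kern m s t _ ih =>
    exact (congrArg (kern m (mk s)) ih).trans (Quot.sound (.noise_kern ..)).symm

lemma mk_mul_kern (m : MIdx d) (s t u : PTree d) :
    mk (t.mul (.kern m s u)) = mk (.kern m s (t.mul u)) := by
  induction t with
  | root a k => rfl
  | noise l' t ih =>
    exact (congrArg (noise l') ih).trans (Quot.sound (.noise_kern ..))
  | kern m' s' t _ ih =>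
    exact (congrArg (kern m' (mk s')) ih).trans (Quot.sound (.kern_kern ..))

lemma mk_mul_comm (t u : PTree d) : mk (t.mul u) = mk (u.mul t) := by
  induction t with
  | root a k => rw [PTree.mul_root]; rfl
  | noise l t ih => rw [mk_mul_noise]; exact congrArg (noise l) ih
  | kern m s t _ ih => rw [mk_mul_kern]; exact congrArg (kern m (mk s)) ih

instance : CommMonoid (Tree d) where
  mul := mul
  one := root 0 0
  mul_assoc := by
    rintro ⟨s⟩ ⟨t⟩ ⟨u⟩
    exact congrArg mk (PTree.mul_assoc' s t u)
  one_mul := by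
    rintro ⟨t⟩
    exact congrArg mk (PTree.addRoot_zero t)
  mul_one := by
    rintro ⟨t⟩
    exact congrArg mk ((PTree.mul_root 0 0 t).trans (PTree.addRoot_zero t))
  mul_comm := by
    rintro ⟨s⟩ ⟨t⟩
    exact mk_mul_comm s t

/-- `X^k`. -/
def X (k : MIdx d) : Tree d := root 0 k

/-- `𝟏^a`. -/
def ext (a : ℝ) : Tree d := root a 0

/-- `Ξ_l`. -/
def Xi (l : MIdx d) : Tree d := noise l 1

/-- `I_m[τ]`. -/
def I (m : MIdx d) (τ : Tree d) : Tree d := kern m τ 1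

lemma mk_noise (l : MIdx d) (t : PTree d) : mk (.noise l t) = Xi l * mk t :=
  congrArg (fun u => mk (.noise l u)) (PTree.addRoot_zero t).symm

lemma mk_kern (m : MIdx d) (s t : PTree d) : mk (.kern m s t) = I m (mk s) * mk t :=
  congrArg (fun u => mk (.kern m s u)) (PTree.addRoot_zero t).symm

end Tree

/-! ### Degrees, conforming trees -/

namespace PTree

variable {d : ℕ}

/-- The degree `|τ|_s`, which ignores the extended decoration. -/
def degS (P : Degrees d) : PTree d → ℝ
  | root _ k => P.deg k
  | noise l t => (P.degNoise - P.deg l) + degS P t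
  | kern m s t => (P.degKernel - P.deg m + degS P s) + degS P t

/-- The sum of all extended decorations. -/
def oSum : PTree d → ℝ
  | root a _ => a
  | noise _ t => oSum t
  | kern _ s t => oSum s + oSum t

/-- All extended decorations vanish. -/
def OZero : PTree d → Prop
  | root a _ => a = 0
  | noise _ t => OZero t
  | kern _ s t => OZero s ∧ OZero t

/-- The polynomial decoration of the root. -/
def rootPoly : PTree d → MIdx d
  | root _ k => k
  | noise _ t => rootPoly t
  | kern _ _ t => rootPoly t

/-- The multiset of types of the edges which leave the root upwards. -/
def nodeType : PTree d → Multiset (EdgeType d)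
  | root _ _ => 0
  | noise l t => .noise l ::ₘ nodeType t
  | kern m _ t => .kern m ::ₘ nodeType t

/-- All nodes other than the root have their node type in `R` (a noise node has empty type). -/
def ConformsAbove (R : Rule d) : PTree d → Prop
  | root _ _ => True
  | noise _ t => 0 ∈ R ∧ ConformsAbove R t
  | kern _ s t => (nodeType s ∈ R ∧ ConformsAbove R s) ∧ ConformsAbove R t

lemma degS_step (P : Degrees d) {t t' : PTree d} (h : Step t t') : degS P t = degS P t' := by
  induction h <;> simp only [degS, *] <;> ring

lemma oSum_step {t t' : PTree d} (h : Step t t') : oSum t = oSum t' := by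
  induction h <;> simp only [oSum, *] ; ring

lemma OZero_step {t t' : PTree d} (h : Step t t') : OZero t = OZero t' := by
  induction h <;> simp only [OZero, *] ; simp only [eq_iff_iff] ; tauto

lemma rootPoly_step {t t' : PTree d} (h : Step t t') : rootPoly t = rootPoly t' := by
  induction h <;> simp only [rootPoly, *]

lemma nodeType_step {t t' : PTree d} (h : Step t t') : nodeType t = nodeType t' := by
  induction h with
  | noise_noise => exact Multiset.cons_swap ..
  | noise_kern => exact Multiset.cons_swap ..
  | kern_kern => exact Multiset.cons_swap ..
  | noise_congr _ _ ih => simp only [nodeType, ih]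
  | kern_congr_left => rfl
  | kern_congr_right _ _ _ ih => simp only [nodeType, ih]

lemma conformsAbove_step (R : Rule d) {t t' : PTree d} (h : Step t t') :
    ConformsAbove R t = ConformsAbove R t' := by
  induction h with
  | kern_congr_left _ _ h ih => simp only [ConformsAbove, ih, nodeType_step h]
  | noise_congr _ _ ih => simp only [ConformsAbove, ih]
  | kern_congr_right _ _ _ ih => simp only [ConformsAbove, ih]
  | noise_noise => rfl
  | noise_kern => simp only [ConformsAbove, eq_iff_iff] ; tauto
  | kern_kern => simp only [ConformsAbove, eq_iff_iff] ; tauto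

end PTree

namespace Tree

variable {d : ℕ}

/-- `|τ|_s`. -/
def degS (P : Degrees d) : Tree d → ℝ := Quot.lift (PTree.degS P) fun _ _ => PTree.degS_step P

def oSum : Tree d → ℝ := Quot.lift PTree.oSum fun _ _ => PTree.oSum_step

/-- `|τ|_+ = |τ|_s + ∑_x o(x)`. -/
def degPlus (P : Degrees d) (τ : Tree d) : ℝ := τ.degS P + τ.oSum

/-- All extended decorations vanish, i.e. the tree belongs to `𝔗`. -/
def OZero : Tree d → Prop := Quot.lift PTree.OZero fun _ _ => PTree.OZero_step

def rootPoly : Tree d → MIdx d := Quot.lift PTree.rootPoly fun _ _ => PTree.rootPoly_step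

def nodeType : Tree d → Multiset (EdgeType d) :=
  Quot.lift PTree.nodeType fun _ _ => PTree.nodeType_step

/-- `τ` strongly conforms to `R`: the node type of every node belongs to `R`. -/
def Conforms (R : Rule d) (τ : Tree d) : Prop :=
  τ.nodeType ∈ R ∧ Quot.lift (PTree.ConformsAbove R) (fun _ _ => PTree.conformsAbove_step R) τ

/-- `τ = 𝟏^p Ξ_l` or `τ = 𝟏^p I_m[σ]`. -/
def IsPlanted (τ : Tree d) : Prop :=
  ∃ p : ℝ, (∃ l, τ = ext p * Xi l) ∨ ∃ m σ, τ = ext p * I m σ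

end Tree

/-! ### Subforests, extraction and contraction -/

/-- For a representative `t` of a tree `T`, the type `Σ b, Cut b t` encodes the triples
`(A, n_A, e_A)` where `A` is a subforest of `T`, `n_A ≤ n` is a function on the nodes of `A` and
`e_A` is a function on the boundary of `A`, i.e. on the edges `∉ A` whose lower node is in `A`.
The index `b` tells if the root of `T` belongs to `A`. Every edge is either `In` the forest `A`
(then both its nodes are in `A`), or at the boundary (`Bdry`, with decoration `p = e_A(e)`),
or `Out` (not in `A`, and its lower node is not in `A`).

A noise node whose edge is not in `A` is taken not to be in `A`: otherwise it is a one-node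
component `𝟏` of `A`, and forests with a one-node component never contribute below, since such a
component has degree `≥ 0`. -/
inductive Cut {d : ℕ} : Bool → PTree d → Type
  | rootOut (a : ℝ) (k : MIdx d) : Cut false (.root a k)
  | rootIn (a : ℝ) (k : MIdx d) (n : MIdx d) (h : n ≤ k) : Cut true (.root a k)
  | noiseOut (l : MIdx d) {t : PTree d} (c : Cut false t) : Cut false (.noise l t)
  | noiseBdry (l : MIdx d) (p : MIdx d) {t : PTree d} (c : Cut true t) : Cut true (.noise l t)
  | noiseIn (l : MIdx d) {t : PTree d} (c : Cut true t) : Cut true (.noise l t)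
  | kernOut (m : MIdx d) {s t : PTree d} (b : Bool) (c' : Cut b s) (c : Cut false t) :
      Cut false (.kern m s t)
  | kernBdry (m : MIdx d) (p : MIdx d) {s t : PTree d} (b : Bool) (c' : Cut b s)
      (c : Cut true t) : Cut true (.kern m s t)
  | kernIn (m : MIdx d) {s t : PTree d} (c' : Cut true s) (c : Cut true t) :
      Cut true (.kern m s t)

namespace Cut

variable {d : ℕ}

/-- The coefficient `(1 / e_A!) * binom n n_A`. -/
def coef : {b : Bool} → {t : PTree d} → Cut b t → ℝ
  | _, _, rootOut _ _ => 1
  | _, _, rootIn _ k n _ => mchoose k n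
  | _, _, noiseOut _ c => coef c
  | _, _, noiseBdry _ p c => (mfact p : ℝ)⁻¹ * coef c
  | _, _, noiseIn _ c => coef c
  | _, _, kernOut _ _ c' c => coef c' * coef c
  | _, _, kernBdry _ p _ c' c => (mfact p : ℝ)⁻¹ * (coef c' * coef c)
  | _, _, kernIn _ c' c => coef c' * coef c

/-- The component of `A` which contains the root, with polynomial decoration `n_A + π e_A`
and with the extended and edge decorations of the given tree
(only meaningful if the root is in `A`). -/
def comp : {b : Bool} → {t : PTree d} → Cut b t → Tree d
  | _, _, rootOut _ _ => 1
  | _, _, rootIn a _ n _ => .root a n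
  | _, _, noiseOut _ _ => 1
  | _, _, noiseBdry _ p c => .X p * comp c
  | _, _, noiseIn l c => .Xi l * comp c
  | _, _, kernOut _ _ _ _ => 1
  | _, _, kernBdry _ p _ _ c => .X p * comp c
  | _, _, kernIn m c' c => .I m (comp c') * comp c

/-- The other components of `A`, with the same decorations. -/
def others : {b : Bool} → {t : PTree d} → Cut b t → Multiset (Tree d)
  | _, _, rootOut _ _ => 0
  | _, _, rootIn _ _ _ _ => 0
  | _, _, noiseOut _ c => others c
  | _, _, noiseBdry _ _ c => others c
  | _, _, noiseIn _ c => others c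
  | _, _, kernOut _ b c' c => ((if b then {comp c'} else 0) + others c') + others c
  | _, _, kernBdry _ _ b c' c => ((if b then {comp c'} else 0) + others c') + others c
  | _, _, kernIn _ c' c => others c' + others c

/-- The extracted forest `E(τ; A, n_A, e_A)`, a multiset of trees. -/
def extracted {b : Bool} {t : PTree d} (c : Cut b t) : Multiset (Tree d) :=
  (if b then {comp c} else 0) + others c

/-- The contracted tree `C(τ; A, n_A, e_A) = (T/A, [n - n_A]_A, o(A) + [n_A + π e_A]_A, e + e_A)`:
each component of `A` is contracted to a node, whose extended decoration becomes the sum of the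
extended decorations of the component, of the degrees of its edges, and of `|n_A + π e_A|_s`. -/
def contracted (P : Degrees d) : {b : Bool} → {t : PTree d} → Cut b t → Tree d
  | _, _, rootOut a k => .root a k
  | _, _, rootIn a k n _ => .root (a + P.deg n) (k - n)
  | _, _, noiseOut l c => .Xi l * contracted P c
  | _, _, noiseBdry l p c => (.ext (P.deg p) * .Xi (l + p)) * contracted P c
  | _, _, noiseIn l c => .ext (P.degNoise - P.deg l) * contracted P c
  | _, _, kernOut m _ c' c => .I m (contracted P c') * contracted P c
  | _, _, kernBdry m p _ c' c =>
      (.ext (P.deg p) * .I (m + p) (contracted P c')) * contracted P c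
  | _, _, kernIn m c' c =>
      (.ext (P.degKernel - P.deg m) * contracted P c') * contracted P c


/-- All the data attached to `(A, n_A, e_A)`. -/
def data (P : Degrees d) {b : Bool} {t : PTree d} (c : Cut b t) :
    ℝ × Tree d × Multiset (Tree d) × Tree d :=
  (coef c, comp c, others c, contracted P c)

/-- Exchanging two edges of a representative permutes the triples `(A, n_A, e_A)`. -/
lemma exists_equiv_of_step (P : Degrees d) {t t' : PTree d} (h : PTree.Step t t') :
    ∃ e : ∀ b, Cut b t ≃ Cut b t', ∀ b c, data P (e b c) = data P c := by
  induction h with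
  | noise_noise l l' t =>
    refine ⟨fun b =>
      { toFun := fun c => match b, c with
          | _, .noiseOut l (.noiseOut l' c) => .noiseOut l' (.noiseOut l c)
          | _, .noiseBdry l p (.noiseBdry l' p' c) => .noiseBdry l' p' (.noiseBdry l p c)
          | _, .noiseBdry l p (.noiseIn l' c) => .noiseIn l' (.noiseBdry l p c)
          | _, .noiseIn l (.noiseBdry l' p' c) => .noiseBdry l' p' (.noiseIn l c)
          | _, .noiseIn l (.noiseIn l' c) => .noiseIn l' (.noiseIn l c)
        invFun := fun c => match b, c with
          | _, .noiseOut l (.noiseOut l' c) => .noiseOut l' (.noiseOut l c)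
          | _, .noiseBdry l p (.noiseBdry l' p' c) => .noiseBdry l' p' (.noiseBdry l p c)
          | _, .noiseBdry l p (.noiseIn l' c) => .noiseIn l' (.noiseBdry l p c)
          | _, .noiseIn l (.noiseBdry l' p' c) => .noiseBdry l' p' (.noiseIn l c)
          | _, .noiseIn l (.noiseIn l' c) => .noiseIn l' (.noiseIn l c)
        left_inv := by rintro (_ | _ | _ | _ | _ | _ | _ | _) <;> rename_i c <;> cases c <;> rfl
        right_inv := by rintro (_ | _ | _ | _ | _ | _ | _ | _) <;> rename_i c <;> cases c <;> rfl },
      ?_⟩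
    intro b c
    cases c <;> rename_i c <;> cases c <;>
      simp only [Equiv.coe_fn_mk, data, coef, comp, others, contracted, mul_left_comm]
  | noise_kern l m s t =>
    refine ⟨fun b =>
      { toFun := fun c => match b, c with
          | _, .noiseOut l (.kernOut m b' c' c) => .kernOut m b' c' (.noiseOut l c)
          | _, .noiseBdry l p (.kernBdry m p' b' c' c) => .kernBdry m p' b' c' (.noiseBdry l p c)
          | _, .noiseBdry l p (.kernIn m c' c) => .kernIn m c' (.noiseBdry l p c)
          | _, .noiseIn l (.kernBdry m p' b' c' c) => .kernBdry m p' b' c' (.noiseIn l c)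
          | _, .noiseIn l (.kernIn m c' c) => .kernIn m c' (.noiseIn l c)
        invFun := fun c => match b, c with
          | _, .kernOut m b' c' (.noiseOut l c) => .noiseOut l (.kernOut m b' c' c)
          | _, .kernBdry m p' b' c' (.noiseBdry l p c) => .noiseBdry l p (.kernBdry m p' b' c' c)
          | _, .kernIn m c' (.noiseBdry l p c) => .noiseBdry l p (.kernIn m c' c)
          | _, .kernBdry m p' b' c' (.noiseIn l c) => .noiseIn l (.kernBdry m p' b' c' c)
          | _, .kernIn m c' (.noiseIn l c) => .noiseIn l (.kernIn m c' c)
        left_inv := by rintro (_ | _ | _ | _ | _ | _ | _ | _) <;> rename_i c <;> cases c <;> rfl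
        right_inv := by rintro (_ | _ | _ | _ | _ | _ | _ | _) <;> rename_i c <;> cases c <;> rfl },
      ?_⟩
    intro b c
    cases c <;> rename_i c <;> cases c <;>
      simp only [Equiv.coe_fn_mk, data, coef, comp, others, contracted, mul_left_comm]
  | kern_kern m m' s s' t =>
    refine ⟨fun b =>
      { toFun := fun c => match b, c with
          | _, .kernOut m b' c' (.kernOut m' b'' c'' c) =>
            .kernOut m' b'' c'' (.kernOut m b' c' c)
          | _, .kernBdry m p b' c' (.kernBdry m' p' b'' c'' c) =>
            .kernBdry m' p' b'' c'' (.kernBdry m p b' c' c)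
          | _, .kernBdry m p b' c' (.kernIn m' c'' c) => .kernIn m' c'' (.kernBdry m p b' c' c)
          | _, .kernIn m c' (.kernBdry m' p' b'' c'' c) =>
            .kernBdry m' p' b'' c'' (.kernIn m c' c)
          | _, .kernIn m c' (.kernIn m' c'' c) => .kernIn m' c'' (.kernIn m c' c)
        invFun := fun c => match b, c with
          | _, .kernOut m b' c' (.kernOut m' b'' c'' c) =>
            .kernOut m' b'' c'' (.kernOut m b' c' c)
          | _, .kernBdry m p b' c' (.kernBdry m' p' b'' c'' c) =>
            .kernBdry m' p' b'' c'' (.kernBdry m p b' c' c)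
          | _, .kernBdry m p b' c' (.kernIn m' c'' c) => .kernIn m' c'' (.kernBdry m p b' c' c)
          | _, .kernIn m c' (.kernBdry m' p' b'' c'' c) =>
            .kernBdry m' p' b'' c'' (.kernIn m c' c)
          | _, .kernIn m c' (.kernIn m' c'' c) => .kernIn m' c'' (.kernIn m c' c)
        left_inv := by rintro (_ | _ | _ | _ | _ | _ | _ | _) <;> rename_i c <;> cases c <;> rfl
        right_inv := by rintro (_ | _ | _ | _ | _ | _ | _ | _) <;> rename_i c <;> cases c <;> rfl },
      ?_⟩
    intro b c
    cases c <;> rename_i c <;> cases c <;>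
      simp only [Equiv.coe_fn_mk, data, coef, comp, others, contracted, mul_left_comm,
        add_left_comm]
  | noise_congr l _ ih =>
    obtain ⟨e, he⟩ := ih
    refine ⟨fun b =>
      { toFun := fun c => match b, c with
          | _, .noiseOut l c => .noiseOut l (e _ c)
          | _, .noiseBdry l p c => .noiseBdry l p (e _ c)
          | _, .noiseIn l c => .noiseIn l (e _ c)
        invFun := fun c => match b, c with
          | _, .noiseOut l c => .noiseOut l ((e _).symm c)
          | _, .noiseBdry l p c => .noiseBdry l p ((e _).symm c)
          | _, .noiseIn l c => .noiseIn l ((e _).symm c)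
        left_inv := by rintro (_ | _ | _ | _ | _ | _ | _ | _) <;> simp
        right_inv := by rintro (_ | _ | _ | _ | _ | _ | _ | _) <;> simp }, ?_⟩
    simp only [data, Prod.mk.injEq] at he ⊢
    intro b c
    cases c <;> rename_i c <;> have := he _ c <;>
      simp [coef, comp, others, contracted, this]
  | kern_congr_left m t _ ih =>
    obtain ⟨e, he⟩ := ih
    refine ⟨fun b =>
      { toFun := fun c => match b, c with
          | _, .kernOut m b' c' c => .kernOut m b' (e _ c') c
          | _, .kernBdry m p b' c' c => .kernBdry m p b' (e _ c') c
          | _, .kernIn m c' c => .kernIn m (e _ c') c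
        invFun := fun c => match b, c with
          | _, .kernOut m b' c' c => .kernOut m b' ((e _).symm c') c
          | _, .kernBdry m p b' c' c => .kernBdry m p b' ((e _).symm c') c
          | _, .kernIn m c' c => .kernIn m ((e _).symm c') c
        left_inv := by rintro (_ | _ | _ | _ | _ | _ | _ | _) <;> simp
        right_inv := by rintro (_ | _ | _ | _ | _ | _ | _ | _) <;> simp }, ?_⟩
    simp only [data, Prod.mk.injEq] at he ⊢
    intro b c
    cases c <;> rename_i c' c <;> have := he _ c' <;>
      simp [coef, comp, others, contracted, this]
  | kern_congr_right m s _ ih =>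
    obtain ⟨e, he⟩ := ih
    refine ⟨fun b =>
      { toFun := fun c => match b, c with
          | _, .kernOut m b' c' c => .kernOut m b' c' (e _ c)
          | _, .kernBdry m p b' c' c => .kernBdry m p b' c' (e _ c)
          | _, .kernIn m c' c => .kernIn m c' (e _ c)
        invFun := fun c => match b, c with
          | _, .kernOut m b' c' c => .kernOut m b' c' ((e _).symm c)
          | _, .kernBdry m p b' c' c => .kernBdry m p b' c' ((e _).symm c)
          | _, .kernIn m c' c => .kernIn m c' ((e _).symm c)
        left_inv := by rintro (_ | _ | _ | _ | _ | _ | _ | _) <;> simp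
        right_inv := by rintro (_ | _ | _ | _ | _ | _ | _ | _) <;> simp }, ?_⟩
    simp only [data, Prod.mk.injEq] at he ⊢
    intro b c
    cases c <;> rename_i c' c <;> have := he _ c <;>
      simp [coef, comp, others, contracted, this]


/-- `∑ |e_A(e)|_s` over the boundary. -/
def bdrySize (P : Degrees d) : {b : Bool} → {t : PTree d} → Cut b t → ℝ
  | _, _, rootOut _ _ => 0
  | _, _, rootIn _ _ _ _ => 0
  | _, _, noiseOut _ c => bdrySize P c
  | _, _, noiseBdry _ p c => P.deg p + bdrySize P c
  | _, _, noiseIn _ c => bdrySize P c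
  | _, _, kernOut _ _ c' c => bdrySize P c' + bdrySize P c
  | _, _, kernBdry _ p _ c' c => P.deg p + (bdrySize P c' + bdrySize P c)
  | _, _, kernIn _ c' c => bdrySize P c' + bdrySize P c

end Cut

namespace Tree

variable {d : ℕ}

lemma degS_mul (P : Degrees d) (σ τ : Tree d) : (σ * τ).degS P = σ.degS P + τ.degS P := by
  have hroot : ∀ (a : ℝ) (k : MIdx d) (t : PTree d),
      (t.addRoot a k).degS P = P.deg k + t.degS P := by
    intro a k t
    induction t with
    | root b n => simp [PTree.addRoot, PTree.degS, Degrees.deg, add_mul, Finset.sum_add_distrib]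
    | noise l t ih => simp only [PTree.addRoot, PTree.degS, ih]; ring
    | kern m s t _ ih => simp only [PTree.addRoot, PTree.degS, ih]; ring
  obtain ⟨s⟩ := σ
  obtain ⟨t⟩ := τ
  change (s.mul t).degS P = s.degS P + t.degS P
  induction s with
  | root a k => exact hroot a k t
  | noise l s ih => simp only [PTree.mul, PTree.degS, ih]; ring
  | kern m s' s _ ih => simp only [PTree.mul, PTree.degS, ih]; ring

lemma degS_one (P : Degrees d) : (1 : Tree d).degS P = 0 := by
  change P.deg 0 = 0
  simp [Degrees.deg]

lemma degS_root (P : Degrees d) (a : ℝ) (k : MIdx d) : (root a k).degS P = P.deg k := rfl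

lemma degS_X (P : Degrees d) (k : MIdx d) : (X k).degS P = P.deg k := rfl

lemma degS_Xi (P : Degrees d) (l : MIdx d) : (Xi l).degS P = P.degNoise - P.deg l := by
  change P.degNoise - P.deg l + P.deg 0 = _
  simp [Degrees.deg]

lemma degS_I (P : Degrees d) (m : MIdx d) (τ : Tree d) :
    (I m τ).degS P = P.degKernel - P.deg m + τ.degS P := by
  obtain ⟨t⟩ := τ
  change P.degKernel - P.deg m + t.degS P + P.deg 0 = P.degKernel - P.deg m + t.degS P
  simp [Degrees.deg]

lemma degPlus_I (P : Degrees d) (m : MIdx d) (τ : Tree d) :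
    (I m τ).degPlus P = P.degKernel - P.deg m + τ.degPlus P := by
  have h : (I m τ).oSum = τ.oSum := by
    obtain ⟨t⟩ := τ
    exact add_zero _
  rw [degPlus, degPlus, degS_I, h, add_assoc]

end Tree

namespace Cut

variable {d : ℕ}

lemma bdrySize_nonneg (P : Degrees d) {b : Bool} {t : PTree d} (c : Cut b t) :
    0 ≤ bdrySize P c := by
  induction c with
  | rootOut => exact le_rfl
  | rootIn => exact le_rfl
  | noiseOut _ _ ih => exact ih
  | noiseBdry _ p _ ih => exact add_nonneg (P.deg_nonneg p) ih
  | noiseIn _ _ ih => exact ih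
  | kernOut _ _ _ _ ih' ih => exact add_nonneg ih' ih
  | kernBdry _ p _ _ _ ih' ih => exact add_nonneg (P.deg_nonneg p) (add_nonneg ih' ih)
  | kernIn _ _ _ ih' ih => exact add_nonneg ih' ih

/-- The degree of the extracted forest controls the boundary decorations. -/
lemma exists_bdrySize_le (P : Degrees d) (t : PTree d) :
    ∃ D : ℝ, ∀ b (c : Cut b t),
      bdrySize P c ≤ D + ((extracted c).map (Tree.degS P)).sum := by
  induction t with
  | root a k =>
    refine ⟨0, fun b c => ?_⟩
    cases c with
    | rootOut => simp [extracted, others, bdrySize]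
    | rootIn _ _ n h => simpa [extracted, others, bdrySize, comp, Tree.degS_root] using P.deg_nonneg n
  | noise l t ih =>
    obtain ⟨D, hD⟩ := ih
    obtain ⟨E, h1, h2⟩ : ∃ E : ℝ, 0 ≤ E + (P.degNoise - P.deg l) ∧ 0 ≤ E :=
      ⟨|P.degNoise - P.deg l|, by linarith [neg_abs_le (P.degNoise - P.deg l)],
        abs_nonneg _⟩
    refine ⟨D + E, fun b c => ?_⟩
    cases c <;> rename_i c <;> have := hD _ c <;>
      simp [extracted, others, bdrySize, comp, Tree.degS_mul, Tree.degS_X, Tree.degS_Xi] at this ⊢ <;>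
      linarith
  | kern m s t ihs iht =>
    obtain ⟨D, hD⟩ := ihs
    obtain ⟨D', hD'⟩ := iht
    obtain ⟨E, h1, h2⟩ : ∃ E : ℝ, 0 ≤ E + (P.degKernel - P.deg m) ∧ 0 ≤ E :=
      ⟨|P.degKernel - P.deg m|, by linarith [neg_abs_le (P.degKernel - P.deg m)],
        abs_nonneg _⟩
    refine ⟨D + D' + E, fun b c => ?_⟩
    cases c with
    | kernOut _ b c' c =>
      have h3 := hD _ c'
      have h4 := hD' _ c
      cases b <;> simp [extracted, others, bdrySize] at h3 h4 ⊢ <;> linarith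
    | kernBdry _ p b c' c =>
      have h3 := hD _ c'
      have h4 := hD' _ c
      cases b <;> simp [extracted, others, bdrySize, comp, Tree.degS_mul, Tree.degS_X] at h3 h4 ⊢ <;>
        linarith
    | kernIn _ c' c =>
      have h3 := hD _ c'
      have h4 := hD' _ c
      simp [extracted, others, bdrySize, comp, Tree.degS_mul, Tree.degS_I] at h3 h4 ⊢
      linarith

lemma finite_bdrySize_le (P : Degrees d) (N : ℝ) (t : PTree d) :
    ∀ b, {c : Cut b t | bdrySize P c ≤ N}.Finite := by
  have hfin : {p : MIdx d | P.deg p ≤ N}.Finite :=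
    (P.below (N + 1)).finite_toSet.subset fun p (hp : P.deg p ≤ N) => by
      simpa [P.mem_below] using hp.trans_lt (lt_add_one N)
  induction t with
  | root a k =>
    rintro (_ | _)
    · refine (Set.finite_singleton (Cut.rootOut a k)).subset ?_
      rintro (_ | _) _
      rfl
    · have hk : Finite {n : MIdx d // n ≤ k} := Set.finite_Iic k
      refine (Set.finite_range fun n : {n : MIdx d // n ≤ k} =>
        Cut.rootIn a k n.1 n.2).subset ?_
      rintro (_ | ⟨_, _, n, h⟩) _
      exact ⟨⟨n, h⟩, rfl⟩
  | noise l t ih =>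
    rintro (_ | _)
    · refine ((ih false).image (Cut.noiseOut l)).subset ?_
      rintro (_ | _) hc
      exact ⟨_, hc, rfl⟩
    · refine ((hfin.image2 (fun p c => Cut.noiseBdry l p c) (ih true)).union
        ((ih true).image (Cut.noiseIn l))).subset ?_
      rintro (_ | _) hc
      · rename_i p c
        simp only [Set.mem_ofPred_eq, bdrySize] at hc
        have h1 := bdrySize_nonneg P c
        have h2 := P.deg_nonneg p
        exact .inl ⟨p, by simp only [Set.mem_ofPred_eq]; linarith, c,
          by simp only [Set.mem_ofPred_eq]; linarith, rfl⟩
      · exact .inr ⟨_, hc, rfl⟩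
  | kern m s t ihs iht =>
    rintro (_ | _)
    · refine (Set.finite_iUnion fun b' =>
        (ihs b').image2 (Cut.kernOut m b') (iht false)).subset ?_
      rintro (_ | _) hc
      rename_i b' c' c
      simp only [Set.mem_ofPred_eq, bdrySize] at hc
      have h1 := bdrySize_nonneg P c
      have h2 := bdrySize_nonneg P c'
      exact Set.mem_iUnion.2 ⟨b', c', by simp only [Set.mem_ofPred_eq]; linarith, c,
        by simp only [Set.mem_ofPred_eq]; linarith, rfl⟩
    · refine ((Set.finite_iUnion fun b' => hfin.image2
        (fun p (x : Cut b' s × Cut true t) => Cut.kernBdry m p b' x.1 x.2)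
        ((ihs b').prod (iht true))).union
        ((ihs true).image2 (Cut.kernIn m) (iht true))).subset ?_
      rintro (_ | _) hc
      · rename_i p b' c' c
        simp only [Set.mem_ofPred_eq, bdrySize] at hc
        have h1 := bdrySize_nonneg P c
        have h2 := bdrySize_nonneg P c'
        have h3 := P.deg_nonneg p
        exact .inl (Set.mem_iUnion.2 ⟨b', p, by simp only [Set.mem_ofPred_eq]; linarith, (c', c),
          ⟨by simp only [Set.mem_ofPred_eq]; linarith,
            by simp only [Set.mem_ofPred_eq]; linarith⟩, rfl⟩)
      · rename_i c' c
        simp only [Set.mem_ofPred_eq, bdrySize] at hc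
        have h1 := bdrySize_nonneg P c
        have h2 := bdrySize_nonneg P c'
        exact .inr ⟨c', by simp only [Set.mem_ofPred_eq]; linarith, c,
          by simp only [Set.mem_ofPred_eq]; linarith, rfl⟩

/-- Only finitely many `(A, n_A, e_A)` extract a forest all of whose trees have negative degree. -/
lemma finite_extracted_neg (P : Degrees d) (t : PTree d) :
    {c : Σ b, Cut b t | ∀ σ ∈ extracted c.2, σ.degS P < 0}.Finite := by
  obtain ⟨D, hD⟩ := exists_bdrySize_le P t
  refine (Set.finite_iUnion fun b =>
    (finite_bdrySize_le P D t b).image (Sigma.mk b)).subset ?_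
  rintro ⟨b, c⟩ hc
  refine Set.mem_iUnion.2 ⟨b, c, ?_, rfl⟩
  have h1 : ((extracted c).map (Tree.degS P)).sum ≤ 0 := by
    refine (Multiset.sum_le_card_nsmul _ 0 ?_).trans (by simp)
    intro x hx
    obtain ⟨σ, hσ, rfl⟩ := Multiset.mem_map.1 hx
    exact (hc σ hσ).le
  have h2 := hD b c
  simp only [Set.mem_ofPred_eq]
  linarith

end Cut

/-! ### The sets of trees determined by a rule -/

section Spaces

variable {d : ℕ} (P : Degrees d) (R : Rule d)

/-- `𝔗_∘`: trees without extended decorations which strongly conform to `R`. -/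
def TCirc : Set (Tree d) := {τ | τ.OZero ∧ τ.Conforms R}

/-- `𝔗_-`: unplanted trees in `𝔗_∘` of negative degree with zero polynomial decoration at the
root. -/
def TMinus : Set (Tree d) :=
  {τ | τ ∈ TCirc R ∧ τ.degS P < 0 ∧ τ.rootPoly = 0 ∧ ¬ τ.IsPlanted}

/-- Completeness of the rule: `Δ_-` maps `𝒯` to `ℱ_- ⊗ 𝒯`, i.e. contracting a negative subforest
of a strongly conforming tree produces a strongly conforming tree. -/
def Rule.IsComplete : Prop :=
  ∀ t : PTree d, Tree.mk t ∈ TCirc R → ∀ (b : Bool) (c : Cut b t),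
    (∀ σ ∈ c.extracted, σ ∈ TMinus P R) → (c.contracted P).Conforms R

/-- `𝔗^ex_∘`: the trees `C(τ; A, n_A, e_A)` with `τ ∈ 𝔗_∘` and `E(τ; A, n_A, e_A)` a forest of
trees in `𝔗_-`. -/
def TExCirc : Set (Tree d) :=
  {τ | ∃ t : PTree d, Tree.mk t ∈ TCirc R ∧ ∃ (b : Bool) (c : Cut b t),
    (∀ σ ∈ c.extracted, σ ∈ TMinus P R) ∧ c.contracted P = τ}

/-- `𝔗^ex_-`. -/
def TExMinus : Set (Tree d) :=
  {τ | τ ∈ TExCirc P R ∧ τ.degS P < 0 ∧ τ.rootPoly = 0 ∧ ¬ τ.IsPlanted}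

/-- The index set `A^ex`. -/
def indexSet : Set ℝ := (Tree.degPlus P) '' TExCirc P R

/-! ### The spaces -/

variable (d) in
/-- The span of all trees, with the tree product. -/
abbrev VSpace : Type := MonoidAlgebra ℝ (Tree d)

/-- The model space `𝒯^ex`, with basis `𝔗^ex_∘`. -/
abbrev TSpace : Type := TExCirc P R →₀ ℝ

/-- `ℱ^ex_-`, the free commutative algebra generated by `𝔗^ex_-`. -/
abbrev FMinus : Type := MvPolynomial (TExMinus P R) ℝ

/-- The set `G^ex_-` of characters of `ℱ^ex_-`. -/
abbrev GMinus : Type := FMinus P R →ₐ[ℝ] ℝ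

/-- The pairs `(m, τ)` with `τ ∈ 𝔗^ex_∘` and `|I_m τ|_+ > 0`. -/
def PlusGen : Type :=
  {p : MIdx d × Tree d // p.2 ∈ TExCirc P R ∧ 0 < (Tree.I p.1 p.2).degPlus P}

/-- `𝒯^ex_+`, the free commutative algebra generated by the `X^i`, `1 ≤ i ≤ d`, and by the
`I_m[τ]` with `τ ∈ 𝔗^ex_∘` and `|I_m τ|_+ > 0`; its monomials are the trees
`X^k ∏_j I_{m_j}[τ_j]` in `𝔗^ex_+`. -/
abbrev TPlus : Type := MvPolynomial (Fin d ⊕ PlusGen P R) ℝ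

/-- The set `G^ex_+` of characters of `𝒯^ex_+`. -/
abbrev GPlus : Type := TPlus P R →ₐ[ℝ] ℝ

/-- A tree as an element of `VSpace`. -/
def tr (τ : Tree d) : VSpace d := MonoidAlgebra.single τ 1

/-- The inclusion of `𝒯^ex` in the span of all trees. -/
def inclT : TSpace P R →ₗ[ℝ] VSpace d := Finsupp.linearCombination ℝ fun τ => tr τ.1

/-- The projection onto `𝒯^ex` which annihilates the trees outside `𝔗^ex_∘`. -/
def projT : VSpace d →ₗ[ℝ] TSpace P R :=
  Finsupp.lsubtypeDomain (TExCirc P R) ∘ₗ (MonoidAlgebra.coeffLinearEquiv ℝ).toLinearMap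

/-- Linear extension of a map defined on trees. -/
def linExt {W : Type*} [AddCommGroup W] [Module ℝ W] (f : Tree d → W) : VSpace d →ₗ[ℝ] W :=
  Finsupp.linearCombination ℝ f ∘ₗ (MonoidAlgebra.coeffLinearEquiv ℝ).toLinearMap

/-! ### Positive coaction -/

/-- The linear map `τ ↦ I_m[τ]`. -/
def integ (m : MIdx d) : VSpace d →ₗ[ℝ] VSpace d := linExt fun τ => tr (.I m τ)

open Classical in
/-- `π_+ I_m[τ] ∈ 𝒯^ex_+`: it is `0` unless `I_m[τ] ∈ 𝔗^ex_+`. -/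
def piPlusI (m : MIdx d) (τ : Tree d) : TPlus P R :=
  if h : τ ∈ TExCirc P R ∧ 0 < (Tree.I m τ).degPlus P then MvPolynomial.X (.inr ⟨(m, τ), h⟩) else 0

/-- The recursive definition of `Δ_+^ex`: it is multiplicative with
`Δ 𝟏^a = 𝟏^a ⊗ 𝟏`, `Δ X^i = X^i ⊗ 𝟏 + 𝟏 ⊗ X^i`, `Δ Ξ_l = Ξ_l ⊗ 𝟏` and
`Δ I_m[τ] = (I_m ⊗ id) Δ τ + ∑_{|k|_s < |I_m τ|_+} X^k / k! ⊗ I_{m+k}[τ]`. -/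
def deltaPlusPre : PTree d → VSpace d ⊗[ℝ] TPlus P R
  | .root a k => (tr (.ext a) ⊗ₜ[ℝ] 1) *
      ∏ i, (tr (.X (Pi.single i 1)) ⊗ₜ[ℝ] 1 + 1 ⊗ₜ[ℝ] MvPolynomial.X (.inl i)) ^ k i
  | .noise l t => (tr (.Xi l) ⊗ₜ[ℝ] 1) * deltaPlusPre t
  | .kern m s t => (TensorProduct.map (integ m) LinearMap.id (deltaPlusPre s) +
      ∑ k ∈ P.below ((Tree.I m (.mk s)).degPlus P),
        (mfact k : ℝ)⁻¹ • (tr (.X k) ⊗ₜ[ℝ] piPlusI P R (m + k) (.mk s))) * deltaPlusPre t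

lemma deltaPlusPre_step {t t' : PTree d} (h : PTree.Step t t') :
    deltaPlusPre P R t = deltaPlusPre P R t' := by
  induction h with
  | noise_noise => exact mul_left_comm _ _ _
  | noise_kern => exact mul_left_comm _ _ _
  | kern_kern => exact mul_left_comm _ _ _
  | noise_congr _ _ ih => simp only [deltaPlusPre, ih]
  | kern_congr_left m t h ih =>
    simp only [deltaPlusPre, ih, Tree.mk, Quot.sound h]
  | kern_congr_right _ _ _ ih => simp only [deltaPlusPre, ih]

/-- `Δ_+^ex` on trees, with values in the span of all trees tensored with `𝒯^ex_+`. -/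
def deltaPlusTree : Tree d → VSpace d ⊗[ℝ] TPlus P R :=
  Quot.lift (deltaPlusPre P R) fun _ _ => deltaPlusPre_step P R

/-- `Δ_+^ex : 𝒯^ex → 𝒯^ex ⊗ 𝒯^ex_+`. (The projection onto `𝒯^ex` discards nothing; this is part of
`WellDefined`.) -/
def deltaPlus : TSpace P R →ₗ[ℝ] TSpace P R ⊗[ℝ] TPlus P R :=
  Finsupp.linearCombination ℝ fun τ =>
    TensorProduct.map (projT P R) LinearMap.id (deltaPlusTree P R τ.1)

/-- `Δ_+^ex : 𝒯^ex_+ → 𝒯^ex_+ ⊗ 𝒯^ex_+`, the algebra morphism with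
`Δ X^i = X^i ⊗ 𝟏 + 𝟏 ⊗ X^i` and
`Δ I_m[τ] = (π_+ I_m ⊗ id) Δ τ + ∑_{|k|_s < |I_m τ|_+} X^k / k! ⊗ I_{m+k}[τ]`. -/
def deltaPlusAlg : TPlus P R →ₐ[ℝ] TPlus P R ⊗[ℝ] TPlus P R :=
  MvPolynomial.aeval <| Sum.elim
    (fun i => MvPolynomial.X (.inl i) ⊗ₜ[ℝ] 1 + 1 ⊗ₜ[ℝ] MvPolynomial.X (.inl i))
    (fun g => TensorProduct.map (linExt (piPlusI P R g.1.1)) LinearMap.id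
        (deltaPlusTree P R g.1.2) +
      ∑ k ∈ P.below ((Tree.I g.1.1 g.1.2).degPlus P),
        (mfact k : ℝ)⁻¹ • ((∏ i, MvPolynomial.X (.inl i) ^ k i) ⊗ₜ[ℝ]
          piPlusI P R (g.1.1 + k) g.1.2))

/-- `Γ^ex_f = (id ⊗ f) Δ_+^ex`. -/
def Gam (f : GPlus P R) : TSpace P R →ₗ[ℝ] TSpace P R :=
  (TensorProduct.rid ℝ (TSpace P R)).toLinearMap ∘ₗ
    TensorProduct.map LinearMap.id f.toLinearMap ∘ₗ deltaPlus P R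

/-- The product `f ∘ f' = (f ⊗ f') Δ_+^ex` of `G^ex_+`. -/
def GPlus.conv (f f' : GPlus P R) : GPlus P R :=
  (Algebra.TensorProduct.lmul' ℝ (S := ℝ)).comp
    ((Algebra.TensorProduct.map f f').comp (deltaPlusAlg P R))

/-- The unit `𝟏^*` of `G^ex_+`. -/
def GPlus.unit : GPlus P R := MvPolynomial.aeval fun _ => (0 : ℝ)

/-- `f'` is a two-sided inverse of `f` in `G^ex_+`. -/
def GPlus.IsInv (f f' : GPlus P R) : Prop :=
  GPlus.conv P R f' f = GPlus.unit P R ∧ GPlus.conv P R f f' = GPlus.unit P R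

open Classical in
/-- The inverse in `G^ex_+`. (It exists; this is part of `WellDefined`.) -/
def GPlus.inv (f : GPlus P R) : GPlus P R :=
  if h : ∃ f', GPlus.IsInv P R f f' then h.choose else f

/-! ### Negative coaction -/

open Classical in
/-- `π^ex_-` on trees: annihilates the trees outside `𝔗^ex_-`. -/
def piMinus (τ : Tree d) : FMinus P R :=
  if h : τ ∈ TExMinus P R then MvPolynomial.X ⟨τ, h⟩ else 0

/-- `π^ex_-` on forests: annihilates the forests which contain a tree outside `𝔗^ex_-`. -/
def piMinusForest (F : Multiset (Tree d)) : FMinus P R := (F.map (piMinus P R)).prod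

/-- `∑_{A, n_A, e_A} (1 / e_A!) * binom n n_A • π^ex_- E(τ; A, n_A, e_A) ⊗ r (C(τ; A, n_A, e_A))`;
the sum has only finitely many non-zero terms, see `finite_support_extractTerm`. -/
def extractTerm {W : Type*} [AddCommGroup W] [Module ℝ W] (r : Tree d → W) (t : PTree d)
    (c : Σ b, Cut b t) : FMinus P R ⊗[ℝ] W :=
  c.2.coef • (piMinusForest P R c.2.extracted ⊗ₜ[ℝ] r (c.2.contracted P))

lemma finite_support_extractTerm {W : Type*} [AddCommGroup W] [Module ℝ W] (r : Tree d → W)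
    (t : PTree d) : (Function.support (extractTerm P R r t)).Finite := by
  refine (Cut.finite_extracted_neg P t).subset fun c hc σ hσ => ?_
  by_contra h
  refine hc ?_
  have h0 : piMinus P R σ = 0 := dif_neg fun h' => h h'.2.1
  have : piMinusForest P R c.2.extracted = 0 :=
    Multiset.prod_eq_zero (Multiset.mem_map.2 ⟨σ, hσ, h0⟩)
  simp [extractTerm, this]

lemma extractTerm_step {W : Type*} [AddCommGroup W] [Module ℝ W] (r : Tree d → W)
    {t t' : PTree d} (h : PTree.Step t t') :
    ∑ᶠ c, extractTerm P R r t c = ∑ᶠ c, extractTerm P R r t' c := by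
  obtain ⟨e, he⟩ := Cut.exists_equiv_of_step P h
  refine finsum_eq_of_bijective (Equiv.sigmaCongrRight e) (Equiv.bijective _) ?_
  rintro ⟨b, c⟩
  have := he b c
  simp only [Cut.data, Prod.mk.injEq] at this
  change extractTerm P R r t ⟨b, c⟩ = extractTerm P R r t' ⟨b, e b c⟩
  simp only [extractTerm, Cut.extracted, this]

/-- The sum over all subforests of a tree. -/
def extractSum {W : Type*} [AddCommGroup W] [Module ℝ W] (r : Tree d → W) :
    Tree d → FMinus P R ⊗[ℝ] W :=
  Quot.lift (fun t => ∑ᶠ c, extractTerm P R r t c) fun _ _ => extractTerm_step P R r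

/-- `Δ_-^ex : 𝒯^ex → ℱ^ex_- ⊗ 𝒯^ex`. (The projection onto `𝒯^ex` discards nothing; this is part of
`WellDefined`.) -/
def deltaMinus : TSpace P R →ₗ[ℝ] FMinus P R ⊗[ℝ] TSpace P R :=
  Finsupp.linearCombination ℝ fun τ => extractSum P R (fun σ => projT P R (tr σ)) τ.1

open Classical in
/-- The right-hand projection in the coproduct of `ℱ^ex_-`: the trees outside `𝔗^ex_-` are
annihilated, except that the one-node trees `𝟏^p`, which occur when the whole tree is extracted,
are identified with the empty forest. -/
def piMinusRight (τ : Tree d) : FMinus P R :=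
  if ∃ p : ℝ, τ = .ext p then 1 else piMinus P R τ

/-- The coproduct `Δ_-^ex : ℱ^ex_- → ℱ^ex_- ⊗ ℱ^ex_-`, an algebra morphism. -/
def deltaMinusAlg : FMinus P R →ₐ[ℝ] FMinus P R ⊗[ℝ] FMinus P R :=
  MvPolynomial.aeval fun τ => extractSum P R (piMinusRight P R) τ.1

/-- The product `g g' = (g' ⊗ g) Δ_-^ex` of `G^ex_-`. -/
def GMinus.prod (g g' : GMinus P R) : GMinus P R :=
  (Algebra.TensorProduct.lmul' ℝ (S := ℝ)).comp
    ((Algebra.TensorProduct.map g' g).comp (deltaMinusAlg P R))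

/-- The unit of `G^ex_-`. -/
def GMinus.unit : GMinus P R := MvPolynomial.aeval fun _ => (0 : ℝ)

/-- `g'` is a two-sided inverse of `g` in `G^ex_-`. -/
def GMinus.IsInv (g g' : GMinus P R) : Prop :=
  GMinus.prod P R g' g = GMinus.unit P R ∧ GMinus.prod P R g g' = GMinus.unit P R

/-- `M_g = (g ⊗ id) Δ_-^ex`. -/
def M (g : GMinus P R) : TSpace P R →ₗ[ℝ] TSpace P R :=
  (TensorProduct.lid ℝ (TSpace P R)).toLinearMap ∘ₗ
    TensorProduct.map g.toLinearMap LinearMap.id ∘ₗ deltaMinus P R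

/-- The structure maps are well defined: `Δ_-^ex` maps `𝒯^ex` to `ℱ^ex_- ⊗ 𝒯^ex`, `Δ_+^ex` maps
`𝒯^ex` to `𝒯^ex ⊗ 𝒯^ex_+`, and the elements of `G^ex_+` are invertible. -/
structure WellDefined : Prop where
  contracted_mem : ∀ t : PTree d, Tree.mk t ∈ TExCirc P R → ∀ (b : Bool) (c : Cut b t),
    (∀ σ ∈ c.extracted, σ ∈ TExMinus P R) → c.contracted P ∈ TExCirc P R
  branch_mem : ∀ (m : MIdx d) (σ τ : Tree d),
    Tree.I m σ * τ ∈ TExCirc P R → σ ∈ TExCirc P R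
  deltaPlus_mem : ∀ τ ∈ TExCirc P R, deltaPlusTree P R τ ∈
    LinearMap.range (TensorProduct.map (inclT P R) (LinearMap.id (M := TPlus P R)))
  exists_inv : ∀ f : GPlus P R, ∃ f', GPlus.IsInv P R f f'

end Spaces

/-! ### Smooth functions -/

section Analysis

/-- `ℝ^d`. -/
abbrev Rd (d : ℕ) : Type := EuclideanSpace ℝ (Fin d)

variable {d : ℕ}

variable (d) in
/-- `C^∞(ℝ^d, ℝ)`. -/
def Smooth : Submodule ℝ (Rd d → ℝ) where
  carrier := {f | ContDiff ℝ ∞ f}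
  add_mem' hf hg := by
    simp only [Set.mem_ofPred_eq] at *
    exact hf.add hg
  zero_mem' := by
    simp only [Set.mem_ofPred_eq]
    exact contDiff_const
  smul_mem' c _ hf := by
    simp only [Set.mem_ofPred_eq] at *
    exact contDiff_const.smul hf

def partialDeriv (i : Fin d) (f : Rd d → ℝ) : Rd d → ℝ :=
  fun x => fderiv ℝ f x (EuclideanSpace.single i 1)

/-- `D^l f`. -/
def mderiv (l : MIdx d) (f : Rd d → ℝ) : Rd d → ℝ :=
  (List.finRange d).foldr (fun i h => (partialDeriv i)^[l i] h) f

/-- `x^k`. -/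
def mpow (x : Rd d) (k : MIdx d) : ℝ := ∏ i, x i ^ k i

/-- Kernels: smooth outside the origin, supported in the punctured unit ball, integrable. -/
structure IsKernel (K : Rd d → ℝ) : Prop where
  smooth : ContDiffOn ℝ ∞ K {0}ᶜ
  support : Function.support K ⊆ {z | 0 < ‖z‖ ∧ ‖z‖ < 1}
  integrable : MeasureTheory.Integrable K

/-- `(D^m K * f)(x)` for smooth `f`, with `D^m K` the distributional derivative:
`D^m K * f = K * D^m f`. -/
def kconv (K : Rd d → ℝ) (m : MIdx d) (f : Rd d → ℝ) (x : Rd d) : ℝ :=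
  ∫ y, K (x - y) * mderiv m f y

/-- `|z|_s = ∑ |z_i|^(1 / s_i)`. -/
def snorm (P : Degrees d) (z : Rd d) : ℝ := ∑ i, |z i| ^ (1 / P.scaling i)

/-- `φ^λ_x(z) = λ^(-s_1 - ... - s_d) φ(λ^(-s_1) (z_1 - x_1), ..., λ^(-s_d) (z_d - x_d))`. -/
def rescale (P : Degrees d) (φ : Rd d → ℝ) (lam : ℝ) (x z : Rd d) : ℝ :=
  lam ^ (-∑ i, P.scaling i) *
    φ (WithLp.toLp 2 fun i => lam ^ (-P.scaling i) * (z i - x i))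

/-- The set `ℬ^r` of test functions. -/
def testFns (d r : ℕ) : Set (Rd d → ℝ) :=
  {φ | ContDiff ℝ ∞ φ ∧ tsupport φ ⊆ Metric.closedBall 0 1 ∧
    ∀ k : MIdx d, ∑ i, k i ≤ r → ∀ x, |mderiv k φ x| ≤ 1}

end Analysis

/-! ### Admissible maps, recentring and models -/

section Models

variable {d : ℕ} (P : Degrees d) (R : Rule d) (K : Rd d → ℝ)

/-- The value on a linear combination of trees (`0` on trees outside `𝔗^ex_∘`) of a linear map
`𝒯^ex → C^∞`. -/
def evalV (Pm : TSpace P R →ₗ[ℝ] Smooth d) (v : VSpace d) : Rd d → ℝ := Pm (projT P R v)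

/-- Extended admissible maps. -/
def IsAdmissible (Pm : TSpace P R →ₗ[ℝ] Smooth d) : Prop :=
  ∃ ξ : Rd d → ℝ, ContDiff ℝ ∞ ξ ∧
    (∀ τ ∈ TExCirc P R, ∀ k x, evalV P R Pm (tr (.X k * τ)) x = mpow x k * evalV P R Pm (tr τ) x) ∧
    (1 ∈ TExCirc P R → ∀ x, evalV P R Pm (tr 1) x = 1) ∧
    (∀ l, Tree.Xi l ∈ TExCirc P R → evalV P R Pm (tr (.Xi l)) = mderiv l ξ) ∧
    (∀ τ ∈ TExCirc P R, ∀ m, Tree.I m τ ∈ TExCirc P R →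
      evalV P R Pm (tr (.I m τ)) = kconv K m (evalV P R Pm (tr τ)))

/-- For `v = F_x τ`, so that `Pm v = Π_x τ`, the number
`f_x(I_n[τ]) = - ∑_{|l|_s < |I_n τ|_+} (-x)^l / l! * (D^{n+l} K * Π_x τ)(x)`. -/
def posVal (Pm : TSpace P R →ₗ[ℝ] Smooth d) (x : Rd d) (n : MIdx d) (τ : Tree d)
    (v : VSpace d) : ℝ :=
  - ∑ l ∈ P.below ((Tree.I n τ).degPlus P),
    mpow (-x) l / mfact l * kconv K (n + l) (evalV P R Pm v) x

open Classical in
/-- `f_x(π_+ I_n[τ])` for a tree `I_n[τ]` of positive degree. -/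
def posValCirc (Pm : TSpace P R →ₗ[ℝ] Smooth d) (x : Rd d) (n : MIdx d) (τ : Tree d)
    (v : VSpace d) : ℝ :=
  if τ ∈ TExCirc P R then posVal P R K Pm x n τ v else 0

/-- The recursive definition of `F_x`: it is multiplicative with `F_x 𝟏^a = 𝟏^a`,
`F_x X^i = X^i - x_i`, `F_x Ξ_l = Ξ_l` and
`F_x I_m[τ] = I_m[F_x τ] + ∑_{|k|_s < |I_m τ|_+} X^k / k! f_x(I_{m+k}[τ])`. -/
def recentrePre (Pm : TSpace P R →ₗ[ℝ] Smooth d) (x : Rd d) : PTree d → VSpace d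
  | .root a k => tr (.ext a) * ∏ i, (tr (.X (Pi.single i 1)) - algebraMap ℝ _ (x i)) ^ k i
  | .noise l t => tr (.Xi l) * recentrePre Pm x t
  | .kern m s t => (integ m (recentrePre Pm x s) +
      ∑ k ∈ P.below ((Tree.I m (.mk s)).degPlus P),
        ((mfact k : ℝ)⁻¹ *
          posValCirc P R K Pm x (m + k) (.mk s) (recentrePre Pm x s)) • tr (.X k)) *
      recentrePre Pm x t

lemma recentrePre_step (Pm : TSpace P R →ₗ[ℝ] Smooth d) (x : Rd d) {t t' : PTree d}
    (h : PTree.Step t t') : recentrePre P R K Pm x t = recentrePre P R K Pm x t' := by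
  induction h with
  | noise_noise => exact mul_left_comm _ _ _
  | noise_kern => exact mul_left_comm _ _ _
  | kern_kern => exact mul_left_comm _ _ _
  | noise_congr _ _ ih => simp only [recentrePre, ih]
  | kern_congr_left m t h ih => simp only [recentrePre, ih, show Tree.mk _ = Tree.mk _ from Quot.sound h]
  | kern_congr_right _ _ _ ih => simp only [recentrePre, ih]

/-- `F_x` on trees. -/
def recentre (Pm : TSpace P R →ₗ[ℝ] Smooth d) (x : Rd d) : Tree d → VSpace d :=
  Quot.lift (recentrePre P R K Pm x) fun _ _ => recentrePre_step P R K Pm x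

/-- The positive character `f_x ∈ G^ex_+` of `Pm`; see `posChar_inl`, `posChar_inr`. -/
def posChar (Pm : TSpace P R →ₗ[ℝ] Smooth d) (x : Rd d) : GPlus P R :=
  MvPolynomial.aeval <| Sum.elim (fun i => - x i)
    (fun g => posVal P R K Pm x g.1.1 g.1.2 (recentre P R K Pm x g.1.2))

/-- The recentred map `Π_x = Pm Γ^ex_{f_x}`. -/
def recentred (Pm : TSpace P R →ₗ[ℝ] Smooth d) (x : Rd d) : TSpace P R →ₗ[ℝ] Smooth d :=
  Pm ∘ₗ Gam P R (posChar P R K Pm x)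

/-- `Γ_{xy} = Γ^ex_{f_x⁻¹ ∘ f_y}`. -/
def GamXY (Pm : TSpace P R →ₗ[ℝ] Smooth d) (x y : Rd d) : TSpace P R →ₗ[ℝ] TSpace P R :=
  Gam P R (GPlus.conv P R (GPlus.inv P R (posChar P R K Pm x)) (posChar P R K Pm y))

lemma posChar_inl (Pm : TSpace P R →ₗ[ℝ] Smooth d) (x : Rd d) (i : Fin d) :
    posChar P R K Pm x (MvPolynomial.X (.inl i)) = - x i := by
  simp [posChar]

/-- `(id ⊗ f_x) Δ_+^ex = F_x`. -/
lemma rid_deltaPlusTree (Pm : TSpace P R →ₗ[ℝ] Smooth d) (x : Rd d) (τ : Tree d) :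
    TensorProduct.rid ℝ (VSpace d) (TensorProduct.map LinearMap.id
      (posChar P R K Pm x).toLinearMap (deltaPlusTree P R τ)) = recentre P R K Pm x τ := by
  let ρ : VSpace d ⊗[ℝ] TPlus P R →ₐ[ℝ] VSpace d :=
    (Algebra.TensorProduct.rid ℝ ℝ (VSpace d)).toAlgHom.comp
      (Algebra.TensorProduct.map (AlgHom.id ℝ (VSpace d)) (posChar P R K Pm x))
  have hρ : ∀ v f, ρ (v ⊗ₜ[ℝ] f) = posChar P R K Pm x f • v := by simp [ρ]
  have hρ' : ∀ z, TensorProduct.rid ℝ (VSpace d) (TensorProduct.map LinearMap.id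
      (posChar P R K Pm x).toLinearMap z) = ρ z := by
    intro z
    induction z with
    | zero => simp
    | add z w hz hw => simp only [map_add, hz, hw]
    | tmul v f => simp [hρ]
  have hint : ∀ m z, ρ (TensorProduct.map (integ m) LinearMap.id z) = integ m (ρ z) := by
    intro m z
    induction z with
    | zero => simp
    | add z w hz hw => simp only [map_add, hz, hw]
    | tmul v f => simp [hρ]
  rw [hρ']
  obtain ⟨t⟩ := τ
  change ρ (deltaPlusPre P R t) = recentrePre P R K Pm x t
  induction t with
  | root a k =>
    simp only [deltaPlusPre, recentrePre, map_mul, map_prod, map_pow, map_add, hρ, posChar_inl,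
      map_one, one_smul]
    simp only [Algebra.algebraMap_eq_smul_one, neg_smul, sub_eq_add_neg]
  | noise l t ih => simp only [deltaPlusPre, recentrePre, map_mul, hρ, map_one, one_smul, ih]
  | kern m s t ihs iht =>
    simp only [deltaPlusPre, recentrePre, map_mul, map_add, hint, ihs, iht, map_sum, map_smul, hρ]
    congr 2
    refine Finset.sum_congr rfl fun k hk => ?_
    rw [smul_smul]
    congr 2
    rw [P.mem_below] at hk
    have hpos : 0 < (Tree.I (m + k) (Tree.mk s)).degPlus P := by
      have := P.deg_add m k
      have h1 := Tree.degPlus_I P m (.mk s)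
      have h2 := Tree.degPlus_I P (m + k) (.mk s)
      linarith
    by_cases h : Tree.mk s ∈ TExCirc P R
    · rw [piPlusI, dif_pos ⟨h, hpos⟩, posValCirc, if_pos h, posChar, MvPolynomial.aeval_X]
      rfl
    · rw [piPlusI, dif_neg fun h' => h h'.1, posValCirc, if_neg h, map_zero]

/-- The defining identity of the positive characters:
`f_x(I_m[τ]) = - ∑_{|l|_s < |I_m τ|_+} (-x)^l / l! * (D^{m+l} K * Π_x τ)(x)`. -/
lemma posChar_inr (Pm : TSpace P R →ₗ[ℝ] Smooth d) (x : Rd d) (m : MIdx d) (τ : TExCirc P R)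
    (h : 0 < (Tree.I m τ.1).degPlus P) :
    posChar P R K Pm x (MvPolynomial.X (.inr ⟨(m, τ.1), τ.2, h⟩)) =
      - ∑ l ∈ P.below ((Tree.I m τ.1).degPlus P), mpow (-x) l / mfact l *
        kconv K (m + l) (recentred P R K Pm x (Finsupp.single τ 1) : Smooth d) x := by
  have h1 : (recentred P R K Pm x (Finsupp.single τ 1) : Rd d → ℝ) =
      evalV P R Pm (recentre P R K Pm x τ.1) := by
    have : ∀ z : VSpace d ⊗[ℝ] TPlus P R,
        TensorProduct.rid ℝ (TSpace P R) (TensorProduct.map LinearMap.id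
          (posChar P R K Pm x).toLinearMap (TensorProduct.map (projT P R) LinearMap.id z)) =
        projT P R (TensorProduct.rid ℝ (VSpace d) (TensorProduct.map LinearMap.id
          (posChar P R K Pm x).toLinearMap z)) := by
      intro z
      induction z with
      | zero => simp
      | add z w hz hw => simp only [map_add, hz, hw]
      | tmul v f => simp
    simp only [evalV, recentred, Gam, deltaPlus, LinearMap.comp_apply,
      Finsupp.linearCombination_single, one_smul, LinearEquiv.coe_coe, this,
      rid_deltaPlusTree]
  rw [h1, posChar, MvPolynomial.aeval_X]
  rfl

/-- The norm on the component of degree `γ`: sum of the absolute values of the coefficients of the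
trees with `|σ|_+ = γ`. -/
def normAt (γ : ℝ) (v : TSpace P R) : ℝ :=
  v.sum fun σ a => if σ.1.degPlus P = γ then |a| else 0

/-- The analytic bounds of a model on the extended regularity structure. -/
structure IsModel (r : ℕ) (PmX : Rd d → TSpace P R →ₗ[ℝ] Smooth d)
    (GamX : Rd d → Rd d → TSpace P R →ₗ[ℝ] TSpace P R) : Prop where
  bound_Pi : ∀ (τ : TExCirc P R) (S : Set (Rd d)), IsCompact S → ∃ C : ℝ, ∀ x ∈ S,
    ∀ lam : ℝ, 0 < lam → lam ≤ 1 → ∀ φ ∈ testFns d r,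
      |∫ z, (PmX x (Finsupp.single τ 1) : Rd d → ℝ) z * rescale P φ lam x z|
        ≤ C * lam ^ (τ.1.degPlus P)
  bound_Gam : ∀ (τ : TExCirc P R) (S : Set (Rd d)), IsCompact S → ∃ C : ℝ, ∀ x ∈ S, ∀ y ∈ S,
    ∀ γ ≤ τ.1.degPlus P, normAt P R γ (GamX x y (Finsupp.single τ 1))
        ≤ C * snorm P (x - y) ^ (τ.1.degPlus P - γ)

/-- Extended pre-models. -/
def IsPreModel (r : ℕ) (Pm : TSpace P R →ₗ[ℝ] Smooth d) : Prop :=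
  IsAdmissible P R K Pm ∧ IsModel P R r (recentred P R K Pm) (GamXY P R K Pm)

/-- `Pm^g = (g ⊗ Pm) Δ_-^ex`. -/
def renorm (g : GMinus P R) (Pm : TSpace P R →ₗ[ℝ] Smooth d) : TSpace P R →ₗ[ℝ] Smooth d :=
  (TensorProduct.lid ℝ (Smooth d)).toLinearMap ∘ₗ
    TensorProduct.map g.toLinearMap Pm ∘ₗ deltaMinus P R

end Models

end RegStr

end

open RegStr

/-! Everything rests on two identities between operators on trees. The first is the group law M_g
M_h = M_{gh} (`MV_MV`, `M_prod`). The second is the cointeraction Γ_f M_g = M_g Γ_{f^g}, where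
f^g(I_m τ) = f(I_m M_g τ) (`GamV_MV`, `Gam_M`). Contraction preserves |·|_+, because the extended
decoration of a contracted node stores the degree that was extracted (`degPlus_contracted`). Hence
the Taylor sums that define the positive characters are cut off at the same place for τ and for
every tree in M_g τ. An induction over trees then shows that the positive character of Π^g is f_x^g
(`posChar_renorm`). Consequently Π^g_x = Π M_g Γ_{f_x^g} = Π Γ_{f_x} M_g = Π_x M_g, and Γ^g_{xy} is
Γ_{xy} conjugated by M_g. The analytic bounds carry over since M_g τ is a finite combination of
trees of the degree of τ. Admissibility carries over since M_g fixes the noises and commutes with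
multiplication by X^k and with I_m.

The two identities are proved without bijections between pairs of subforests. If edge decorations
are confined to a finite box `Iic b`, the sum over subforests splits into `D0` (root not extracted)
and `D1` (root extracted, with its component kept in a separate tensor factor). Both are algebra
morphisms for the tree product, so coassociativity (`coassoc_tr`) and cointeraction
(`cointeract_tr`) need to be checked only on 𝟏^a, X_i, Ξ_l and I_m[σ]. There the sums over boundary
decorations are matched by the addition formula for the divided powers X^k/k!. On a given vector the
truncated operators agree with the genuine ones as soon as b is large (`eventually_MB_MV`,
`eventually_gamB_eq`), so each identity is obtained by choosing one sufficiently large box.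

The closure properties of the extended trees come from positivity. All coefficients in the sum over
subforests are positive, so with indicator functionals no cancellation occurs. A tree is then
reached by two successive operations exactly if its coefficient in the composite operator is
nonzero, and coassociativity or cointeraction exhibits it as a single contraction of a conforming
tree (`contracted_mem`, `comp_mem`, `GamV_mem_of_nonneg`). For the positive coaction, whose
coefficients are polynomials in the character, vanishing on the nonnegative orthant suffices
(`deltaPlus_mem`).

Inverses are built recursively. In the negative group M_g - id involves only trees with fewer edges;
in the positive group the recursion follows the branches. In both groups the representation by
operators is faithful, as seen by applying `counit`, and this makes the one-sided inverses
two-sided. -/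

noncomputable section

/-! ### The algebra of trees: generators, divided powers, multiplicative recursions. -/

namespace RegStr

variable {d : ℕ}

/-! ### Trees as generators of the algebra of trees -/

namespace Tree

lemma root_mul_root (a b : ℝ) (k n : MIdx d) : root a k * root b n = root (a + b) (k + n) := rfl

lemma X_add (k n : MIdx d) : X (k + n) = X k * X n := by
  simp [X, root_mul_root]

lemma ext_add (a b : ℝ) : (ext (a + b) : Tree d) = ext a * ext b := by
  simp [ext, root_mul_root]

lemma root_eq (a : ℝ) (k : MIdx d) : root a k = ext a * X k := by
  simp [ext, X, root_mul_root]

lemma X_eq_prod (k : MIdx d) : X k = ∏ i, X (Pi.single i 1 : MIdx d) ^ k i := by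
  let F : Multiplicative (MIdx d) →* Tree d :=
    { toFun := fun k => X k.toAdd, map_one' := rfl, map_mul' := fun k n => X_add k.toAdd n.toAdd }
  have h : k = ∑ i, k i • (Pi.single i 1 : MIdx d) := by
    ext j
    simp [Finset.sum_apply, Pi.single_apply]
  refine (congrArg (fun k => F (Multiplicative.ofAdd k)) h).trans ?_
  simp only [ofAdd_sum, map_prod, ofAdd_nsmul, map_pow]
  rfl

/-- Trees are generated under the tree product by `𝟏^a`, `X^i`, `Ξ_l` and planted kernel trees. -/
theorem induction_gen {motive : Tree d → Prop} (ext : ∀ a, motive (ext a))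
    (X : ∀ i, motive (X (Pi.single i 1))) (Xi : ∀ l, motive (Xi l))
    (I : ∀ m σ, motive σ → motive (I m σ)) (mul : ∀ σ τ, motive σ → motive τ → motive (σ * τ))
    (τ : Tree d) : motive τ := by
  obtain ⟨t⟩ := τ
  change motive (mk t)
  induction t with
  | root a k =>
    change motive (root a k)
    rw [root_eq, X_eq_prod]
    refine mul _ _ (ext a) (Finset.prod_induction _ motive mul (ext 0) fun i _ => ?_)
    induction k i with
    | zero => rw [pow_zero]; exact ext 0
    | succ n ih => rw [pow_succ]; exact mul _ _ ih (X i)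
  | noise l t ih => rw [mk_noise]; exact mul _ _ (Xi l) ih
  | kern m s t ihs iht => rw [mk_kern]; exact mul _ _ (I m _ ihs) iht

end Tree

lemma tr_mul (σ τ : Tree d) : tr (σ * τ) = tr σ * tr τ := by
  simp [tr, MonoidAlgebra.single_mul_single]

lemma tr_one : tr (1 : Tree d) = 1 := rfl

lemma linExt_tr {W : Type*} [AddCommGroup W] [Module ℝ W] (f : Tree d → W) (τ : Tree d) :
    linExt f (tr τ) = f τ := by
  simp [linExt, tr]

lemma integ_tr (m : MIdx d) (τ : Tree d) : integ m (tr τ) = tr (.I m τ) := linExt_tr _ _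

lemma linMap_ext {W : Type*} [AddCommGroup W] [Module ℝ W] {F G : VSpace d →ₗ[ℝ] W}
    (h : ∀ τ, F (tr τ) = G (tr τ)) : F = G := by
  refine LinearMap.ext fun v => ?_
  induction v using MonoidAlgebra.induction_linear with
  | zero => simp
  | add v w hv hw => simp only [map_add, hv, hw]
  | single τ a =>
    have : (MonoidAlgebra.single τ a : VSpace d) = a • tr τ := by simp [tr]
    rw [this, map_smul, map_smul, h]

lemma coeff_tr (τ σ : Tree d) [Decidable (τ = σ)] : (tr τ).coeff σ = if τ = σ then 1 else 0 := by
  classical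
  simp [tr, Finsupp.single_apply]

lemma eq_sum_coeff (v : VSpace d) : v = v.coeff.sum fun σ a => a • tr σ := by
  conv_lhs => rw [← MonoidAlgebra.sum_coeff_single v]
  simp [tr]

/-- `X^p / p!`. -/
def dp (p : MIdx d) : VSpace d := (mfact p : ℝ)⁻¹ • tr (.X p)

/-- `𝟏^a`. -/
def tExt (a : ℝ) : VSpace d := tr (.ext a)

/-- `X^i`. -/
def tX (i : Fin d) : VSpace d := tr (.X (Pi.single i 1))

lemma tExt_zero : (tExt 0 : VSpace d) = 1 := rfl

lemma tExt_add (a b : ℝ) : (tExt (a + b) : VSpace d) = tExt a * tExt b := by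
  rw [tExt, Tree.ext_add, tr_mul]; rfl

lemma tr_prod {ι : Type*} (s : Finset ι) (f : ι → Tree d) :
    tr (∏ i ∈ s, f i) = ∏ i ∈ s, tr (f i) :=
  map_prod (MonoidAlgebra.of ℝ (Tree d)) f s

lemma tr_pow (τ : Tree d) (n : ℕ) : tr (τ ^ n) = tr τ ^ n :=
  map_pow (MonoidAlgebra.of ℝ (Tree d)) τ n

lemma tr_X (k : MIdx d) : tr (.X k) = ∏ i, tX i ^ k i := by
  rw [Tree.X_eq_prod, tr_prod]
  simp only [tr_pow]
  rfl

/-! ### Divided powers -/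

section DividedPowers

variable {W : Type*} [CommRing W] [Algebra ℝ W]

/-- `a^k / k!`. -/
def dpow (a : Fin d → W) (k : MIdx d) : W := (mfact k : ℝ)⁻¹ • ∏ i, a i ^ k i

lemma dp_eq_dpow (p : MIdx d) : dp p = dpow tX p := by
  rw [dp, dpow, tr_X]

lemma map_dpow {W' F : Type*} [CommRing W'] [Algebra ℝ W'] [FunLike F W W'] [AlgHomClass F ℝ W W']
    (f : F) (a : Fin d → W) (k : MIdx d) : f (dpow a k) = dpow (fun i => f (a i)) k := by
  simp [dpow]

lemma dpow_zero (a : Fin d → W) : dpow a 0 = 1 := by simp [dpow, mfact]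

lemma dpow_mul (a c : Fin d → W) (k : MIdx d) :
    dpow (fun i => a i * c i) k = dpow a k * ∏ i, c i ^ k i := by
  simp [dpow, mul_pow, Finset.prod_mul_distrib]

lemma dpow_eq_prod (a : Fin d → W) (k : MIdx d) :
    dpow a k = ∏ i, (((k i).factorial : ℝ)⁻¹ • a i ^ k i) := by
  simp [dpow, mfact, Finset.prod_smul]

lemma dpow_one_add (a b : W) (n : ℕ) :
    ((n.factorial : ℝ)⁻¹ • (a + b) ^ n : W) = ∑ j ∈ Finset.Iic n,
      (((j.factorial : ℝ)⁻¹ • a ^ j) * (((n - j).factorial : ℝ)⁻¹ • b ^ (n - j))) := by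
  rw [add_pow, Finset.smul_sum, Nat.range_succ_eq_Iic]
  refine Finset.sum_congr rfl fun j hj => ?_
  have hj : j ≤ n := Finset.mem_Iic.1 hj
  rw [smul_mul_smul_comm, mul_comm _ ((n.choose j : ℕ) : W), ← nsmul_eq_mul,
    ← Nat.cast_smul_eq_nsmul ℝ, smul_smul]
  congr 1
  rw [Nat.cast_choose ℝ hj]
  field_simp

lemma Iic_eq_piFinset (k : MIdx d) : Finset.Iic k = Fintype.piFinset fun i => Finset.Iic (k i) := by
  ext n
  simp [Pi.le_def]

/-- Divided powers absorb the binomial coefficients. The factors 1/e_A! and the binomials of n over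
n_A in the extraction formula thereby become one and the same exponential rule. -/
lemma dpow_add (a b : Fin d → W) (k : MIdx d) :
    dpow (fun i => a i + b i) k = ∑ n ∈ Finset.Iic k, dpow a n * dpow b (k - n) := by
  simp only [dpow_eq_prod, dpow_one_add, Finset.prod_univ_sum, Iic_eq_piFinset,
    ← Finset.prod_mul_distrib, Pi.sub_apply]

-- Substitution p = n, q = k - n. The box is closed downwards, so the pairs that arise are exactly
-- those with p + q in the box.
open Classical in
lemma sum_box_add {A : Type*} [AddCommMonoid A] (b : MIdx d) (H : MIdx d → MIdx d → A) :
    ∑ k ∈ Finset.Iic b, ∑ n ∈ Finset.Iic k, H n (k - n) =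
      ∑ p ∈ Finset.Iic b, ∑ q ∈ Finset.Iic b, if p + q ≤ b then H p q else 0 := by
  rw [Finset.sum_sigma', ← Finset.sum_product', ← Finset.sum_filter]
  refine Finset.sum_bij' (fun x _ => (x.2, x.1 - x.2)) (fun x _ => ⟨x.1 + x.2, x.1⟩) ?_ ?_ ?_ ?_ ?_
  · rintro ⟨k, n⟩ h
    simp only [Finset.mem_sigma, Finset.mem_Iic, Finset.mem_filter, Finset.mem_product] at h ⊢
    exact ⟨⟨h.2.trans h.1, tsub_le_self.trans h.1⟩, by rw [add_tsub_cancel_of_le h.2]; exact h.1⟩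
  · rintro ⟨p, q⟩ h
    simp only [Finset.mem_sigma, Finset.mem_Iic, Finset.mem_filter, Finset.mem_product] at h ⊢
    exact ⟨h.2, le_self_add⟩
  · rintro ⟨k, n⟩ h
    simp only [Finset.mem_sigma, Finset.mem_Iic] at h ⊢
    simp [add_tsub_cancel_of_le h.2]
  · rintro ⟨p, q⟩ h
    simp
  · rintro ⟨k, n⟩ h
    rfl

open Classical in
/-- Addition formula for exponential series with coefficients supported in a box. -/
lemma sum_dpow_add {A : Type*} [AddCommGroup A] [Module W A] (b : MIdx d) (x y : Fin d → W)
    (F : MIdx d → A) (hF : ∀ n, ¬ n ≤ b → F n = 0) :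
    ∑ k ∈ Finset.Iic b, dpow (fun i => x i + y i) k • F k =
      ∑ p ∈ Finset.Iic b, ∑ q ∈ Finset.Iic b, dpow x p • dpow y q • F (p + q) := by
  -- Since `F` vanishes outside the box, the constraint p + q ≤ b can be inserted for free, and p
  -- and q range independently.
  have h : ∀ p q, dpow x p • dpow y q • F (p + q) =
      if p + q ≤ b then dpow x p • dpow y q • F (p + q) else 0 := by
    intro p q
    split_ifs with h
    · rfl
    · rw [hF _ h, smul_zero, smul_zero]
  refine (Finset.sum_congr rfl fun k _ => ?_).trans
    ((sum_box_add b fun p q => dpow x p • dpow y q • F (p + q)).trans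
      (Finset.sum_congr rfl fun p _ => Finset.sum_congr rfl fun q _ => (h p q).symm))
  rw [dpow_add, Finset.sum_smul]
  refine Finset.sum_congr rfl fun n hn => ?_
  rw [add_tsub_cancel_of_le (Finset.mem_Iic.1 hn), mul_smul]

end DividedPowers

/-! ### Multiplicative recursion on trees -/

/-- Data for a multiplicative recursion on trees with values in an algebra. -/
structure TreeRec (d : ℕ) (W : Type*) [CommRing W] [Algebra ℝ W] where
  ext : ℝ → W
  ext_zero : ext 0 = 1
  ext_add : ∀ a b, ext (a + b) = ext a * ext b
  X : Fin d → W
  Xi : MIdx d → W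
  -- The branch is passed along with its value: in recentring, the polynomial terms depend on the
  -- branch itself and not only on its image.
  I : MIdx d → Tree d → W → W

namespace TreeRec

variable {W : Type*} [CommRing W] [Algebra ℝ W] (r : TreeRec d W)

def pre : PTree d → W
  | .root a k => r.ext a * ∏ i, r.X i ^ k i
  | .noise l t => r.Xi l * pre t
  | .kern m s t => r.I m (.mk s) (pre s) * pre t

lemma pre_step {t t' : PTree d} (h : PTree.Step t t') : r.pre t = r.pre t' := by
  induction h with
  | noise_noise => exact mul_left_comm _ _ _
  | noise_kern => exact mul_left_comm _ _ _
  | kern_kern => exact mul_left_comm _ _ _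
  | noise_congr _ _ ih => simp only [pre, ih]
  | kern_congr_left m t h ih => simp only [pre, ih, Tree.mk, Quot.sound h]
  | kern_congr_right _ _ _ ih => simp only [pre, ih]

def tree : Tree d → W := Quot.lift r.pre fun _ _ => r.pre_step

lemma pre_addRoot (a : ℝ) (k : MIdx d) (t : PTree d) :
    r.pre (t.addRoot a k) = (r.ext a * ∏ i, r.X i ^ k i) * r.pre t := by
  induction t with
  | root c p =>
    simp only [PTree.addRoot, pre, r.ext_add, Pi.add_apply, pow_add, Finset.prod_mul_distrib]
    ring
  | noise l t ih => simp only [PTree.addRoot, pre, ih]; ring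
  | kern m s t _ ih => simp only [PTree.addRoot, pre, ih]; ring

lemma pre_mul (t u : PTree d) : r.pre (t.mul u) = r.pre t * r.pre u := by
  induction t with
  | root c p => simp only [PTree.mul, pre_addRoot, pre]
  | noise l t ih => simp only [PTree.mul, pre, ih, mul_assoc]
  | kern m s t _ ih => simp only [PTree.mul, pre, ih, mul_assoc]

lemma pre_root_zero : r.pre (.root 0 0) = 1 := by simp [pre, r.ext_zero]

/-- The algebra morphism defined by the recursion. -/
def hom : VSpace d →ₐ[ℝ] W := MonoidAlgebra.lift ℝ W (Tree d)
  { toFun := r.tree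
    map_one' := r.pre_root_zero
    map_mul' := by
      rintro ⟨t⟩ ⟨u⟩
      exact r.pre_mul t u }

lemma hom_mk (t : PTree d) : r.hom (tr (.mk t)) = r.pre t := by
  simp [hom, tr]; rfl

lemma hom_ext (a : ℝ) : r.hom (tExt a) = r.ext a := by
  refine (r.hom_mk (.root a 0)).trans ?_
  simp [pre]

lemma hom_X (i : Fin d) : r.hom (tX i) = r.X i := by
  refine (r.hom_mk (.root 0 (Pi.single i 1))).trans ?_
  rw [pre, r.ext_zero, one_mul, Finset.prod_eq_single i] <;> simp +contextual

lemma hom_Xi (l : MIdx d) : r.hom (tr (.Xi l)) = r.Xi l := by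
  refine (r.hom_mk (.noise l (.root 0 0))).trans ?_
  rw [pre, pre_root_zero, mul_one]

lemma hom_I (m : MIdx d) (σ : Tree d) : r.hom (tr (.I m σ)) = r.I m σ (r.hom (tr σ)) := by
  obtain ⟨s⟩ := σ
  refine (r.hom_mk (.kern m s (.root 0 0))).trans ?_
  rw [pre, pre_root_zero, mul_one, ← hom_mk]
  rfl

end TreeRec

/-- Two algebra morphisms on trees agree if they agree on generators. -/
theorem algHom_ext_gen {W : Type*} [CommRing W] [Algebra ℝ W] {F G : VSpace d →ₐ[ℝ] W}
    (ext : ∀ a, F (tExt a) = G (tExt a)) (X : ∀ i, F (tX i) = G (tX i))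
    (Xi : ∀ l, F (tr (.Xi l)) = G (tr (.Xi l)))
    (I : ∀ m σ, F (tr σ) = G (tr σ) → F (tr (.I m σ)) = G (tr (.I m σ))) : F = G := by
  have h : F.toLinearMap = G.toLinearMap := by
    refine linMap_ext fun τ => ?_
    change F _ = G _
    induction τ using Tree.induction_gen with
    | ext a => exact ext a
    | X i => exact X i
    | Xi l => exact Xi l
    | I m σ h => exact I m σ h
    | mul σ τ h1 h2 => rw [tr_mul, map_mul, map_mul, h1, h2]
  exact AlgHom.ext fun v => LinearMap.congr_fun h v

end RegStr
end

/-! ### Truncated operators: coassociativity, cointeraction and the group law of recentrings. -/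

noncomputable section

namespace RegStr

variable {d : ℕ}

/-! ### Truncated coactions

All edge decorations are restricted to the box `Iic b`; the sums over boundary decorations are then
finite, and trees with an edge decoration outside the box are treated as zero. -/

section Truncated

open Classical in
/-- `I_m`, or zero if `m` is outside the box. -/
def integB (b m : MIdx d) : VSpace d →ₗ[ℝ] VSpace d := if m ≤ b then integ m else 0

open Classical in
/-- `Ξ_l`, or zero if `l` is outside the box. -/
def xiB (b l : MIdx d) : VSpace d := if l ≤ b then tr (.Xi l) else 0

lemma integB_of_not_le {b m : MIdx d} (h : ¬ m ≤ b) : integB b m = 0 := if_neg h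

lemma xiB_of_not_le {b l : MIdx d} (h : ¬ l ≤ b) : xiB b l = 0 := if_neg h

lemma integB_of_le {b m : MIdx d} (h : m ≤ b) : integB b m = integ m := if_pos h

lemma xiB_of_le {b l : MIdx d} (h : l ≤ b) : xiB b l = tr (.Xi l) := if_pos h

/-- Decorations outside the box stay outside when they are raised. This makes it consistent to treat
edges outside the box as zero in every identity below. -/
lemma not_add_le {b m : MIdx d} (h : ¬ m ≤ b) (p : MIdx d) : ¬ m + p ≤ b :=
  fun h' => h (le_self_add.trans h')

/-- Contraction of the first factor with a linear functional. -/
def contrL {W : Type*} [AddCommGroup W] [Module ℝ W] (g : VSpace d →ₗ[ℝ] ℝ) :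
    VSpace d ⊗[ℝ] W →ₗ[ℝ] W :=
  (TensorProduct.lid ℝ W).toLinearMap ∘ₗ TensorProduct.map g LinearMap.id

lemma contrL_tmul {W : Type*} [AddCommGroup W] [Module ℝ W] (g : VSpace d →ₗ[ℝ] ℝ) (v : VSpace d)
    (w : W) : contrL g (v ⊗ₜ[ℝ] w) = g v • w := by simp [contrL]

variable (P : Degrees d) (b : MIdx d)

/-- The recursion for the pair `(D₀, D₁)`: the sum over the subforests which avoid the root, and the
sum over those which contain it, with the component of the root in the first tensor factor; all
other components are evaluated with `g`. -/
def extractRec (g : VSpace d →ₗ[ℝ] ℝ) : TreeRec d (VSpace d × (VSpace d ⊗[ℝ] VSpace d)) where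
  ext a := (tExt a, tExt a ⊗ₜ tExt a)
  ext_zero := rfl
  ext_add x y := by simp [tExt_add]
  -- A factor X_i at an extracted root is either counted by n_A, moving to the component and leaving
  -- its degree as an extended decoration, or it stays on the contracted node.
  X i := (tX i, tX i ⊗ₜ tExt (P.scaling i) + 1 ⊗ₜ tX i)
  Xi l := (xiB b l, xiB b l ⊗ₜ tExt (P.degNoise - P.deg l) +
    ∑ p ∈ Finset.Iic b, dp p ⊗ₜ (tExt (P.deg p) * xiB b (l + p)))
  -- `w.1 + contrL g w.2` is M_g of the branch: an edge outside A imposes nothing on the branch. If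
  -- the edge is in A, the root component of the branch is grafted onto that of the tree, and the
  -- edge leaves its degree behind. The sum over `p` runs over the decorations of a boundary edge.
  I m _ w := (integB b m (w.1 + contrL g w.2),
    TensorProduct.map (integB b m) (LinearMap.mulLeft ℝ (tExt (P.degKernel - P.deg m))) w.2 +
    ∑ p ∈ Finset.Iic b, dp p ⊗ₜ (tExt (P.deg p) * integB b (m + p) (w.1 + contrL g w.2)))

/-- Sum over the subforests which avoid the root. -/
def D0 (g : VSpace d →ₗ[ℝ] ℝ) : VSpace d →ₐ[ℝ] VSpace d :=
  (AlgHom.fst ℝ _ _).comp (extractRec P b g).hom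

/-- Sum over the subforests which contain the root. -/
def D1 (g : VSpace d →ₗ[ℝ] ℝ) : VSpace d →ₐ[ℝ] VSpace d ⊗[ℝ] VSpace d :=
  (AlgHom.snd ℝ _ _).comp (extractRec P b g).hom

/-- The truncated map `M_g`. -/
def MB (g : VSpace d →ₗ[ℝ] ℝ) : VSpace d →ₗ[ℝ] VSpace d :=
  (D0 P b g).toLinearMap + contrL g ∘ₗ (D1 P b g).toLinearMap

variable (g : VSpace d →ₗ[ℝ] ℝ)

lemma MB_apply (v : VSpace d) : MB P b g v = D0 P b g v + contrL g (D1 P b g v) := rfl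

lemma D0_ext (a : ℝ) : D0 P b g (tExt a) = tExt a := by simp [D0, TreeRec.hom_ext, extractRec]

lemma D0_X (i : Fin d) : D0 P b g (tX i) = tX i := by simp [D0, TreeRec.hom_X, extractRec]

lemma D0_Xi (l : MIdx d) : D0 P b g (tr (.Xi l)) = xiB b l := by
  simp [D0, TreeRec.hom_Xi, extractRec]

lemma D0_I (m : MIdx d) (v : VSpace d) : D0 P b g (integ m v) = integB b m (MB P b g v) := by
  refine LinearMap.congr_fun (f := (D0 P b g).toLinearMap ∘ₗ integ m)
    (g := integB b m ∘ₗ MB P b g) (linMap_ext fun τ => ?_) v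
  simp only [LinearMap.comp_apply, integ_tr]
  exact congrArg Prod.fst ((extractRec P b g).hom_I m τ)

lemma D1_ext (a : ℝ) : D1 P b g (tExt a) = tExt a ⊗ₜ tExt a := by
  simp [D1, TreeRec.hom_ext, extractRec]

lemma D1_X (i : Fin d) : D1 P b g (tX i) = tX i ⊗ₜ tExt (P.scaling i) + 1 ⊗ₜ tX i := by
  simp [D1, TreeRec.hom_X, extractRec]

lemma D1_Xi (l : MIdx d) : D1 P b g (tr (.Xi l)) = xiB b l ⊗ₜ tExt (P.degNoise - P.deg l) +
    ∑ p ∈ Finset.Iic b, dp p ⊗ₜ (tExt (P.deg p) * xiB b (l + p)) := by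
  simp [D1, TreeRec.hom_Xi, extractRec]

lemma D1_I (m : MIdx d) (v : VSpace d) : D1 P b g (integ m v) =
    TensorProduct.map (integB b m) (LinearMap.mulLeft ℝ (tExt (P.degKernel - P.deg m)))
      (D1 P b g v) +
    ∑ p ∈ Finset.Iic b, dp p ⊗ₜ (tExt (P.deg p) * integB b (m + p) (MB P b g v)) := by
  have h := LinearMap.congr_fun (f := (D1 P b g).toLinearMap ∘ₗ integ m)
    (g := TensorProduct.map (integB b m) (LinearMap.mulLeft ℝ (tExt (P.degKernel - P.deg m))) ∘ₗ
      (D1 P b g).toLinearMap +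
    ∑ p ∈ Finset.Iic b, TensorProduct.mk ℝ _ _ (dp p) ∘ₗ LinearMap.mulLeft ℝ (tExt (P.deg p)) ∘ₗ
      integB b (m + p) ∘ₗ MB P b g) (linMap_ext fun τ => ?_) v
  · simpa [LinearMap.add_apply, LinearMap.sum_apply] using h
  · simp only [LinearMap.add_apply, LinearMap.sum_apply, LinearMap.comp_apply, integ_tr]
    exact congrArg Prod.snd ((extractRec P b g).hom_I m τ)

lemma D0_dp (p : MIdx d) : D0 P b g (dp p) = dp p := by
  simp only [dp_eq_dpow, map_dpow, D0_X]

lemma D0_xiB (l : MIdx d) : D0 P b g (xiB b l) = xiB b l := by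
  by_cases h : l ≤ b
  · rw [xiB_of_le h, D0_Xi, xiB_of_le h]
  · rw [xiB_of_not_le h, map_zero]

lemma D0_integB (m : MIdx d) (v : VSpace d) :
    D0 P b g (integB b m v) = integB b m (MB P b g v) := by
  by_cases h : m ≤ b
  · rw [integB_of_le h, D0_I, integB_of_le h]
  · simp [integB_of_not_le h]

lemma D1_xiB (l : MIdx d) : D1 P b g (xiB b l) = xiB b l ⊗ₜ tExt (P.degNoise - P.deg l) +
    ∑ p ∈ Finset.Iic b, dp p ⊗ₜ (tExt (P.deg p) * xiB b (l + p)) := by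
  by_cases h : l ≤ b
  · rw [← D1_Xi P b g, xiB_of_le h]
  · simp [xiB_of_not_le h, xiB_of_not_le (not_add_le h _)]

lemma D1_integB (m : MIdx d) (v : VSpace d) : D1 P b g (integB b m v) =
    TensorProduct.map (integB b m) (LinearMap.mulLeft ℝ (tExt (P.degKernel - P.deg m)))
      (D1 P b g v) +
    ∑ p ∈ Finset.Iic b, dp p ⊗ₜ (tExt (P.deg p) * integB b (m + p) (MB P b g v)) := by
  by_cases h : m ≤ b
  · rw [← D1_I P b g, integB_of_le h]
  · simp [integB_of_not_le h, integB_of_not_le (not_add_le h _)]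

lemma tExt_deg (p : MIdx d) : (tExt (P.deg p) : VSpace d) = ∏ i, tExt (P.scaling i) ^ p i := by
  let F : Multiplicative ℝ →* VSpace d :=
    { toFun := fun a => tExt a.toAdd, map_one' := rfl, map_mul' := fun a c => tExt_add _ _ }
  have h : ∀ a : ℝ, tExt a = F (Multiplicative.ofAdd a) := fun a => rfl
  simp only [h, Degrees.deg, ofAdd_sum, map_prod]
  refine Finset.prod_congr rfl fun i _ => ?_
  rw [← nsmul_eq_mul, ofAdd_nsmul, map_pow]

lemma dpow_tmul_ext (p : MIdx d) :
    dpow (fun i => (tX i ⊗ₜ[ℝ] tExt (P.scaling i) : VSpace d ⊗[ℝ] VSpace d)) p =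
      dp p ⊗ₜ tExt (P.deg p) := by
  have h : (fun i => (tX i ⊗ₜ[ℝ] tExt (P.scaling i) : VSpace d ⊗[ℝ] VSpace d)) = fun i =>
      Algebra.TensorProduct.includeLeft (R := ℝ) (S := ℝ) (tX i) *
      Algebra.TensorProduct.includeRight (R := ℝ) (tExt (P.scaling i)) := by
    ext i
    simp
  rw [h, dpow_mul, ← map_dpow, ← dp_eq_dpow]
  simp only [← map_pow, ← map_prod]
  rw [← tExt_deg]
  simp

lemma D1_dp (p : MIdx d) : D1 P b g (dp p) =
    dpow (fun i => (tX i ⊗ₜ[ℝ] tExt (P.scaling i) + 1 ⊗ₜ tX i : VSpace d ⊗[ℝ] VSpace d)) p := by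
  simp only [dp_eq_dpow, map_dpow, D1_X]

lemma dpow_one_tmul {W : Type*} [CommRing W] [Algebra ℝ W] (p : MIdx d) :
    dpow (fun i => (1 ⊗ₜ[ℝ] tX i : W ⊗[ℝ] VSpace d)) p = 1 ⊗ₜ dp p := by
  rw [dp_eq_dpow]
  exact (map_dpow (Algebra.TensorProduct.includeRight (R := ℝ) (A := W)) tX p).symm

/-- Shift formula for series with coefficients supported in the box. -/
lemma sum_D1_dp {W : Type*} [AddCommGroup W] [Module (VSpace d ⊗[ℝ] VSpace d) W]
    (F : MIdx d → W) (hF : ∀ n, ¬ n ≤ b → F n = 0) :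
    ∑ k ∈ Finset.Iic b, D1 P b g (dp k) • F k =
      ∑ p ∈ Finset.Iic b, ∑ q ∈ Finset.Iic b,
        (dp p ⊗ₜ[ℝ] (tExt (P.deg p) * dp q) : VSpace d ⊗[ℝ] VSpace d) • F (p + q) := by
  simp only [D1_dp]
  rw [sum_dpow_add b _ _ F hF]
  refine Finset.sum_congr rfl fun p _ => Finset.sum_congr rfl fun q _ => ?_
  rw [dpow_tmul_ext, dpow_one_tmul, smul_smul]
  simp

/-! ### Composition of truncated extractions -/

variable (h : VSpace d →ₗ[ℝ] ℝ)

/-- The functional `k` with `M_h M_g = M_k`. -/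
def compFun : VSpace d →ₗ[ℝ] ℝ := g + h ∘ₗ MB P b g

/-- The coassociativity identities at `v`. -/
structure Coassoc (v : VSpace d) : Prop where
  -- A two-stage extraction, first with `g` and then with `h`, is sorted by the stages whose
  -- component contains the root. The four fields are: neither, the second only, both, the first
  -- only.
  avoid : D0 P b (compFun P b g h) v = D0 P b h (D0 P b g v)
  left : Algebra.TensorProduct.map (D0 P b g) (AlgHom.id ℝ (VSpace d))
    (D1 P b (compFun P b g h) v) = D1 P b h (D0 P b g v)
  both : Algebra.TensorProduct.assoc ℝ ℝ ℝ (VSpace d) (VSpace d) (VSpace d)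
    (Algebra.TensorProduct.map (D1 P b g) (AlgHom.id ℝ (VSpace d)) (D1 P b (compFun P b g h) v)) =
      Algebra.TensorProduct.map (AlgHom.id ℝ (VSpace d)) (D1 P b h) (D1 P b g v)
  right : Algebra.TensorProduct.map (AlgHom.id ℝ (VSpace d)) (D0 P b h) (D1 P b g v) =
    D1 P b (compFun P b g h) v

variable {P b g h} in
lemma Coassoc.mul {v w : VSpace d} (hv : Coassoc P b g h v) (hw : Coassoc P b g h w) :
    Coassoc P b g h (v * w) where
  avoid := by simp only [map_mul, hv.avoid, hw.avoid]
  left := by simp only [map_mul, hv.left, hw.left]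
  both := by simp only [map_mul, hv.both, hw.both]
  right := by simp only [map_mul, hv.right, hw.right]

-- Sum of `left` and of `both` with its first tensor factor evaluated by `g`: an inner extraction in
-- the root component either avoids the root or contains it.
variable {P b g h} in
lemma Coassoc.map_MB {v : VSpace d} (hv : Coassoc P b g h v) :
    TensorProduct.map (MB P b g) LinearMap.id (D1 P b (compFun P b g h) v) =
      D1 P b h (MB P b g v) := by
  have h1 : ∀ z : VSpace d ⊗[ℝ] VSpace d, TensorProduct.map (MB P b g) LinearMap.id z =
      Algebra.TensorProduct.map (D0 P b g) (AlgHom.id ℝ (VSpace d)) z +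
      contrL g (Algebra.TensorProduct.assoc ℝ ℝ ℝ (VSpace d) (VSpace d) (VSpace d)
        (Algebra.TensorProduct.map (D1 P b g) (AlgHom.id ℝ (VSpace d)) z)) := by
    intro z
    induction z with
    | zero => simp
    | add z w hz hw => simp only [map_add, hz, hw]; abel
    | tmul x y =>
      simp only [TensorProduct.map_tmul, MB_apply, Algebra.TensorProduct.map_tmul,
        TensorProduct.add_tmul, AlgHom.coe_id, id_eq, LinearMap.id_coe]
      congr 1
      generalize D1 P b g x = u
      induction u with
      | zero => simp
      | add z w hz hw => simp only [map_add, hz, hw, TensorProduct.add_tmul]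
      | tmul x z => simp [contrL_tmul, TensorProduct.smul_tmul']
  have h2 : ∀ z : VSpace d ⊗[ℝ] VSpace d,
      contrL g (Algebra.TensorProduct.map (AlgHom.id ℝ (VSpace d)) (D1 P b h) z) =
      D1 P b h (contrL g z) := by
    intro z
    induction z with
    | zero => simp
    | add z w hz hw => simp only [map_add, hz, hw]
    | tmul x y => simp [contrL_tmul]
  rw [h1, hv.both, hv.left, h2, ← map_add, MB_apply]

-- Evaluating the root component with k = g + h ∘ M_g produces two terms. The `g` term goes with the
-- root being extracted at the first stage only (`right`), the other with extraction at the second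
-- stage (`map_MB`).
variable {P b g h} in
lemma Coassoc.MB_MB {v : VSpace d} (hv : Coassoc P b g h v) :
    MB P b h (MB P b g v) = MB P b (compFun P b g h) v := by
  have h1 : ∀ z : VSpace d ⊗[ℝ] VSpace d, contrL (compFun P b g h) z = contrL g z +
      contrL h (TensorProduct.map (MB P b g) LinearMap.id z) := by
    intro z
    induction z with
    | zero => simp
    | add z w hz hw => simp only [map_add, hz, hw]; abel
    | tmul x y => simp [contrL_tmul, compFun, add_smul]
  have h2 : ∀ z : VSpace d ⊗[ℝ] VSpace d, D0 P b h (contrL g z) =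
      contrL g (Algebra.TensorProduct.map (AlgHom.id ℝ (VSpace d)) (D0 P b h) z) := by
    intro z
    induction z with
    | zero => simp
    | add z w hz hw => simp only [map_add, hz, hw]
    | tmul x y => simp [contrL_tmul]
  rw [MB_apply P b h, ← hv.map_MB, MB_apply P b (compFun P b g h), h1, ← add_assoc]
  congr 1
  rw [MB_apply, map_add, hv.avoid, h2, hv.right]

/-- A boundary decoration k of the composite component is split as k = p + q, where p is created by
the inner extraction and q by the outer one. -/
lemma sum_assoc_D1_dp (G : MIdx d → VSpace d) (hG : ∀ n, ¬ n ≤ b → G n = 0) :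
    ∑ k ∈ Finset.Iic b, Algebra.TensorProduct.assoc ℝ ℝ ℝ (VSpace d) (VSpace d) (VSpace d)
      (D1 P b g (dp k) ⊗ₜ[ℝ] (tExt (P.deg k) * G k)) =
      ∑ p ∈ Finset.Iic b, dp p ⊗ₜ[ℝ] ((tExt (P.deg p) ⊗ₜ[ℝ] tExt (P.deg p)) *
        ∑ q ∈ Finset.Iic b, dp q ⊗ₜ[ℝ] (tExt (P.deg q) * G (p + q))) := by
  have h := sum_D1_dp P b g (W := (VSpace d ⊗[ℝ] VSpace d) ⊗[ℝ] VSpace d)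
    (fun n => 1 ⊗ₜ[ℝ] (tExt (P.deg n) * G n)) (fun n hn => by simp [hG n hn])
  simp only [TensorProduct.smul_tmul', smul_eq_mul, mul_one] at h
  rw [← map_sum, h]
  simp only [map_sum, Algebra.TensorProduct.assoc_tmul, Finset.mul_sum, TensorProduct.tmul_sum,
    Algebra.TensorProduct.tmul_mul_tmul, P.deg_add, tExt_add, mul_assoc]

lemma MB_MB_aux (m : MIdx d) (z : VSpace d ⊗[ℝ] VSpace d) (a : VSpace d) :
    Algebra.TensorProduct.map (D0 P b g) (AlgHom.id ℝ (VSpace d))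
      (TensorProduct.map (integB b m) (LinearMap.mulLeft ℝ a) z) =
    TensorProduct.map (integB b m) (LinearMap.mulLeft ℝ a)
      (TensorProduct.map (MB P b g) LinearMap.id z) := by
  induction z with
  | zero => simp
  | add z w hz hw => simp only [map_add, hz, hw]
  | tmul x y => simp [D0_integB]

lemma MB_MB_aux' (m : MIdx d) (z : VSpace d ⊗[ℝ] VSpace d) (a : ℝ) :
    Algebra.TensorProduct.map (AlgHom.id ℝ (VSpace d)) (D0 P b g)
      (TensorProduct.map (integB b m) (LinearMap.mulLeft ℝ (tExt a)) z) =
    TensorProduct.map (integB b m) (LinearMap.mulLeft ℝ (tExt a))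
      (Algebra.TensorProduct.map (AlgHom.id ℝ (VSpace d)) (D0 P b g) z) := by
  induction z with
  | zero => simp
  | add z w hz hw => simp only [map_add, hz, hw]
  | tmul x y => simp [D0_ext]

/-- Multiplication by `𝟏^a ⊗ 𝟏^a`. -/
def mulExt2 (a : ℝ) : VSpace d ⊗[ℝ] VSpace d →ₗ[ℝ] VSpace d ⊗[ℝ] VSpace d :=
  LinearMap.mulLeft ℝ (tExt a ⊗ₜ tExt a)

lemma assoc_D1_map (m : MIdx d) (z : VSpace d ⊗[ℝ] VSpace d) :
    Algebra.TensorProduct.assoc ℝ ℝ ℝ (VSpace d) (VSpace d) (VSpace d)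
      (Algebra.TensorProduct.map (D1 P b g) (AlgHom.id ℝ (VSpace d))
        (TensorProduct.map (integB b m)
          (LinearMap.mulLeft ℝ (tExt (P.degKernel - P.deg m))) z)) =
    TensorProduct.map (integB b m) (mulExt2 (P.degKernel - P.deg m))
      (Algebra.TensorProduct.assoc ℝ ℝ ℝ (VSpace d) (VSpace d) (VSpace d)
        (Algebra.TensorProduct.map (D1 P b g) (AlgHom.id ℝ (VSpace d)) z)) +
    ∑ p ∈ Finset.Iic b, dp p ⊗ₜ ((tExt (P.deg p) ⊗ₜ[ℝ] 1) *
      TensorProduct.map (integB b (m + p)) (LinearMap.mulLeft ℝ (tExt (P.degKernel - P.deg m)))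
      (TensorProduct.map (MB P b g) LinearMap.id z)) := by
  induction z with
  | zero => simp
  | add z w hz hw =>
    simp only [map_add, hz, hw, mul_add, TensorProduct.tmul_add, Finset.sum_add_distrib]
    abel
  | tmul x y =>
    simp only [TensorProduct.map_tmul, Algebra.TensorProduct.map_tmul, D1_integB,
      TensorProduct.add_tmul, map_add, TensorProduct.sum_tmul, map_sum,
      Algebra.TensorProduct.assoc_tmul, AlgHom.coe_id, id_eq, LinearMap.id_coe,
      Algebra.TensorProduct.tmul_mul_tmul, one_mul]
    congr 1
    generalize D1 P b g x = u
    induction u with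
    | zero => simp
    | add z w hz hw => simp only [map_add, hz, hw, TensorProduct.add_tmul]
    | tmul x z => simp [mulExt2, Algebra.TensorProduct.tmul_mul_tmul]

lemma map_D1_mulExt (m : MIdx d) (z : VSpace d ⊗[ℝ] VSpace d) (a : ℝ) :
    Algebra.TensorProduct.map (AlgHom.id ℝ (VSpace d)) (D1 P b g)
      (TensorProduct.map (integB b m) (LinearMap.mulLeft ℝ (tExt a)) z) =
    TensorProduct.map (integB b m) (mulExt2 a)
      (Algebra.TensorProduct.map (AlgHom.id ℝ (VSpace d)) (D1 P b g) z) := by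
  induction z with
  | zero => simp
  | add z w hz hw => simp only [map_add, hz, hw]
  | tmul x y => simp [D1_ext, mulExt2]

/-- The edge may be contracted before or after its decoration has been raised by p. The two extended
decorations agree because |I_{m+p}| + |p| = |I_m|. -/
lemma ext_mul_map_integB (m p : MIdx d) (z : VSpace d ⊗[ℝ] VSpace d) :
    (tExt (P.deg p) ⊗ₜ[ℝ] tExt (P.deg p)) * TensorProduct.map (integB b (m + p))
      (LinearMap.mulLeft ℝ (tExt (P.degKernel - P.deg (m + p)))) z =
    (tExt (P.deg p) ⊗ₜ[ℝ] 1) * TensorProduct.map (integB b (m + p))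
      (LinearMap.mulLeft ℝ (tExt (P.degKernel - P.deg m))) z := by
  induction z with
  | zero => simp
  | add z w hz hw => simp only [map_add, mul_add, hz, hw]
  | tmul x y =>
    simp only [TensorProduct.map_tmul, LinearMap.mulLeft_apply, Algebra.TensorProduct.tmul_mul_tmul,
      one_mul, ← mul_assoc, ← tExt_add, P.deg_add]
    rw [show P.deg p + (P.degKernel - (P.deg m + P.deg p)) = P.degKernel - P.deg m by ring]

/-- Coassociativity of the truncated extraction. -/
theorem coassoc_tr (τ : Tree d) : Coassoc P b g h (tr τ) := by
  induction τ using Tree.induction_gen with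
  | ext a =>
    change Coassoc P b g h (tExt a)
    constructor <;> simp [D0_ext, D1_ext]
  | X i =>
    change Coassoc P b g h (tX i)
    constructor <;> simp [D0_X, D1_X, D1_ext, D0_ext, TensorProduct.add_tmul,
      TensorProduct.tmul_add, Algebra.TensorProduct.one_def, add_assoc]
  | Xi l =>
    have hF : ∀ n, ¬ n ≤ b → xiB b (l + n) = 0 := fun n hn =>
      xiB_of_not_le (by rw [add_comm]; exact not_add_le hn _)
    constructor
    · simp [D0_Xi, D0_xiB]
    · simp [D0_Xi, D1_Xi, D0_xiB, D1_xiB, D0_dp]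
    · simp only [D1_Xi, map_add, map_sum, Algebra.TensorProduct.map_tmul, D1_xiB,
        AlgHom.coe_id, id_eq, sum_assoc_D1_dp P b g _ hF, D1_ext, map_mul, mul_add,
        TensorProduct.add_tmul, TensorProduct.sum_tmul, Algebra.TensorProduct.assoc_tmul,
        TensorProduct.tmul_add, Finset.sum_add_distrib, add_assoc]
      congr 1
      -- The two sides differ only in extended decorations, which agree because |p| + |Ξ_{l+p}| =
      -- |Ξ_l|.
      simp only [Algebra.TensorProduct.tmul_mul_tmul, ← tExt_add, P.deg_add]
      congr 1
      refine Finset.sum_congr rfl fun p _ => ?_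
      congr 3
      ring
    · simp [D0_xiB, D1_Xi, D0_ext]
  | I m σ ih =>
    -- The four identities on the branch give M_h M_g = M_k there, and this is the form in which a
    -- branch enters below an edge outside the forest.
    have hM := ih.MB_MB
    have hF : ∀ n, ¬ n ≤ b → integB b (m + n) = 0 := fun n hn =>
      integB_of_not_le (by rw [add_comm]; exact not_add_le hn _)
    rw [← integ_tr]
    constructor
    · rw [D0_I, D0_I, D0_integB, hM]
    · simp only [D1_I, D0_I, D1_integB, map_add, map_sum, MB_MB_aux, ih.map_MB, hM,
        Algebra.TensorProduct.map_tmul, D0_dp, AlgHom.coe_id, id_eq]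
    · simp only [D1_I, map_add, map_sum, assoc_D1_map, ih.both, ih.map_MB,
        Algebra.TensorProduct.map_tmul, AlgHom.coe_id, id_eq,
        sum_assoc_D1_dp P b g (fun n => integB b (m + n) (MB P b (compFun P b g h) (tr σ)))
          (fun n hn => by simp [hF n hn]), map_D1_mulExt, map_mul, D1_ext, D1_integB,
        ext_mul_map_integB, mul_add, TensorProduct.tmul_add, Finset.sum_add_distrib, add_assoc, hM]
    · simp only [D1_I, map_add, map_sum, MB_MB_aux', ih.right, Algebra.TensorProduct.map_tmul,
        AlgHom.coe_id, id_eq, map_mul, D0_ext, D0_integB, hM]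
  | mul σ τ h1 h2 => rw [tr_mul]; exact h1.mul h2

lemma coassoc (v : VSpace d) : Coassoc P b g h v := by
  have h0 : ∀ {W : Type _} [AddCommGroup W] [Module ℝ W] {F G : VSpace d →ₗ[ℝ] W},
      (∀ τ, F (tr τ) = G (tr τ)) → F v = G v := fun H => LinearMap.congr_fun (linMap_ext H) v
  exact
    { avoid := h0 (F := (D0 P b (compFun P b g h)).toLinearMap)
        (G := (D0 P b h).toLinearMap ∘ₗ (D0 P b g).toLinearMap)
        fun τ => (coassoc_tr P b g h τ).avoid
      left := h0 (F := (Algebra.TensorProduct.map (D0 P b g) (AlgHom.id ℝ (VSpace d))).toLinearMap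
          ∘ₗ (D1 P b (compFun P b g h)).toLinearMap)
        (G := (D1 P b h).toLinearMap ∘ₗ (D0 P b g).toLinearMap)
        fun τ => (coassoc_tr P b g h τ).left
      both := h0 (F := ((Algebra.TensorProduct.assoc ℝ ℝ ℝ (VSpace d) (VSpace d)
            (VSpace d)).toAlgHom.comp
            (Algebra.TensorProduct.map (D1 P b g) (AlgHom.id ℝ (VSpace d)))).toLinearMap
          ∘ₗ (D1 P b (compFun P b g h)).toLinearMap)
        (G := (Algebra.TensorProduct.map (AlgHom.id ℝ (VSpace d)) (D1 P b h)).toLinearMap ∘ₗ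
          (D1 P b g).toLinearMap)
        fun τ => (coassoc_tr P b g h τ).both
      right := h0 (F := (Algebra.TensorProduct.map (AlgHom.id ℝ (VSpace d)) (D0 P b h)).toLinearMap
          ∘ₗ (D1 P b g).toLinearMap)
        (G := (D1 P b (compFun P b g h)).toLinearMap)
        fun τ => (coassoc_tr P b g h τ).right }

/-! ### Truncated recentring -/

/-- The recursion for the recentring operator `Γ` with parameters `x` and `φ`. -/
def gamRec (x : Fin d → ℝ) (φ : MIdx d → VSpace d →ₗ[ℝ] ℝ) : TreeRec d (VSpace d) where
  ext := tExt
  ext_zero := rfl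
  ext_add := tExt_add
  X i := tX i + algebraMap ℝ _ (x i)
  Xi := xiB b
  -- No degree condition appears in this sum. The degree cutoff is encoded later in the vanishing of
  -- `φ` on trees of nonpositive degree, so the algebra here is independent of degrees.
  I m σ w := integB b m w + ∑ k ∈ Finset.Iic b, φ (m + k) (tr σ) • dp k

/-- The truncated recentring operator. -/
def gamB (x : Fin d → ℝ) (φ : MIdx d → VSpace d →ₗ[ℝ] ℝ) : VSpace d →ₐ[ℝ] VSpace d :=
  (gamRec b x φ).hom

variable (x y : Fin d → ℝ) (φ ψ : MIdx d → VSpace d →ₗ[ℝ] ℝ)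

lemma gamB_ext (a : ℝ) : gamB b x φ (tExt a) = tExt a := TreeRec.hom_ext _ _

lemma gamB_X (i : Fin d) : gamB b x φ (tX i) = tX i + algebraMap ℝ _ (x i) := TreeRec.hom_X _ _

lemma gamB_Xi (l : MIdx d) : gamB b x φ (tr (.Xi l)) = xiB b l := TreeRec.hom_Xi _ _

lemma gamB_I (m : MIdx d) (v : VSpace d) : gamB b x φ (integ m v) =
    integB b m (gamB b x φ v) + ∑ k ∈ Finset.Iic b, φ (m + k) v • dp k := by
  have h := LinearMap.congr_fun (f := (gamB b x φ).toLinearMap ∘ₗ integ m)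
    (g := integB b m ∘ₗ (gamB b x φ).toLinearMap +
      ∑ k ∈ Finset.Iic b, (φ (m + k)).smulRight (dp k)) (linMap_ext fun τ => ?_) v
  · simpa [LinearMap.add_apply, LinearMap.sum_apply] using h
  · simp only [LinearMap.add_apply, LinearMap.sum_apply, LinearMap.comp_apply, integ_tr]
    exact (gamRec b x φ).hom_I m τ

lemma gamB_xiB (l : MIdx d) : gamB b x φ (xiB b l) = xiB b l := by
  by_cases h : l ≤ b
  · rw [xiB_of_le h, gamB_Xi, xiB_of_le h]
  · rw [xiB_of_not_le h, map_zero]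

-- Vanishing of `φ` outside the box is essential: for m outside it the left side is zero, so the
-- polynomial terms must vanish as well.
variable {φ ψ} in
lemma gamB_integB (hφ : ∀ n, ¬ n ≤ b → φ n = 0) (m : MIdx d) (v : VSpace d) :
    gamB b x φ (integB b m v) =
      integB b m (gamB b x φ v) + ∑ k ∈ Finset.Iic b, φ (m + k) v • dp k := by
  by_cases h : m ≤ b
  · rw [← gamB_I, integB_of_le h]
  · simp [integB_of_not_le h, fun k => hφ _ (not_add_le h k)]

lemma gamB_dp (p : MIdx d) :
    gamB b x φ (dp p) = dpow (fun i => tX i + algebraMap ℝ _ (x i)) p := by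
  simp only [dp_eq_dpow, map_dpow, gamB_X]

variable {φ} in
lemma sum_gamB_dp {W : Type*} [AddCommGroup W] [Module (VSpace d) W] (F : MIdx d → W)
    (hF : ∀ n, ¬ n ≤ b → F n = 0) :
    ∑ k ∈ Finset.Iic b, gamB b x φ (dp k) • F k = ∑ p ∈ Finset.Iic b, dp p •
      ∑ q ∈ Finset.Iic b, algebraMap ℝ (VSpace d) (dpow x q) • F (p + q) := by
  simp only [gamB_dp]
  rw [sum_dpow_add b _ _ F hF]
  simp only [Finset.smul_sum]
  refine Finset.sum_congr rfl fun p _ => Finset.sum_congr rfl fun q _ => ?_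
  rw [← dp_eq_dpow, ← Algebra.ofId_apply, map_dpow]
  rfl

/-- The function `(m, v) ↦ φ (m, M_g v)`. -/
def pullFun : MIdx d → VSpace d →ₗ[ℝ] ℝ := fun n => φ n ∘ₗ MB P b g

-- On I_m[σ] with its edge at the boundary, extraction puts X^p/p! on the component and recentring
-- then turns I_{m+p} into the sum of φ(m+p+q) X^q/q!. In the other order the polynomial X^k/k! is
-- created first and `D1` distributes it as k = p + q. The extraction inside σ is absorbed by
-- replacing φ with φ ∘ M_g.
variable {φ} in
theorem cointeract_tr (hφ : ∀ n, ¬ n ≤ b → φ n = 0) (τ : Tree d) :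
    gamB b x φ (D0 P b g (tr τ)) = D0 P b g (gamB b x (pullFun P b g φ) (tr τ)) ∧
    Algebra.TensorProduct.map (AlgHom.id ℝ (VSpace d)) (gamB b x φ) (D1 P b g (tr τ)) =
      D1 P b g (gamB b x (pullFun P b g φ) (tr τ)) := by
  have hmul : ∀ z w : VSpace d, Algebra.TensorProduct.map (AlgHom.id ℝ (VSpace d)) (gamB b x φ)
      (z ⊗ₜ w) = z ⊗ₜ gamB b x φ w := fun _ _ => rfl
  induction τ using Tree.induction_gen with
  | ext a =>
    change gamB b x φ (D0 P b g (tExt a)) = D0 P b g (gamB b x (pullFun P b g φ) (tExt a)) ∧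
      Algebra.TensorProduct.map (AlgHom.id ℝ (VSpace d)) (gamB b x φ) (D1 P b g (tExt a)) =
      D1 P b g (gamB b x (pullFun P b g φ) (tExt a))
    simp [D0_ext, D1_ext, gamB_ext]
  | X i =>
    change gamB b x φ (D0 P b g (tX i)) = D0 P b g (gamB b x (pullFun P b g φ) (tX i)) ∧
      Algebra.TensorProduct.map (AlgHom.id ℝ (VSpace d)) (gamB b x φ) (D1 P b g (tX i)) =
      D1 P b g (gamB b x (pullFun P b g φ) (tX i))
    simp only [D0_X, gamB_X, map_add, D1_X, hmul, gamB_ext, AlgHom.commutes, true_and,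
      TensorProduct.tmul_add, add_assoc]
    rw [Algebra.TensorProduct.algebraMap_apply, Algebra.algebraMap_eq_smul_one,
      TensorProduct.smul_tmul]
  | Xi l => simp [D0_Xi, gamB_xiB, gamB_Xi, D0_xiB, D1_xiB, D1_Xi, gamB_ext]
  | I m σ ih =>
    obtain ⟨h1, h2⟩ := ih
    have hM : gamB b x φ (MB P b g (tr σ)) = MB P b g (gamB b x (pullFun P b g φ) (tr σ)) := by
      rw [MB_apply, MB_apply, map_add, h1, ← h2]
      congr 1
      generalize D1 P b g (tr σ) = z
      induction z with
      | zero => simp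
      | add z w hz hw => simp only [map_add, hz, hw]
      | tmul x y => simp [contrL_tmul]
    have hψ : ∀ n, ¬ n ≤ b → pullFun P b g φ n = 0 := fun n hn => by
      rw [pullFun, hφ n hn, LinearMap.zero_comp]
    have hφ' : ∀ n, ¬ n ≤ b → φ (m + n) = 0 := fun n hn =>
      hφ _ (by rw [add_comm]; exact not_add_le hn _)
    rw [← integ_tr]
    constructor
    · simp only [D0_I, gamB_integB b x hφ, gamB_I, map_add, hM, D0_integB, map_sum, map_smul, D0_dp]
      rfl
    · have h3 : ∀ z : VSpace d ⊗[ℝ] VSpace d,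
          Algebra.TensorProduct.map (AlgHom.id ℝ (VSpace d)) (gamB b x φ)
          (TensorProduct.map (integB b m)
            (LinearMap.mulLeft ℝ (tExt (P.degKernel - P.deg m))) z) =
          TensorProduct.map (integB b m) (LinearMap.mulLeft ℝ (tExt (P.degKernel - P.deg m)))
          (Algebra.TensorProduct.map (AlgHom.id ℝ (VSpace d)) (gamB b x φ) z) := by
        intro z
        induction z with
        | zero => simp
        | add z w hz hw => simp only [map_add, hz, hw]
        | tmul x y => simp [gamB_ext]
      have h4 := sum_D1_dp P b g (W := VSpace d ⊗[ℝ] VSpace d)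
        (fun n => φ (m + n) (MB P b g (tr σ)) • 1) (fun n hn => by simp [hφ' n hn])
      simp only [smul_eq_mul, mul_smul_comm, mul_one] at h4
      simp only [D1_I, gamB_I, map_add, map_sum, h3, h2, D1_integB, hmul, map_mul, gamB_ext,
        gamB_integB b x hφ, hM, mul_add, TensorProduct.tmul_add, Finset.sum_add_distrib, add_assoc,
        map_smul, pullFun, LinearMap.comp_apply, h4]
      simp only [Finset.mul_sum, TensorProduct.tmul_sum, mul_smul_comm, TensorProduct.tmul_smul]
  | mul σ τ h1 h2 => simp only [tr_mul, map_mul, h1.1, h1.2, h2.1, h2.2, and_self]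

variable {φ} in
/-- Cointeraction: recentring and extraction intertwine. -/
theorem gamB_MB (hφ : ∀ n, ¬ n ≤ b → φ n = 0) (v : VSpace d) :
    gamB b x φ (MB P b g v) = MB P b g (gamB b x (pullFun P b g φ) v) := by
  refine LinearMap.congr_fun (f := (gamB b x φ).toLinearMap ∘ₗ MB P b g)
    (g := MB P b g ∘ₗ (gamB b x (pullFun P b g φ)).toLinearMap) (linMap_ext fun τ => ?_) v
  obtain ⟨h1, h2⟩ := cointeract_tr P b g x hφ τ
  simp only [LinearMap.comp_apply, AlgHom.toLinearMap_apply]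
  rw [MB_apply, MB_apply, map_add, h1, ← h2]
  congr 1
  generalize D1 P b g (tr τ) = z
  induction z with
  | zero => simp
  | add z w hz hw => simp only [map_add, hz, hw]
  | tmul x y => simp [contrL_tmul]

/-- The function part of the product of `(x, φ)` and `(y, ψ)`. -/
def convFun : MIdx d → VSpace d →ₗ[ℝ] ℝ := fun n =>
  φ n ∘ₗ (gamB b y ψ).toLinearMap + ∑ k ∈ Finset.Iic b, dpow x k • ψ (n + k)

lemma convFun_apply (n : MIdx d) (v : VSpace d) : convFun b x y φ ψ n v =
    φ n (gamB b y ψ v) + ∑ k ∈ Finset.Iic b, dpow x k * ψ (n + k) v := by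
  simp [convFun, LinearMap.sum_apply]

variable {φ ψ} in
/-- The group law of recentring operators. -/
theorem gamB_comp (hφ : ∀ n, ¬ n ≤ b → φ n = 0) (hψ : ∀ n, ¬ n ≤ b → ψ n = 0) :
    (gamB b x φ).comp (gamB b y ψ) = gamB b (x + y) (convFun b x y φ ψ) := by
  refine algHom_ext_gen (fun a => ?_) (fun i => ?_) (fun l => ?_) fun m σ ih => ?_
  · simp [gamB_ext]
  · simp only [AlgHom.comp_apply, gamB_X, map_add, AlgHom.commutes, Pi.add_apply, add_assoc]
  · simp [gamB_Xi, gamB_xiB]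
  · have hψ' : ∀ n, ¬ n ≤ b → ψ (m + n) = 0 := fun n hn =>
      hψ _ (by rw [add_comm]; exact not_add_le hn _)
    have h4 := sum_gamB_dp b x (φ := φ) (W := VSpace d)
        (fun n => ψ (m + n) (tr σ) • 1) (fun n hn => by simp [hψ' n hn])
    simp only [smul_eq_mul, mul_smul_comm, mul_one] at h4
    rw [← integ_tr, AlgHom.comp_apply, gamB_I, gamB_I, map_add, gamB_integB b x hφ, ← ih, map_sum,
      AlgHom.comp_apply]
    simp only [map_smul, h4, convFun_apply, add_smul, Finset.sum_add_distrib, add_assoc,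
      Finset.sum_smul, Finset.mul_sum]
    congr 2
    refine Finset.sum_congr rfl fun p _ => Finset.sum_congr rfl fun q _ => ?_
    simp [Algebra.algebraMap_eq_smul_one, smul_smul, mul_comm]

end Truncated

end RegStr
end

noncomputable section

namespace RegStr

variable {d : ℕ}

/-! ### Truncated extractions as sums over subforests -/

section BoxCuts

open Classical in
/-- The subforests of a tree for which all edge decorations of the tree and of the contracted tree
lie in the box `Iic b`. -/
def boxCuts (b : MIdx d) : (t : PTree d) → (e : Bool) → Finset (Cut e t)
  | .root a k, false => {.rootOut a k}
  | .root a k, true => (Finset.Iic k).attach.map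
      ⟨fun n => .rootIn a k n.1 (Finset.mem_Iic.1 n.2), fun x y h => by
        cases x; cases y; cases h; rfl⟩
  | .noise l t, false => if l ≤ b then
      (boxCuts b t false).map ⟨fun c => .noiseOut l c, fun x y h => by cases h; rfl⟩ else ∅
  | .noise l t, true => (((Finset.Iic b).filter fun p => l + p ≤ b) ×ˢ boxCuts b t true).map
      ⟨fun x => .noiseBdry l x.1 x.2, fun x y h => by cases x; cases y; cases h; rfl⟩ ∪
      if l ≤ b then (boxCuts b t true).map ⟨fun c => .noiseIn l c, fun x y h => by cases h; rfl⟩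
      else ∅
  | .kern m s t, false => if m ≤ b then
      ((Finset.univ.sigma fun e => boxCuts b s e) ×ˢ boxCuts b t false).map
      ⟨fun x => .kernOut m x.1.1 x.1.2 x.2, fun x y h => by
        obtain ⟨⟨_, _⟩, _⟩ := x; obtain ⟨⟨_, _⟩, _⟩ := y; cases h; rfl⟩ else ∅
  | .kern m s t, true => (((Finset.Iic b).filter fun p => m + p ≤ b) ×ˢ
      ((Finset.univ.sigma fun e => boxCuts b s e) ×ˢ boxCuts b t true)).map
      ⟨fun x => .kernBdry m x.1 x.2.1.1 x.2.1.2 x.2.2, fun x y h => by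
        obtain ⟨_, ⟨_, _⟩, _⟩ := x; obtain ⟨_, ⟨_, _⟩, _⟩ := y; cases h; rfl⟩ ∪
      if m ≤ b then (boxCuts b s true ×ˢ boxCuts b t true).map
      ⟨fun x => .kernIn m x.1 x.2, fun x y h => by cases x; cases y; cases h; rfl⟩ else ∅

variable (b : MIdx d)

open Classical in
lemma sum_noise_true {W : Type*} [AddCommMonoid W] (l : MIdx d) (t : PTree d)
    (F : Cut true (.noise l t) → W) : ∑ c ∈ boxCuts b (.noise l t) true, F c =
      (∑ p ∈ Finset.Iic b, if l + p ≤ b then ∑ c ∈ boxCuts b t true, F (.noiseBdry l p c) else 0) +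
      if l ≤ b then ∑ c ∈ boxCuts b t true, F (.noiseIn l c) else 0 := by
  rw [boxCuts, Finset.sum_union, Finset.sum_map, Finset.sum_product, Finset.sum_filter]
  · congr 1
    split_ifs
    · rw [Finset.sum_map]; rfl
    · rfl
  · rw [Finset.disjoint_left]
    intro c h1 h2
    split_ifs at h2
    · obtain ⟨x, -, rfl⟩ := Finset.mem_map.1 h1
      obtain ⟨y, -, h⟩ := Finset.mem_map.1 h2
      cases h
    · simp at h2

open Classical in
lemma sum_kern_true {W : Type*} [AddCommMonoid W] (m : MIdx d) (s t : PTree d)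
    (F : Cut true (.kern m s t) → W) : ∑ c ∈ boxCuts b (.kern m s t) true, F c =
      (∑ p ∈ Finset.Iic b, if m + p ≤ b then ∑ e, ∑ c' ∈ boxCuts b s e,
        ∑ c ∈ boxCuts b t true, F (.kernBdry m p e c' c) else 0) +
      if m ≤ b then ∑ c' ∈ boxCuts b s true, ∑ c ∈ boxCuts b t true, F (.kernIn m c' c) else 0 := by
  rw [boxCuts, Finset.sum_union, Finset.sum_map, Finset.sum_product, Finset.sum_filter]
  · congr 1
    · refine Finset.sum_congr rfl fun p _ => ?_
      rw [Finset.sum_product, Finset.sum_sigma]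
      rfl
    · split_ifs
      · rw [Finset.sum_map, Finset.sum_product]; rfl
      · rfl
  · rw [Finset.disjoint_left]
    intro c h1 h2
    split_ifs at h2
    · obtain ⟨x, -, rfl⟩ := Finset.mem_map.1 h1
      obtain ⟨y, -, h⟩ := Finset.mem_map.1 h2
      cases h
    · simp at h2

open Classical in
lemma sum_kern_false {W : Type*} [AddCommMonoid W] (m : MIdx d) (s t : PTree d)
    (F : Cut false (.kern m s t) → W) : ∑ c ∈ boxCuts b (.kern m s t) false, F c =
      if m ≤ b then ∑ e, ∑ c' ∈ boxCuts b s e, ∑ c ∈ boxCuts b t false, F (.kernOut m e c' c)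
      else 0 := by
  rw [boxCuts]
  split_ifs
  · rw [Finset.sum_map, Finset.sum_product, Finset.sum_sigma]; rfl
  · rfl

open Classical in
lemma sum_noise_false {W : Type*} [AddCommMonoid W] (l : MIdx d) (t : PTree d)
    (F : Cut false (.noise l t) → W) : ∑ c ∈ boxCuts b (.noise l t) false, F c =
      if l ≤ b then ∑ c ∈ boxCuts b t false, F (.noiseOut l c) else 0 := by
  rw [boxCuts]
  split_ifs
  · rw [Finset.sum_map]; rfl
  · rfl

lemma sum_root_true {W : Type*} [AddCommMonoid W] (a : ℝ) (k : MIdx d)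
    (F : Cut true (.root a k) → W) (G : MIdx d → W) (hG : ∀ n h, F (.rootIn a k n h) = G n) :
    ∑ c ∈ boxCuts b (.root a k) true, F c = ∑ n ∈ Finset.Iic k, G n := by
  rw [boxCuts, Finset.sum_map, ← Finset.sum_attach (Finset.Iic k)]
  exact Finset.sum_congr rfl fun n _ => hG n.1 _

/-- Multiplicative extension of a functional to forests. -/
def forestVal (g : VSpace d →ₗ[ℝ] ℝ) (F : Multiset (Tree d)) : ℝ := (F.map fun σ => g (tr σ)).prod

lemma forestVal_add (g : VSpace d →ₗ[ℝ] ℝ) (F F' : Multiset (Tree d)) :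
    forestVal g (F + F') = forestVal g F * forestVal g F' := by
  simp [forestVal]

lemma forestVal_zero (g : VSpace d →ₗ[ℝ] ℝ) : forestVal g 0 = 1 := by simp [forestVal]

lemma forestVal_singleton (g : VSpace d →ₗ[ℝ] ℝ) (σ : Tree d) :
    forestVal g {σ} = g (tr σ) := by simp [forestVal]

lemma forestVal_ne_zero {g : VSpace d →ₗ[ℝ] ℝ} {F : Multiset (Tree d)} :
    forestVal g F ≠ 0 ↔ ∀ σ ∈ F, g (tr σ) ≠ 0 := by
  rw [forestVal, Ne, Multiset.prod_eq_zero_iff]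
  simp

lemma mfact_mul_inv {k n : MIdx d} (h : n ≤ k) :
    (mfact k : ℝ) * ((mfact n : ℝ)⁻¹ * (mfact (k - n) : ℝ)⁻¹) = mchoose k n := by
  simp only [mfact, mchoose, Nat.cast_prod, ← Finset.prod_inv_distrib, ← Finset.prod_mul_distrib]
  refine Finset.prod_congr rfl fun i _ => ?_
  rw [Nat.cast_choose ℝ (h i), Pi.sub_apply]
  field_simp

lemma mfact_ne_zero (k : MIdx d) : (mfact k : ℝ) ≠ 0 := by
  simp [mfact, Finset.prod_ne_zero_iff, Nat.factorial_ne_zero]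

lemma tr_X_eq (k : MIdx d) : tr (.X k) = (mfact k : ℝ) • dp k := by
  rw [dp, smul_inv_smul₀ (mfact_ne_zero k)]

lemma tr_root (a : ℝ) (k : MIdx d) : tr (.root a k) = tExt a * tr (.X k) := by
  rw [Tree.root_eq, tr_mul]; rfl

variable (P : Degrees d) (g : VSpace d →ₗ[ℝ] ℝ)

lemma D1_root (a : ℝ) (k : MIdx d) : D1 P b g (tr (.root a k)) =
    ∑ n ∈ Finset.Iic k, (mchoose k n : ℝ) •
      (tr (.root a n) ⊗ₜ[ℝ] tr (.root (a + P.deg n) (k - n))) := by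
  rw [tr_root, map_mul, D1_ext, tr_X_eq, map_smul, D1_dp, dpow_add, Finset.smul_sum, Finset.mul_sum]
  refine Finset.sum_congr rfl fun n hn => ?_
  rw [dpow_tmul_ext, dpow_one_tmul, ← mfact_mul_inv (Finset.mem_Iic.1 hn), tr_root, tr_root, dp, dp,
    tExt_add]
  simp only [Algebra.TensorProduct.tmul_mul_tmul, mul_smul_comm, ← TensorProduct.tmul_smul,
    mul_one, smul_mul_assoc, ← TensorProduct.smul_tmul', smul_smul, mul_assoc]
  congr 2
  ring

/-- Extraction avoiding the root, as a sum over subforests. -/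
theorem D0_eq_sum_and_D1_eq_sum (t : PTree d) :
    D0 P b g (tr (.mk t)) = ∑ c ∈ boxCuts b t false,
      (c.coef * forestVal g c.others) • tr (c.contracted P) ∧
    D1 P b g (tr (.mk t)) = ∑ c ∈ boxCuts b t true,
      (c.coef * forestVal g c.others) • (tr c.comp ⊗ₜ[ℝ] tr (c.contracted P)) := by
  induction t with
  | root a k =>
    constructor
    · change D0 P b g (tr (.root a k)) = _
      rw [tr_root, map_mul, D0_ext, tr_X_eq, map_smul, D0_dp, ← tr_X_eq, ← tr_root]
      simp [boxCuts, Cut.coef, Cut.others, forestVal_zero, Cut.contracted]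
    · refine (D1_root b P g a k).trans (sum_root_true b a k _ _ fun n h => ?_).symm
      simp [Cut.coef, Cut.others, forestVal_zero, Cut.contracted, Cut.comp]
  | noise l t ih =>
    rw [Tree.mk_noise, tr_mul, map_mul, map_mul, D0_Xi, D1_Xi, ih.1, ih.2, sum_noise_false,
      sum_noise_true]
    constructor
    · split_ifs with hl
      · rw [xiB_of_le hl, Finset.mul_sum]
        simp [Cut.coef, Cut.others, Cut.contracted, tr_mul]
      · rw [xiB_of_not_le hl, zero_mul]
    · rw [add_comm, add_mul, Finset.sum_mul]
      congr 1
      · refine Finset.sum_congr rfl fun p _ => ?_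
        split_ifs with hl
        · rw [xiB_of_le hl, Finset.mul_sum]
          refine Finset.sum_congr rfl fun c _ => ?_
          simp only [Cut.coef, Cut.others, Cut.contracted, Cut.comp, tr_mul, dp, tExt,
            Algebra.TensorProduct.tmul_mul_tmul, smul_mul_assoc, ← TensorProduct.smul_tmul',
            mul_smul_comm, smul_smul]
          congr 1
          ring
        · simp [xiB_of_not_le hl]
      · split_ifs with hl
        · rw [xiB_of_le hl, Finset.mul_sum]
          refine Finset.sum_congr rfl fun c _ => ?_
          simp only [Cut.coef, Cut.others, Cut.contracted, Cut.comp, tr_mul, tExt, mul_smul_comm,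
            Algebra.TensorProduct.tmul_mul_tmul]
        · rw [xiB_of_not_le hl, TensorProduct.zero_tmul, zero_mul]
  | kern m s t ihs iht =>
    -- Below an edge outside A the branch carries an arbitrary subforest, whose root component, if
    -- there is one, becomes one of the other components of the whole tree.
    have hM : MB P b g (tr (.mk s)) = ∑ e, ∑ c ∈ boxCuts b s e,
        (c.coef * forestVal g c.extracted) • tr (c.contracted P) := by
      rw [MB_apply, ihs.1, ihs.2, Fintype.sum_bool, add_comm, map_sum]
      congr 1
      · refine Finset.sum_congr rfl fun c _ => ?_
        simp only [map_smul, contrL_tmul, Cut.extracted, forestVal_add, forestVal_singleton,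
          smul_smul, if_true]
        congr 1
        ring
      · simp [Cut.extracted]
    rw [Tree.mk_kern, tr_mul, map_mul, map_mul, ← integ_tr, D0_I, D1_I, iht.1, iht.2, hM, ihs.2,
      sum_kern_false, sum_kern_true]
    have hex : ∀ (e : Bool) (c' : Cut e s), forestVal g ((if e then {c'.comp} else 0) + c'.others) =
      forestVal g c'.extracted := fun _ _ => rfl
    constructor
    · split_ifs with hl
      · rw [integB_of_le hl, map_sum, Finset.sum_mul]
        refine Finset.sum_congr rfl fun e _ => ?_
        rw [map_sum, Finset.sum_mul_sum]
        refine Finset.sum_congr rfl fun c' _ => Finset.sum_congr rfl fun c _ => ?_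
        simp only [map_smul, integ_tr, Cut.coef, Cut.others, Cut.contracted, tr_mul, forestVal_add,
          smul_mul_smul_comm, hex]
        congr 1
        ring
      · rw [integB_of_not_le hl, LinearMap.zero_apply, zero_mul]
    · rw [add_comm, add_mul, Finset.sum_mul]
      congr 1
      · refine Finset.sum_congr rfl fun p _ => ?_
        split_ifs with hl
        · have hT : tExt (P.deg p) * integ (m + p) (∑ e, ∑ c ∈ boxCuts b s e,
              (c.coef * forestVal g c.extracted) • tr (c.contracted P)) =
              ∑ e, ∑ c ∈ boxCuts b s e, (c.coef * forestVal g c.extracted) •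
                (tExt (P.deg p) * tr (.I (m + p) (c.contracted P))) := by
            simp only [map_sum, map_smul, integ_tr, Finset.mul_sum, mul_smul_comm]
          rw [integB_of_le hl, hT, TensorProduct.tmul_sum, Finset.sum_mul]
          refine Finset.sum_congr rfl fun e _ => ?_
          rw [TensorProduct.tmul_sum, Finset.sum_mul_sum]
          refine Finset.sum_congr rfl fun c' _ => Finset.sum_congr rfl fun c _ => ?_
          simp only [Cut.coef, Cut.others, Cut.contracted, Cut.comp, tr_mul, dp,
            tExt, forestVal_add, hex, Algebra.TensorProduct.tmul_mul_tmul, smul_mul_assoc,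
            ← TensorProduct.smul_tmul', mul_smul_comm, smul_smul, TensorProduct.tmul_smul]
          congr 1
          ring
        · simp [integB_of_not_le hl]
      · split_ifs with hl
        · rw [integB_of_le hl, map_sum, Finset.sum_mul_sum]
          refine Finset.sum_congr rfl fun c' _ => Finset.sum_congr rfl fun c _ => ?_
          simp only [map_smul, TensorProduct.map_tmul, LinearMap.mulLeft_apply, integ_tr, Cut.coef,
            Cut.others, Cut.contracted, Cut.comp, tr_mul, forestVal_add, tExt, mul_smul_comm,
            Algebra.TensorProduct.tmul_mul_tmul, smul_mul_assoc, smul_smul, mul_assoc]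
          congr 1
          ring
        · simp [integB_of_not_le hl]

theorem MB_eq_sum (t : PTree d) : MB P b g (tr (.mk t)) = ∑ e, ∑ c ∈ boxCuts b t e,
    (c.coef * forestVal g c.extracted) • tr (c.contracted P) := by
  rw [MB_apply, (D0_eq_sum_and_D1_eq_sum b P g t).1, (D0_eq_sum_and_D1_eq_sum b P g t).2,
    Fintype.sum_bool, add_comm, map_sum]
  congr 1
  · refine Finset.sum_congr rfl fun c _ => ?_
    simp only [map_smul, contrL_tmul, Cut.extracted, forestVal_add, forestVal_singleton,
      smul_smul, if_true]
    congr 1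
    ring
  · simp [Cut.extracted]

end BoxCuts

end RegStr
end

/-! ### Degree bookkeeping, functionals on negative trees, and the counit. -/

noncomputable section

namespace RegStr

variable {d : ℕ}

/-! ### Degrees of extracted and contracted trees -/

namespace Tree

lemma oSum_mul (σ τ : Tree d) : (σ * τ).oSum = σ.oSum + τ.oSum := by
  have hroot : ∀ (a : ℝ) (k : MIdx d) (t : PTree d), (t.addRoot a k).oSum = a + t.oSum := by
    intro a k t
    induction t with
    | root b n => rfl
    | noise l t ih => simp only [PTree.addRoot, PTree.oSum, ih]
    | kern m s t _ ih => simp only [PTree.addRoot, PTree.oSum, ih]; ring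
  obtain ⟨s⟩ := σ
  obtain ⟨t⟩ := τ
  change (s.mul t).oSum = s.oSum + t.oSum
  induction s with
  | root a k => exact hroot a k t
  | noise l s ih => simp only [PTree.mul, PTree.oSum, ih]
  | kern m s' s _ ih => simp only [PTree.mul, PTree.oSum, ih]; ring

lemma degPlus_mul (P : Degrees d) (σ τ : Tree d) :
    (σ * τ).degPlus P = σ.degPlus P + τ.degPlus P := by
  simp only [degPlus, degS_mul, oSum_mul]; ring

lemma degPlus_root (P : Degrees d) (a : ℝ) (k : MIdx d) : (root a k).degPlus P = P.deg k + a := rfl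

lemma degPlus_ext (P : Degrees d) (a : ℝ) : (ext a : Tree d).degPlus P = a := by
  simp [ext, degPlus_root, Degrees.deg]

lemma degPlus_X (P : Degrees d) (k : MIdx d) : (X k).degPlus P = P.deg k := by
  simp [X, degPlus_root]

lemma degPlus_Xi (P : Degrees d) (l : MIdx d) : (Xi l).degPlus P = P.degNoise - P.deg l := by
  rw [degPlus, degS_Xi]
  exact add_zero _

lemma degS_ext (P : Degrees d) (a : ℝ) : (ext a : Tree d).degS P = 0 := by
  simp [ext, degS_root, Degrees.deg]

lemma rootPoly_mul (σ τ : Tree d) : (σ * τ).rootPoly = σ.rootPoly + τ.rootPoly := by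
  have hroot : ∀ (a : ℝ) (k : MIdx d) (t : PTree d),
      (t.addRoot a k).rootPoly = k + t.rootPoly := by
    intro a k t
    induction t with
    | root b n => rfl
    | noise l t ih => simp only [PTree.addRoot, PTree.rootPoly, ih]
    | kern m s t _ ih => simp only [PTree.addRoot, PTree.rootPoly, ih]
  obtain ⟨s⟩ := σ
  obtain ⟨t⟩ := τ
  change (s.mul t).rootPoly = s.rootPoly + t.rootPoly
  induction s with
  | root a k => exact hroot a k t
  | noise l s ih => simp only [PTree.mul, PTree.rootPoly, ih]
  | kern m s' s _ ih => simp only [PTree.mul, PTree.rootPoly, ih]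

lemma rootPoly_X (k : MIdx d) : (X k).rootPoly = k := rfl

lemma exists_eq_X_mul {σ : Tree d} {i : Fin d} (h : σ.rootPoly i ≠ 0) :
    ∃ σ', σ = X (Pi.single i 1) * σ' := by
  obtain ⟨t⟩ := σ
  change t.rootPoly i ≠ 0 at h
  change ∃ σ', mk t = X (Pi.single i 1) * σ'
  induction t with
  | root a k =>
    refine ⟨root a (k - Pi.single i 1), ?_⟩
    have hk : Pi.single i 1 ≤ k := by
      intro j
      by_cases hj : j = i
      · subst hj
        simpa [PTree.rootPoly] using Nat.one_le_iff_ne_zero.2 h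
      · simp [hj]
    rw [X, root_mul_root, zero_add, add_tsub_cancel_of_le hk]
    rfl
  | noise l t ih =>
    obtain ⟨σ, hσ⟩ := ih h
    exact ⟨Xi l * σ, by rw [mk_noise, hσ, mul_left_comm]⟩
  | kern m s t _ ih =>
    obtain ⟨σ, hσ⟩ := ih h
    exact ⟨I m (mk s) * σ, by rw [mk_kern, hσ, mul_left_comm]⟩

end Tree

namespace Cut

/-- The extended decoration of a contracted node collects exactly what is lost: edge degrees,
extended decorations, and |n_A + π e_A|. The last term also compensates for the lowered degrees of
the boundary edges. For this reason M_g respects the degree cutoffs and the model bounds. -/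
lemma degPlus_contracted (P : Degrees d) {e : Bool} {t : PTree d} (c : Cut e t) :
    (c.contracted P).degPlus P = (Tree.mk t).degPlus P := by
  induction c with
  | rootOut => rfl
  | rootIn a k n h =>
    change P.deg (k - n) + (a + P.deg n) = P.deg k + a
    have := P.deg_add n (k - n)
    rw [add_tsub_cancel_of_le h] at this
    linarith
  | noiseOut l c ih => rw [contracted, Tree.degPlus_mul, ih, Tree.mk_noise, Tree.degPlus_mul]
  | noiseBdry l p c ih =>
    simp only [contracted, Tree.degPlus_mul, ih, Tree.mk_noise, Tree.degPlus_ext, Tree.degPlus_Xi,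
      P.deg_add]
    ring
  | noiseIn l c ih =>
    simp only [contracted, Tree.degPlus_mul, ih, Tree.mk_noise, Tree.degPlus_ext, Tree.degPlus_Xi]
  | kernOut m e c' c ih' ih =>
    simp only [contracted, Tree.degPlus_mul, ih, ih', Tree.mk_kern, Tree.degPlus_I]
  | kernBdry m p e c' c ih' ih =>
    simp only [contracted, Tree.degPlus_mul, ih, ih', Tree.mk_kern, Tree.degPlus_ext,
      Tree.degPlus_I, P.deg_add]
    ring
  | kernIn m c' c ih' ih =>
    simp only [contracted, Tree.degPlus_mul, ih, ih', Tree.mk_kern, Tree.degPlus_ext,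
      Tree.degPlus_I]

/-- Without extended decorations the degree is shared between the forest and the quotient: a
boundary decoration adds to its component what it takes from its edge. Negative trees extracted in
two stages thus assemble to a negative tree. -/
lemma degS_contracted (P : Degrees d) {e : Bool} {t : PTree d} (c : Cut e t) :
    (c.contracted P).degS P + (c.extracted.map (Tree.degS P)).sum = (Tree.mk t).degS P := by
  induction c with
  | rootOut => simp [contracted, extracted, others]; rfl
  | rootIn a k n h =>
    simp only [contracted, extracted, others, comp, if_true, Tree.degS_root, add_zero,
      Multiset.map_singleton, Multiset.sum_singleton, ← P.deg_add, tsub_add_cancel_of_le h]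
    rfl
  | noiseOut l c ih =>
    simp only [contracted, extracted, others, Tree.degS_mul, Tree.mk_noise, Tree.degS_Xi] at ih ⊢
    simp at ih ⊢
    linarith
  | noiseBdry l p c ih =>
    simp only [contracted, extracted, others, comp, Tree.degS_mul, Tree.mk_noise, Tree.degS_Xi,
      Tree.degS_ext] at ih ⊢
    simp [Tree.degS_mul, Tree.degS_X, P.deg_add] at ih ⊢
    linarith
  | noiseIn l c ih =>
    simp only [contracted, extracted, others, comp, Tree.degS_mul, Tree.mk_noise, Tree.degS_Xi,
      Tree.degS_ext] at ih ⊢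
    simp [Tree.degS_mul, Tree.degS_Xi] at ih ⊢
    linarith
  | kernOut m e c' c ih' ih =>
    simp only [contracted, extracted, others, Tree.degS_mul, Tree.mk_kern, Tree.degS_I,
      Multiset.map_add, Multiset.sum_add] at ih ih' ⊢
    simp at ih ih' ⊢
    linarith
  | kernBdry m p e c' c ih' ih =>
    simp only [contracted, extracted, others, comp, Tree.degS_mul, Tree.mk_kern, Tree.degS_I,
      Tree.degS_ext, Multiset.map_add, Multiset.sum_add] at ih ih' ⊢
    simp [Tree.degS_mul, Tree.degS_X, P.deg_add] at ih ih' ⊢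
    linarith
  | kernIn m c' c ih' ih =>
    simp only [contracted, extracted, others, comp, Tree.degS_mul, Tree.mk_kern, Tree.degS_I,
      Tree.degS_ext, Multiset.map_add, Multiset.sum_add] at ih ih' ⊢
    simp [Tree.degS_mul, Tree.degS_I] at ih ih' ⊢
    linarith

/-- Strict positivity rules out cancellation between subforests, which lets combinatorial statements
be read off from nonzero coefficients. -/
lemma coef_pos {e : Bool} {t : PTree d} (c : Cut e t) : 0 < c.coef := by
  have hf : ∀ p : MIdx d, (0 : ℝ) < (mfact p : ℝ)⁻¹ := fun p =>
    inv_pos.2 (Nat.cast_pos.2 (Finset.prod_pos fun i _ => Nat.factorial_pos _))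
  induction c with
  | rootOut => exact one_pos
  | rootIn a k n h => exact Nat.cast_pos.2 (Finset.prod_pos fun i _ => Nat.choose_pos (h i))
  | noiseOut _ _ ih => exact ih
  | noiseBdry _ p _ ih => exact mul_pos (hf p) ih
  | noiseIn _ _ ih => exact ih
  | kernOut _ _ _ _ ih' ih => exact mul_pos ih' ih
  | kernBdry _ p _ _ _ ih' ih => exact mul_pos (hf p) (mul_pos ih' ih)
  | kernIn _ _ _ ih' ih => exact mul_pos ih' ih

open Filter in
open scoped Classical in
lemma eventually_mem_boxCuts {e : Bool} {t : PTree d} (c : Cut e t) :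
    ∀ᶠ b in atTop, c ∈ boxCuts b t e := by
  induction c with
  | rootOut => simp [boxCuts]
  | rootIn a k n h =>
    refine .of_forall fun b => ?_
    rw [boxCuts]
    exact Finset.mem_map.2 ⟨⟨n, Finset.mem_Iic.2 h⟩, Finset.mem_attach _ _, rfl⟩
  | noiseOut l c ih =>
    filter_upwards [ih, eventually_ge_atTop l] with b h1 h2
    rw [boxCuts, if_pos h2]
    exact Finset.mem_map.2 ⟨c, h1, rfl⟩
  | noiseBdry l p c ih =>
    filter_upwards [ih, eventually_ge_atTop (l + p)] with b h1 h2
    rw [boxCuts]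
    exact Finset.mem_union.2 (.inl (Finset.mem_map.2 ⟨(p, c), by
      simp [h1, h2, le_add_self.trans h2], rfl⟩))
  | noiseIn l c ih =>
    filter_upwards [ih, eventually_ge_atTop l] with b h1 h2
    rw [boxCuts, if_pos h2]
    exact Finset.mem_union.2 (.inr (Finset.mem_map.2 ⟨c, h1, rfl⟩))
  | kernOut m e c' c ih' ih =>
    filter_upwards [ih', ih, eventually_ge_atTop m] with b h0 h1 h2
    rw [boxCuts, if_pos h2]
    exact Finset.mem_map.2 ⟨(⟨e, c'⟩, c), Finset.mem_product.2 ⟨Finset.mem_sigma.2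
      ⟨Finset.mem_univ _, h0⟩, h1⟩, rfl⟩
  | kernBdry m p e c' c ih' ih =>
    filter_upwards [ih', ih, eventually_ge_atTop (m + p)] with b h0 h1 h2
    rw [boxCuts]
    exact Finset.mem_union.2 (.inl (Finset.mem_map.2 ⟨(p, ⟨e, c'⟩, c), Finset.mem_product.2
      ⟨by simp [h2, le_add_self.trans h2], Finset.mem_product.2 ⟨Finset.mem_sigma.2
      ⟨Finset.mem_univ _, h0⟩, h1⟩⟩, rfl⟩))
  | kernIn m c' c ih' ih =>
    filter_upwards [ih', ih, eventually_ge_atTop m] with b h0 h1 h2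
    rw [boxCuts, if_pos h2]
    exact Finset.mem_union.2 (.inr (Finset.mem_map.2 ⟨(c', c), by simp [h0, h1], rfl⟩))

end Cut

/-! ### Functionals on negative trees -/

section NegFun

open Filter

variable (P : Degrees d)

/-- The conditions on a tree in the definition of `𝔗_-`, apart from conforming to the rule. -/
def NegCond (σ : Tree d) : Prop := σ.degS P < 0 ∧ σ.rootPoly = 0 ∧ ¬ σ.IsPlanted

/-- Functionals which vanish outside the trees satisfying `NegCond`. -/
def IsNegFun (g : VSpace d →ₗ[ℝ] ℝ) : Prop := ∀ σ, g (tr σ) ≠ 0 → NegCond P σ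

/-- The subforests all of whose components have negative degree. -/
def negCuts (t : PTree d) : Finset (Σ e, Cut e t) := (Cut.finite_extracted_neg P t).toFinset

lemma mem_negCuts {t : PTree d} {c : Σ e, Cut e t} :
    c ∈ negCuts P t ↔ ∀ σ ∈ c.2.extracted, σ.degS P < 0 := by simp [negCuts]

lemma MB_eq_sum_sigma (b : MIdx d) (g : VSpace d →ₗ[ℝ] ℝ) (t : PTree d) :
    MB P b g (tr (.mk t)) = ∑ c ∈ Finset.univ.sigma fun e => boxCuts b t e,
      (c.2.coef * forestVal g c.2.extracted) • tr (c.2.contracted P) := by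
  rw [MB_eq_sum, Finset.sum_sigma]

/-- The box is chosen before the functional. This uniformity is needed because the lemma is later
applied to `compFun P b _ _`, which itself depends on the box. -/
theorem eventually_MB_eq (t : PTree d) : ∀ᶠ b in atTop, ∀ g : VSpace d →ₗ[ℝ] ℝ,
    (∀ σ, g (tr σ) ≠ 0 → σ.degS P < 0) → MB P b g (tr (.mk t)) =
      ∑ c ∈ negCuts P t, (c.2.coef * forestVal g c.2.extracted) • tr (c.2.contracted P) := by
  have h : ∀ᶠ b in atTop, ∀ c ∈ negCuts P t, c.2 ∈ boxCuts b t c.1 :=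
    (Filter.eventually_all_finset _).2 fun c _ => c.2.eventually_mem_boxCuts
  filter_upwards [h] with b hb g hg
  rw [MB_eq_sum_sigma]
  symm
  refine Finset.sum_subset (fun c hc => by simpa using hb c hc) fun c _ hc => ?_
  have : forestVal g c.2.extracted = 0 := by
    by_contra h0
    exact hc ((mem_negCuts P).2 fun σ hσ => hg σ (forestVal_ne_zero.1 h0 σ hσ))
  rw [this, mul_zero, zero_smul]

variable {P}

lemma eq_zero_of_forall_tr {W : Type*} [AddCommGroup W] [Module ℝ W] {F : VSpace d →ₗ[ℝ] W}
    (h : ∀ τ, F (tr τ) = 0) (v : VSpace d) : F v = 0 :=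
  LinearMap.congr_fun (linMap_ext (G := 0) h) v

lemma IsNegFun.X_mul {g : VSpace d →ₗ[ℝ] ℝ} (hg : IsNegFun P g) (i : Fin d) (v : VSpace d) :
    g (tX i * v) = 0 := by
  refine eq_zero_of_forall_tr (F := g ∘ₗ LinearMap.mulLeft ℝ (tX i)) (fun τ => ?_) v
  by_contra h
  change g (tX i * tr τ) ≠ 0 at h
  rw [tX, ← tr_mul] at h
  have := congrFun (hg _ h).2.1 i
  simp [Tree.rootPoly_mul, Tree.rootPoly_X] at this

lemma IsNegFun.root {g : VSpace d →ₗ[ℝ] ℝ} (hg : IsNegFun P g) (a : ℝ) (k : MIdx d) :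
    g (tr (.root a k)) = 0 := by
  by_contra h
  exact (P.deg_nonneg k).not_gt (hg _ h).1

lemma IsNegFun.ext_mul_dp {g : VSpace d →ₗ[ℝ] ℝ} (hg : IsNegFun P g) (a : ℝ) (p : MIdx d) :
    g (tExt a * dp p) = 0 := by
  rw [dp, mul_smul_comm, ← tr_root, map_smul, hg.root, smul_zero]

lemma IsNegFun.ext_mul_integB {g : VSpace d →ₗ[ℝ] ℝ} (hg : IsNegFun P g) (b : MIdx d) (a : ℝ)
    (m : MIdx d) (v : VSpace d) : g (tExt a * integB b m v) = 0 := by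
  by_cases h : m ≤ b
  · rw [integB_of_le h]
    refine eq_zero_of_forall_tr (F := g ∘ₗ LinearMap.mulLeft ℝ (tExt a) ∘ₗ integ m) (fun τ => ?_) v
    by_contra h
    simp only [LinearMap.comp_apply, integ_tr, LinearMap.mulLeft_apply, tExt, ← tr_mul] at h
    exact (hg _ h).2.2 ⟨a, .inr ⟨m, τ, rfl⟩⟩
  · simp [integB_of_not_le h]

lemma IsNegFun.ext_mul_xiB {g : VSpace d →ₗ[ℝ] ℝ} (hg : IsNegFun P g) (b : MIdx d) (a : ℝ)
    (l : MIdx d) : g (tExt a * xiB b l) = 0 := by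
  by_cases h : l ≤ b
  · rw [xiB_of_le h]
    by_contra h
    rw [tExt, ← tr_mul] at h
    exact (hg _ h).2.2 ⟨a, .inl ⟨l, rfl⟩⟩
  · simp [xiB_of_not_le h]

variable {g : VSpace d →ₗ[ℝ] ℝ} (hg : IsNegFun P g) (b : MIdx d)
include hg

/-- If X_i is moved to the root component, this component has a nonzero polynomial decoration at its
root and is killed by `g`; only the term that leaves X_i in place survives. -/
lemma IsNegFun.MB_X_mul (i : Fin d) (v : VSpace d) : MB P b g (tX i * v) = tX i * MB P b g v := by
  rw [MB_apply, MB_apply, map_mul, map_mul, D0_X, D1_X, mul_add]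
  congr 1
  generalize D1 P b g v = z
  induction z with
  | zero => simp
  | add z w hz hw => simp only [map_add, mul_add, hz, hw]
  | tmul x y => simp [add_mul, contrL_tmul, Algebra.TensorProduct.tmul_mul_tmul, hg.X_mul]

lemma IsNegFun.MB_ext (a : ℝ) : MB P b g (tExt a) = tExt a := by
  rw [MB_apply, D0_ext, D1_ext, contrL_tmul, show g (tExt a) = 0 from hg.root a 0, zero_smul,
    add_zero]

/-- A component containing the root of a planted tree is itself planted if it contains the edge, and
otherwise is a single node. Both are killed by `g`, so extraction happens strictly inside the
branch. -/
lemma IsNegFun.MB_ext_mul_integ (a : ℝ) (m : MIdx d) (v : VSpace d) :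
    MB P b g (tExt a * integ m v) = tExt a * integB b m (MB P b g v) := by
  rw [MB_apply, map_mul, map_mul, D0_ext, D1_ext, D0_I, D1_I, mul_add, map_add, Finset.mul_sum,
    map_sum]
  have h1 : ∀ z : VSpace d ⊗[ℝ] VSpace d, contrL g (tExt a ⊗ₜ tExt a * TensorProduct.map
      (integB b m) (LinearMap.mulLeft ℝ (tExt (P.degKernel - P.deg m))) z) = 0 := by
    intro z
    induction z with
    | zero => simp
    | add z w hz hw => simp only [map_add, mul_add, hz, hw, add_zero]
    | tmul x y => simp [contrL_tmul, Algebra.TensorProduct.tmul_mul_tmul, hg.ext_mul_integB]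
  rw [h1, zero_add, Finset.sum_eq_zero fun p _ => ?_, add_zero]
  rw [Algebra.TensorProduct.tmul_mul_tmul, contrL_tmul, hg.ext_mul_dp, zero_smul]

lemma IsNegFun.MB_ext_mul_Xi (a : ℝ) (l : MIdx d) :
    MB P b g (tExt a * tr (.Xi l)) = tExt a * xiB b l := by
  rw [MB_apply, map_mul, map_mul, D0_ext, D1_ext, D0_Xi, D1_Xi, mul_add, map_add, Finset.mul_sum,
    map_sum, Finset.sum_eq_zero fun p _ => ?_]
  · simp [contrL_tmul, Algebra.TensorProduct.tmul_mul_tmul, hg.ext_mul_xiB]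
  · rw [Algebra.TensorProduct.tmul_mul_tmul, contrL_tmul, hg.ext_mul_dp, zero_smul]

/-- Composition preserves the functionals on negative trees. -/
theorem IsNegFun.compFun {h : VSpace d →ₗ[ℝ] ℝ} (hh : IsNegFun P h) :
    IsNegFun P (compFun P b g h) := by
  intro σ hσ
  by_contra hneg
  have hgσ : g (tr σ) = 0 := by
    by_contra h0
    exact hneg (hg σ h0)
  rw [RegStr.compFun, LinearMap.add_apply, hgσ, zero_add, LinearMap.comp_apply] at hσ
  apply hneg
  refine ⟨?_, ?_, ?_⟩
  · obtain ⟨t⟩ := σ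
    change h (MB P b g (tr (.mk t))) ≠ 0 at hσ
    rw [MB_eq_sum_sigma, map_sum] at hσ
    obtain ⟨c, -, hc⟩ := Finset.exists_ne_zero_of_sum_ne_zero hσ
    rw [map_smul, smul_eq_mul] at hc
    have h1 := (hh _ (right_ne_zero_of_mul hc)).1
    have h2 := forestVal_ne_zero.1 (right_ne_zero_of_mul (left_ne_zero_of_mul hc))
    change (Tree.mk t).degS P < 0
    rw [← c.2.degS_contracted P]
    have h3 : (c.2.extracted.map (Tree.degS P)).sum ≤ 0 := by
      refine (Multiset.sum_le_card_nsmul _ 0 ?_).trans (by simp)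
      intro x hx
      obtain ⟨σ, hσ, rfl⟩ := Multiset.mem_map.1 hx
      exact (hg σ (h2 σ hσ)).1.le
    linarith
  -- A nonzero root polynomial allows a factor X_i to be split off. That factor passes through the
  -- inner extraction and is then killed by `h`.
  · by_contra h0
    obtain ⟨i, hi⟩ := Function.ne_iff.1 h0
    obtain ⟨σ, rfl⟩ := Tree.exists_eq_X_mul hi
    rw [tr_mul] at hσ
    exact hσ ((congrArg h (hg.MB_X_mul b i _)).trans (hh.X_mul i _))
  · rintro ⟨a, ⟨l, rfl⟩ | ⟨m, σ, rfl⟩⟩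
    · rw [tr_mul] at hσ
      exact hσ ((congrArg h (hg.MB_ext_mul_Xi b a l)).trans (hh.ext_mul_xiB b a l))
    · rw [tr_mul, ← integ_tr] at hσ
      exact hσ ((congrArg h (hg.MB_ext_mul_integ b a m _)).trans (hh.ext_mul_integB b a m _))

end NegFun

/-! ### The counit -/

section Counit

open Filter

/-- The functional which is `1` on the trees `𝟏^a` and vanishes on all other trees. -/
def counit : VSpace d →ₐ[ℝ] ℝ := TreeRec.hom
  { ext := fun _ => 1, ext_zero := rfl, ext_add := fun _ _ => (one_mul 1).symm, X := fun _ => 0,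
    Xi := fun _ => 0, I := fun _ _ _ => 0 }

lemma counit_ext (a : ℝ) : counit (tExt a : VSpace d) = 1 := TreeRec.hom_ext _ a

lemma counit_X (i : Fin d) : counit (tX i) = 0 := TreeRec.hom_X _ i

lemma counit_Xi (l : MIdx d) : counit (tr (.Xi l)) = 0 := TreeRec.hom_Xi _ l

lemma counit_integ (m : MIdx d) (v : VSpace d) : counit (integ m v) = 0 := by
  refine eq_zero_of_forall_tr (F := counit.toLinearMap ∘ₗ integ m) (fun τ => ?_) v
  simp only [LinearMap.comp_apply, integ_tr]
  exact TreeRec.hom_I _ m τ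

lemma counit_xiB (b l : MIdx d) : counit (xiB b l) = 0 := by
  by_cases h : l ≤ b
  · rw [xiB_of_le h, counit_Xi]
  · rw [xiB_of_not_le h, map_zero]

lemma counit_integB (b m : MIdx d) (v : VSpace d) : counit (integB b m v) = 0 := by
  by_cases h : m ≤ b
  · rw [integB_of_le h, counit_integ]
  · rw [integB_of_not_le h, LinearMap.zero_apply, map_zero]

lemma counit_tr (τ : Tree d) [Decidable (∃ a, τ = .ext a)] :
    counit (tr τ) = if ∃ a, τ = .ext a then 1 else 0 := by
  split_ifs with h
  · obtain ⟨a, rfl⟩ := h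
    exact counit_ext a
  · obtain ⟨t⟩ := τ
    change counit (tr (.mk t)) = 0
    cases t with
    | root a k =>
      obtain ⟨i, hi⟩ : ∃ i, k i ≠ 0 := by
        by_contra! hk
        exact h ⟨a, by rw [show k = 0 from funext hk]; rfl⟩
      obtain ⟨σ, hσ⟩ := Tree.exists_eq_X_mul (σ := .mk (.root a k)) (i := i) hi
      rw [hσ, tr_mul, map_mul]
      exact mul_eq_zero_of_left (counit_X i) _
    | noise l t => rw [Tree.mk_noise, tr_mul, map_mul, counit_Xi, zero_mul]
    | kern m s t => rw [Tree.mk_kern, tr_mul, map_mul, ← integ_tr, counit_integ, zero_mul]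

/-- The projection onto the trees with all edge decorations in the box. -/
def projBox (b : MIdx d) : VSpace d →ₐ[ℝ] VSpace d := TreeRec.hom
  { ext := tExt, ext_zero := rfl, ext_add := tExt_add, X := tX, Xi := xiB b,
    I := fun m _ w => integB b m w }

lemma eventually_projBox (τ : Tree d) : ∀ᶠ b in atTop, projBox b (tr τ) = tr τ := by
  induction τ using Tree.induction_gen with
  | ext a => exact .of_forall fun b => TreeRec.hom_ext _ a
  | X i => exact .of_forall fun b => TreeRec.hom_X _ i
  | Xi l =>
    filter_upwards [eventually_ge_atTop l] with b hb
    exact (TreeRec.hom_Xi _ l).trans (xiB_of_le hb)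
  | I m σ ih =>
    filter_upwards [ih, eventually_ge_atTop m] with b h hb
    refine (TreeRec.hom_I _ m σ).trans ?_
    change integB b m (projBox b (tr σ)) = _
    rw [h, integB_of_le hb, integ_tr]
  | mul σ τ h1 h2 =>
    filter_upwards [h1, h2] with b h1 h2
    rw [tr_mul, map_mul, h1, h2]

variable (P : Degrees d) (b : MIdx d) (g : VSpace d →ₗ[ℝ] ℝ)

lemma counit_comp_D0 : counit.comp (D0 P b g) = (counit : VSpace d →ₐ[ℝ] ℝ) := by
  refine algHom_ext_gen (fun a => ?_) (fun i => ?_) (fun l => ?_) fun m σ _ => ?_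
  · simp [D0_ext]
  · simp [D0_X]
  · simp [D0_Xi, counit_xiB, counit_Xi]
  · simp [← integ_tr, D0_I, counit_integ, counit_integB]

/-- The quotient is of the form 𝟏^a only if the whole tree with all its polynomial decorations is
extracted. This leaves the tree itself in the left factor, subject to the box, and no other
component on which `g` could act. -/
lemma counit_comp_D1 : (Algebra.TensorProduct.rid ℝ ℝ (VSpace d)).toAlgHom.comp
    ((Algebra.TensorProduct.map (AlgHom.id ℝ (VSpace d)) counit).comp (D1 P b g)) =
      projBox b := by
  refine algHom_ext_gen (fun a => ?_) (fun i => ?_) (fun l => ?_) fun m σ ih => ?_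
  · refine Eq.trans ?_ (TreeRec.hom_ext _ a).symm
    simp [D1_ext, counit_ext]
  · refine Eq.trans ?_ (TreeRec.hom_X _ i).symm
    simp [D1_X, counit_ext, counit_X]
  · refine Eq.trans ?_ (TreeRec.hom_Xi _ l).symm
    simp [D1_Xi, counit_ext, counit_xiB]
  · refine Eq.trans ?_ (TreeRec.hom_I _ m σ).symm
    change _ = integB b m (projBox b (tr σ))
    rw [← ih]
    simp only [← integ_tr, AlgHom.comp_apply, D1_I, map_add, map_sum,
      Algebra.TensorProduct.map_tmul, map_mul, counit_integB, mul_zero, TensorProduct.tmul_zero,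
      Finset.sum_const_zero, add_zero]
    generalize D1 P b g (tr σ) = z
    induction z with
    | zero => simp
    | add z w hz hw => simp only [map_add, hz, hw]
    | tmul x y => simp [counit_ext]

/-- This recovers `g` from M_g; it yields the faithfulness of the negative action and the explicit
form of the product of characters. -/
lemma counit_MB (v : VSpace d) :
    counit (MB P b g v) = counit v + g (projBox b v) := by
  have h : ∀ z : VSpace d ⊗[ℝ] VSpace d, counit (contrL g z) =
      g (Algebra.TensorProduct.rid ℝ ℝ (VSpace d)
        (Algebra.TensorProduct.map (AlgHom.id ℝ (VSpace d)) counit z)) := by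
    intro z
    induction z with
    | zero => simp
    | add z w hz hw => simp only [map_add, hz, hw]
    | tmul x y => simp [contrL_tmul, mul_comm]
  rw [MB_apply, map_add, h, ← counit_comp_D1 P b g, ← AlgHom.comp_apply, counit_comp_D0]
  rfl

end Counit

end RegStr
end

/-! ### Closure of the extended trees under contraction, extraction and passage to branches. -/

noncomputable section

namespace RegStr

variable {d : ℕ}

/-! ### Conforming trees -/

namespace Tree

variable (R : Rule d)

/-- All nodes other than the root have their node type in the rule. -/
def ConfAbove : Tree d → Prop :=
  Quot.lift (PTree.ConformsAbove R) (fun _ _ => PTree.conformsAbove_step R)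

lemma confAbove_mul (σ τ : Tree d) :
    (σ * τ).ConfAbove R ↔ σ.ConfAbove R ∧ τ.ConfAbove R := by
  have hroot : ∀ (a : ℝ) (k : MIdx d) (t : PTree d),
      (t.addRoot a k).ConformsAbove R ↔ t.ConformsAbove R := by
    intro a k t
    induction t with
    | root b n => rfl
    | noise l t ih => simp only [PTree.addRoot, PTree.ConformsAbove, ih]
    | kern m s t _ ih => simp only [PTree.addRoot, PTree.ConformsAbove, ih]
  obtain ⟨s⟩ := σ
  obtain ⟨t⟩ := τ
  change (s.mul t).ConformsAbove R ↔ s.ConformsAbove R ∧ t.ConformsAbove R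
  induction s with
  | root a k => simpa [PTree.mul, PTree.ConformsAbove] using hroot a k t
  | noise l s ih => simp only [PTree.mul, PTree.ConformsAbove, ih, and_assoc]
  | kern m s' s _ ih => simp only [PTree.mul, PTree.ConformsAbove, ih, and_assoc]

lemma nodeType_mul (σ τ : Tree d) : (σ * τ).nodeType = σ.nodeType + τ.nodeType := by
  have hroot : ∀ (a : ℝ) (k : MIdx d) (t : PTree d),
      (t.addRoot a k).nodeType = t.nodeType := by
    intro a k t
    induction t with
    | root b n => rfl
    | noise l t ih => simp only [PTree.addRoot, PTree.nodeType, ih]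
    | kern m s t _ ih => simp only [PTree.addRoot, PTree.nodeType, ih]
  obtain ⟨s⟩ := σ
  obtain ⟨t⟩ := τ
  change (s.mul t).nodeType = s.nodeType + t.nodeType
  induction s with
  | root a k => simpa [PTree.mul, PTree.nodeType] using hroot a k t
  | noise l s ih => simp only [PTree.mul, PTree.nodeType, ih, Multiset.cons_add]
  | kern m s' s _ ih => simp only [PTree.mul, PTree.nodeType, ih, Multiset.cons_add]

lemma OZero.mul {σ τ : Tree d} (h1 : σ.OZero) (h2 : τ.OZero) : (σ * τ).OZero := by
  have hroot : ∀ (k : MIdx d) (t : PTree d), t.OZero → (t.addRoot 0 k).OZero := by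
    intro k t
    induction t with
    | root b n => simp [PTree.addRoot, PTree.OZero]
    | noise l t ih => exact ih
    | kern m s t _ ih => exact fun h => ⟨h.1, ih h.2⟩
  obtain ⟨s⟩ := σ
  obtain ⟨t⟩ := τ
  change s.OZero at h1
  change (s.mul t).OZero
  induction s with
  | root a k =>
    obtain rfl : a = 0 := h1
    exact hroot k t h2
  | noise l s ih => exact ih h1
  | kern m s' s _ ih => exact ⟨h1.1, ih h1.2⟩

lemma OZero_X (k : MIdx d) : (X k).OZero := rfl

lemma OZero_Xi (l : MIdx d) : (Xi l).OZero := rfl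

lemma OZero_I (m : MIdx d) (σ : Tree d) : (I m σ).OZero ↔ σ.OZero := by
  obtain ⟨s⟩ := σ
  exact and_iff_left rfl

lemma nodeType_X (k : MIdx d) : (X k).nodeType = 0 := rfl

lemma nodeType_Xi (l : MIdx d) : (Xi l).nodeType = {.noise l} := rfl

lemma nodeType_I (m : MIdx d) (σ : Tree d) : (I m σ).nodeType = {.kern m} := by
  obtain ⟨s⟩ := σ; rfl

lemma confAbove_X (k : MIdx d) : (X k).ConfAbove R := trivial

lemma confAbove_Xi (l : MIdx d) : (Xi l).ConfAbove R ↔ 0 ∈ R := and_iff_left trivial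

lemma confAbove_I (m : MIdx d) (σ : Tree d) : (I m σ).ConfAbove R ↔ σ.Conforms R := by
  obtain ⟨s⟩ := σ
  exact and_iff_left trivial

end Tree

/-- All trees carried by the kernel edges at the root belong to `S`. -/
def PTree.BranchIn (S : Set (Tree d)) : PTree d → Prop
  | .root _ _ => True
  | .noise _ t => BranchIn S t
  | .kern _ s t => Tree.mk s ∈ S ∧ BranchIn S t

lemma PTree.branchIn_step (S : Set (Tree d)) {t t' : PTree d} (h : PTree.Step t t') :
    t.BranchIn S = t'.BranchIn S := by
  induction h with
  | noise_noise => rfl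
  | noise_kern => rfl
  | kern_kern => simp only [BranchIn, eq_iff_iff]; tauto
  | noise_congr _ _ ih => exact ih
  | kern_congr_left m t h ih => simp only [BranchIn, show Tree.mk _ = Tree.mk _ from Quot.sound h]
  | kern_congr_right _ _ _ ih => simp only [BranchIn, ih]

namespace Tree

/-- All trees carried by the kernel edges at the root belong to `S`. -/
def BranchIn (S : Set (Tree d)) : Tree d → Prop :=
  Quot.lift (PTree.BranchIn S) (fun _ _ => PTree.branchIn_step S)

lemma branchIn_mul (S : Set (Tree d)) (σ τ : Tree d) :
    (σ * τ).BranchIn S ↔ σ.BranchIn S ∧ τ.BranchIn S := by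
  have hroot : ∀ (a : ℝ) (k : MIdx d) (t : PTree d),
      (t.addRoot a k).BranchIn S ↔ t.BranchIn S := by
    intro a k t
    induction t with
    | root b n => rfl
    | noise l t ih => exact ih
    | kern m s t _ ih => simp only [PTree.addRoot, PTree.BranchIn, ih]
  obtain ⟨s⟩ := σ
  obtain ⟨t⟩ := τ
  change (s.mul t).BranchIn S ↔ s.BranchIn S ∧ t.BranchIn S
  induction s with
  | root a k => simpa [PTree.mul, PTree.BranchIn] using hroot a k t
  | noise l s ih => exact ih
  | kern m s' s _ ih => simp only [PTree.mul, PTree.BranchIn, ih, and_assoc]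

lemma branchIn_I (S : Set (Tree d)) (m : MIdx d) (σ : Tree d) :
    (I m σ).BranchIn S ↔ σ ∈ S := by
  obtain ⟨s⟩ := σ
  exact and_iff_left trivial

lemma branchIn_Xi (S : Set (Tree d)) (l : MIdx d) : (Xi l).BranchIn S := trivial

lemma branchIn_root (S : Set (Tree d)) (a : ℝ) (k : MIdx d) : (root a k).BranchIn S := trivial

end Tree

section Closure

variable (P : Degrees d) (R : Rule d)

/-- The empty subforest. -/
def emptyCut : (t : PTree d) → Cut false t
  | .root a k => .rootOut a k
  | .noise l t => .noiseOut l (emptyCut t)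
  | .kern m s t => .kernOut m false (emptyCut s) (emptyCut t)

lemma extracted_emptyCut (t : PTree d) : (emptyCut t).extracted = 0 := by
  induction t with
  | root a k => rfl
  | noise l t ih => exact ih
  | kern m s t ihs iht =>
    simp only [Cut.extracted, emptyCut, Cut.others, Bool.false_eq_true, if_false, zero_add]
      at ihs iht ⊢
    rw [ihs, iht, add_zero]

lemma contracted_emptyCut (t : PTree d) : (emptyCut t).contracted P = Tree.mk t := by
  induction t with
  | root a k => rfl
  | noise l t ih => rw [emptyCut, Cut.contracted, ih, Tree.mk_noise]
  | kern m s t ihs iht => rw [emptyCut, Cut.contracted, ihs, iht, Tree.mk_kern]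

lemma coef_emptyCut (t : PTree d) : (emptyCut t).coef = 1 := by
  induction t with
  | root a k => rfl
  | noise l t ih => exact ih
  | kern m s t ihs iht => rw [emptyCut, Cut.coef, ihs, iht, one_mul]

/-- This isolates the identity term of M_g: every other subforest really extracts a tree. -/
lemma eq_emptyCut {e : Bool} {t : PTree d} (c : Cut e t) (h : c.extracted = 0) :
    (⟨e, c⟩ : Σ e, Cut e t) = ⟨false, emptyCut t⟩ := by
  induction c with
  | rootOut => rfl
  | rootIn => simp [Cut.extracted] at h
  | noiseOut l c ih =>
    have := ih h
    simp only [Sigma.mk.injEq, heq_eq_eq, true_and] at this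
    rw [this]; rfl
  | noiseBdry => simp [Cut.extracted] at h
  | noiseIn => simp [Cut.extracted] at h
  | kernOut m e c' c ih' ih =>
    have h1 : c'.extracted + c.others = 0 := by simpa [Cut.extracted, Cut.others] using h
    rw [add_eq_zero] at h1
    have h2 := ih' h1.1
    have h3 := ih (by simpa [Cut.extracted] using h1.2)
    cases e with
    | true => simp at h2
    | false =>
      simp only [Sigma.mk.injEq, heq_eq_eq, true_and] at h2 h3
      rw [h2, h3]; rfl
  | kernBdry => simp [Cut.extracted] at h
  | kernIn => simp [Cut.extracted] at h

variable {R}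

/-- Inside a component a node keeps only some of its edges, with unchanged types, so normality of
the rule applies. For the root only the inclusion of node types is recorded, because in the
induction the root has not yet received all its edges. -/
lemma extracted_aux (hR : R.IsNormal) {e : Bool} {t : PTree d} (c : Cut e t)
    (h0 : t.OZero) (h1 : t.ConformsAbove R) :
    (∀ σ ∈ c.others, σ ∈ TCirc R) ∧ (e = true → c.comp.OZero ∧ c.comp.ConfAbove R ∧
      c.comp.nodeType ≤ t.nodeType) := by
  induction c with
  | rootOut => simp [Cut.others]
  | rootIn a k n h => exact ⟨by simp [Cut.others], fun _ => ⟨h0, trivial, le_rfl⟩⟩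
  | noiseOut l c ih => exact ⟨(ih h0 h1.2).1, by simp⟩
  | noiseBdry l p c ih =>
    obtain ⟨h2, h3, h4, h5⟩ := by simpa using ih h0 h1.2
    refine ⟨h2, fun _ => ⟨(Tree.OZero_X p).mul h3,
      (Tree.confAbove_mul R _ _).2 ⟨Tree.confAbove_X R p, h4⟩, ?_⟩⟩
    rw [Cut.comp, Tree.nodeType_mul, Tree.nodeType_X, zero_add]
    exact h5.trans (Multiset.le_cons_self _ _)
  | noiseIn l c ih =>
    obtain ⟨h2, h3, h4, h5⟩ := by simpa using ih h0 h1.2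
    refine ⟨h2, fun _ => ⟨(Tree.OZero_Xi l).mul h3,
      (Tree.confAbove_mul R _ _).2 ⟨(Tree.confAbove_Xi R l).2 h1.1, h4⟩, ?_⟩⟩
    rw [Cut.comp, Tree.nodeType_mul, Tree.nodeType_Xi, PTree.nodeType, Multiset.singleton_add]
    exact (Multiset.cons_le_cons_iff _).2 h5
  | kernOut m e c' c ih' ih =>
    obtain ⟨h2, h3⟩ := ih' h0.1 h1.1.2
    refine ⟨?_, by simp⟩
    intro σ hσ
    rw [Cut.others, Multiset.mem_add, Multiset.mem_add] at hσ
    rcases hσ with (hσ | hσ) | hσ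
    · cases e with
      | false => simp at hσ
      | true =>
        obtain rfl : σ = c'.comp := by simpa using hσ
        obtain ⟨h3, h4, h5⟩ := h3 rfl
        exact ⟨h3, hR _ _ h5 h1.1.1, h4⟩
    · exact h2 σ hσ
    · exact (ih h0.2 h1.2).1 σ hσ
  | kernBdry m p e c' c ih' ih =>
    obtain ⟨h2, h3⟩ := ih' h0.1 h1.1.2
    obtain ⟨h2', h3', h4', h5'⟩ := by simpa using ih h0.2 h1.2
    refine ⟨?_, fun _ => ⟨(Tree.OZero_X p).mul h3',
      (Tree.confAbove_mul R _ _).2 ⟨Tree.confAbove_X R p, h4'⟩, ?_⟩⟩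
    · intro σ hσ
      rw [Cut.others, Multiset.mem_add, Multiset.mem_add] at hσ
      rcases hσ with (hσ | hσ) | hσ
      · cases e with
        | false => simp at hσ
        | true =>
          obtain rfl : σ = c'.comp := by simpa using hσ
          obtain ⟨h3, h4, h5⟩ := h3 rfl
          exact ⟨h3, hR _ _ h5 h1.1.1, h4⟩
      · exact h2 σ hσ
      · exact h2' σ hσ
    · rw [Cut.comp, Tree.nodeType_mul, Tree.nodeType_X, zero_add]
      exact h5'.trans (Multiset.le_cons_self _ _)
  | kernIn m c' c ih' ih =>
    obtain ⟨h2, h3, h4, h5⟩ := by simpa using ih' h0.1 h1.1.2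
    obtain ⟨h2', h3', h4', h5'⟩ := by simpa using ih h0.2 h1.2
    refine ⟨?_, fun _ => ⟨((Tree.OZero_I m _).2 h3).mul h3', (Tree.confAbove_mul R _ _).2
      ⟨(Tree.confAbove_I R m _).2 ⟨hR _ _ h5 h1.1.1, h4⟩, h4'⟩, ?_⟩⟩
    · intro σ hσ
      rw [Cut.others, Multiset.mem_add] at hσ
      exact hσ.elim (h2 σ) (h2' σ)
    · rw [Cut.comp, Tree.nodeType_mul, Tree.nodeType_I, PTree.nodeType, Multiset.singleton_add]
      exact (Multiset.cons_le_cons_iff _).2 h5'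

lemma comp_mem_TCirc (hR : R.IsNormal) {t : PTree d} (c : Cut true t) (ht : Tree.mk t ∈ TCirc R) :
    c.comp ∈ TCirc R := by
  obtain ⟨h1, h2, h3⟩ := (extracted_aux hR c ht.1 ht.2.2).2 rfl
  exact ⟨h1, hR _ _ h3 ht.2.1, h2⟩

lemma extracted_mem_TCirc (hR : R.IsNormal) {e : Bool} {t : PTree d} (c : Cut e t)
    (ht : Tree.mk t ∈ TCirc R) : ∀ σ ∈ c.extracted, σ ∈ TCirc R := by
  intro σ hσ
  rw [Cut.extracted, Multiset.mem_add] at hσ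
  rcases hσ with hσ | hσ
  · cases e with
    | false => simp at hσ
    | true =>
      obtain rfl : σ = c.comp := by simpa using hσ
      exact comp_mem_TCirc hR c ht
  · exact (extracted_aux hR c ht.1 ht.2.2).1 σ hσ

variable {P}

/-- Branches of a contracted tree are contracted trees. -/
lemma branchIn_contracted {e : Bool} {t : PTree d} (c : Cut e t)
    (h0 : t.OZero) (h1 : t.ConformsAbove R) (hc : ∀ σ ∈ c.others, σ ∈ TMinus P R) :
    (c.contracted P).BranchIn (TExCirc P R) := by
  induction c with
  | rootOut => trivial
  | rootIn => trivial
  | noiseOut l c ih => exact (Tree.branchIn_mul _ _ _).2 ⟨Tree.branchIn_Xi _ l, ih h0 h1.2 hc⟩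
  | noiseBdry l p c ih =>
    exact (Tree.branchIn_mul _ _ _).2 ⟨(Tree.branchIn_mul _ _ _).2
      ⟨Tree.branchIn_root _ _ _, Tree.branchIn_Xi _ _⟩, ih h0 h1.2 hc⟩
  | noiseIn l c ih =>
    exact (Tree.branchIn_mul _ _ _).2 ⟨Tree.branchIn_root _ _ _, ih h0 h1.2 hc⟩
  | @kernOut m s t e c' c ih' ih =>
    simp only [Cut.others, Multiset.mem_add] at hc
    exact (Tree.branchIn_mul _ _ _).2 ⟨(Tree.branchIn_I _ _ _).2
      ⟨s, ⟨h0.1, h1.1⟩, e, c', fun σ hσ => hc σ (.inl (Multiset.mem_add.1 hσ)), rfl⟩,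
      ih h0.2 h1.2 fun σ hσ => hc σ (.inr hσ)⟩
  | @kernBdry m p s t e c' c ih' ih =>
    simp only [Cut.others, Multiset.mem_add] at hc
    exact (Tree.branchIn_mul _ _ _).2 ⟨(Tree.branchIn_mul _ _ _).2 ⟨Tree.branchIn_root _ _ _,
      (Tree.branchIn_I _ _ _).2
      ⟨s, ⟨h0.1, h1.1⟩, e, c', fun σ hσ => hc σ (.inl (Multiset.mem_add.1 hσ)), rfl⟩⟩,
      ih h0.2 h1.2 fun σ hσ => hc σ (.inr hσ)⟩
  | kernIn m c' c ih' ih =>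
    simp only [Cut.others, Multiset.mem_add] at hc
    exact (Tree.branchIn_mul _ _ _).2 ⟨(Tree.branchIn_mul _ _ _).2 ⟨Tree.branchIn_root _ _ _,
      ih' h0.1 h1.1.2 fun σ hσ => hc σ (.inl hσ)⟩,
      ih h0.2 h1.2 fun σ hσ => hc σ (.inr hσ)⟩

lemma branchIn_of_mem {τ : Tree d} (h : τ ∈ TExCirc P R) : τ.BranchIn (TExCirc P R) := by
  obtain ⟨t, ht, e, c, hc, rfl⟩ := h
  exact branchIn_contracted c ht.1 ht.2.2 fun σ hσ => hc σ (Multiset.mem_add.2 (.inr hσ))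

theorem branch_mem (m : MIdx d) (σ τ : Tree d) (h : Tree.I m σ * τ ∈ TExCirc P R) :
    σ ∈ TExCirc P R :=
  (Tree.branchIn_I _ m σ).1 ((Tree.branchIn_mul _ _ _).1 (branchIn_of_mem h)).1

/-! ### Positivity -/

/-- Linear functionals which are nonnegative on trees. -/
def NonnegFun (u : VSpace d →ₗ[ℝ] ℝ) : Prop := ∀ σ, 0 ≤ u (tr σ)

open Classical in
/-- The indicator functional of a set of trees. -/
def indFun (S : Set (Tree d)) : VSpace d →ₗ[ℝ] ℝ := linExt fun τ => if τ ∈ S then 1 else 0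

open Classical in
lemma indFun_tr (S : Set (Tree d)) (τ : Tree d) : indFun S (tr τ) = if τ ∈ S then 1 else 0 :=
  linExt_tr _ _

lemma indFun_ne_zero {S : Set (Tree d)} {τ : Tree d} : indFun S (tr τ) ≠ 0 ↔ τ ∈ S := by
  classical
  simp [indFun_tr]

lemma indFun_pos {S : Set (Tree d)} {τ : Tree d} (h : τ ∈ S) : 0 < indFun S (tr τ) := by
  classical
  simp [indFun_tr, h]

lemma indFun_nonneg (S : Set (Tree d)) : NonnegFun (indFun S) := by
  classical
  intro σ
  rw [indFun_tr]
  split_ifs <;> norm_num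

lemma NonnegFun.forestVal {g : VSpace d →ₗ[ℝ] ℝ} (hg : NonnegFun g) (F : Multiset (Tree d)) :
    0 ≤ forestVal g F :=
  Multiset.prod_nonneg fun x hx => by
    obtain ⟨σ, -, rfl⟩ := Multiset.mem_map.1 hx
    exact hg σ

lemma NonnegFun.comp_MB {u g : VSpace d →ₗ[ℝ] ℝ} (hu : NonnegFun u) (hg : NonnegFun g)
    (b : MIdx d) : NonnegFun (u ∘ₗ MB P b g) := by
  rintro ⟨t⟩
  change 0 ≤ u (MB P b g (tr (.mk t)))
  rw [MB_eq_sum_sigma, map_sum]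
  refine Finset.sum_nonneg fun c _ => ?_
  rw [map_smul]
  exact mul_nonneg (mul_nonneg c.2.coef_pos.le (hg.forestVal _)) (hu _)

/-- Together with `exists_of_MB_ne_zero` this translates between contractions and coefficients: one
admissible subforest makes the sum positive, and a nonzero sum has an admissible subforest. -/
lemma NonnegFun.MB_pos {u g : VSpace d →ₗ[ℝ] ℝ} (hu : NonnegFun u) (hg : NonnegFun g)
    {b : MIdx d} {t : PTree d} {e : Bool} {c : Cut e t} (hc : c ∈ boxCuts b t e)
    (hc1 : ∀ σ ∈ c.extracted, g (tr σ) ≠ 0) (hc2 : 0 < u (tr (c.contracted P))) :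
    0 < u (MB P b g (tr (.mk t))) := by
  rw [MB_eq_sum_sigma, map_sum]
  refine Finset.sum_pos' (fun c _ => ?_) ⟨⟨e, c⟩, by simpa using hc, ?_⟩
  · rw [map_smul]
    exact mul_nonneg (mul_nonneg c.2.coef_pos.le (hg.forestVal _)) (hu _)
  · rw [map_smul]
    exact mul_pos (mul_pos c.coef_pos ((hg.forestVal _).lt_of_ne'
      (forestVal_ne_zero.2 hc1))) hc2

lemma exists_of_MB_ne_zero {u g : VSpace d →ₗ[ℝ] ℝ} {b : MIdx d} {t : PTree d}
    (h : u (MB P b g (tr (.mk t))) ≠ 0) : ∃ (e : Bool) (c : Cut e t),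
      (∀ σ ∈ c.extracted, g (tr σ) ≠ 0) ∧ u (tr (c.contracted P)) ≠ 0 := by
  rw [MB_eq_sum_sigma, map_sum] at h
  obtain ⟨c, -, hc⟩ := Finset.exists_ne_zero_of_sum_ne_zero h
  rw [map_smul, smul_eq_mul] at hc
  exact ⟨c.1, c.2, forestVal_ne_zero.1 (right_ne_zero_of_mul (left_ne_zero_of_mul hc)),
    right_ne_zero_of_mul hc⟩

lemma isNegFun_ind_TMinus : IsNegFun P (indFun (TMinus P R)) := fun _ h => (indFun_ne_zero.1 h).2

lemma isNegFun_ind_TExMinus : IsNegFun P (indFun (TExMinus P R)) :=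
  fun _ h => (indFun_ne_zero.1 h).2

/-- With indicator functionals, the two successive contractions t₀ → t → result give a positive
coefficient in the composite operator. Coassociativity rewrites this operator as a single extraction
from t₀, so some subforest of t₀ contracts to the same result in one step. -/
theorem contracted_mem (hR : R.IsNormal) (t : PTree d) (ht : Tree.mk t ∈ TExCirc P R) (e : Bool)
    (c : Cut e t) (hc : ∀ σ ∈ c.extracted, σ ∈ TExMinus P R) : c.contracted P ∈ TExCirc P R := by
  obtain ⟨t₀, ht₀, e₀, c₀, hc₀, h₀⟩ := ht
  obtain ⟨b, hb, hb₀⟩ := (c.eventually_mem_boxCuts.and c₀.eventually_mem_boxCuts).exists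
  have h1 : 0 < (indFun {c.contracted P} ∘ₗ MB P b (indFun (TExMinus P R)))
      (MB P b (indFun (TMinus P R)) (tr (.mk t₀))) := by
    refine ((indFun_nonneg _).comp_MB (indFun_nonneg _) b).MB_pos (indFun_nonneg _) hb₀
      (fun σ hσ => indFun_ne_zero.2 (hc₀ σ hσ)) ?_
    rw [h₀]
    exact (indFun_nonneg _).MB_pos (indFun_nonneg _) hb
      (fun σ hσ => indFun_ne_zero.2 (hc σ hσ)) (indFun_pos rfl)
  rw [LinearMap.comp_apply, (coassoc P b _ _ _).MB_MB] at h1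
  obtain ⟨e₁, c₁, h2, h3⟩ := exists_of_MB_ne_zero h1.ne'
  have h4 : c₁.contracted P ∈ ({c.contracted P} : Set (Tree d)) := indFun_ne_zero.1 h3
  -- Membership of the new components in `TMinus` has two sources: they conform because they sit
  -- inside t₀, and they satisfy `NegCond` because the composite functional lives on such trees.
  refine ⟨t₀, ht₀, e₁, c₁, fun σ hσ => ⟨extracted_mem_TCirc hR c₁ ht₀ σ hσ, ?_⟩, h4⟩
  exact isNegFun_ind_TMinus.compFun b isNegFun_ind_TExMinus σ (h2 σ hσ)

/-- Same positivity argument, now with `Coassoc.map_MB` in place of the composition law: a root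
component of a contracted tree is a contraction of a root component of the original conforming tree.
The functional `one` accepts all other components and all quotients, as these are irrelevant here.
-/
lemma comp_mem (hR : R.IsNormal) {t : PTree d} (ht : Tree.mk t ∈ TExCirc P R) (c : Cut true t) :
    c.comp ∈ TExCirc P R := by
  obtain ⟨t₀, ht₀, e₀, c₀, hc₀, h₀⟩ := ht
  obtain ⟨b, hb, hb₀⟩ := (c.eventually_mem_boxCuts.and c₀.eventually_mem_boxCuts).exists
  let one : VSpace d →ₗ[ℝ] ℝ := indFun Set.univ
  let u : VSpace d →ₗ[ℝ] ℝ := indFun {c.comp}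
  let w : VSpace d →ₗ[ℝ] ℝ := one ∘ₗ contrL u ∘ₗ (D1 P b one).toLinearMap
  have hone : NonnegFun one := indFun_nonneg _
  have hsum : ∀ (u' h' : VSpace d →ₗ[ℝ] ℝ) (s : PTree d),
      one (contrL u' (D1 P b h' (tr (.mk s)))) = ∑ c ∈ boxCuts b s true,
        (c.coef * forestVal h' c.others) * (u' (tr c.comp) * one (tr (c.contracted P))) := by
    intro u' h' s
    rw [(D0_eq_sum_and_D1_eq_sum b P h' s).2, map_sum, map_sum]
    simp only [map_smul, contrL_tmul, smul_eq_mul]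
  have hw : NonnegFun w := by
    rintro ⟨s⟩
    refine (hsum u one s).symm ▸ Finset.sum_nonneg fun c _ => ?_
    exact mul_nonneg (mul_nonneg c.coef_pos.le (hone.forestVal _))
      (mul_nonneg (indFun_nonneg _ _) (hone _))
  have h1 : 0 < w (MB P b (indFun (TMinus P R)) (tr (.mk t₀))) := by
    refine hw.MB_pos (indFun_nonneg _) hb₀ (fun σ hσ => indFun_ne_zero.2 (hc₀ σ hσ)) ?_
    rw [h₀]
    refine (hsum u one t).symm ▸ Finset.sum_pos' (fun c _ => ?_) ⟨c, hb, ?_⟩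
    · exact mul_nonneg (mul_nonneg c.coef_pos.le (hone.forestVal _))
        (mul_nonneg (indFun_nonneg _ _) (hone _))
    · exact mul_pos (mul_pos c.coef_pos ((hone.forestVal _).lt_of_ne' (forestVal_ne_zero.2
        fun σ _ => indFun_ne_zero.2 trivial))) (mul_pos (indFun_pos rfl) (indFun_pos trivial))
  have h2 : w (MB P b (indFun (TMinus P R)) (tr (.mk t₀))) =
      one (contrL (u ∘ₗ MB P b (indFun (TMinus P R)))
        (D1 P b (compFun P b (indFun (TMinus P R)) one) (tr (.mk t₀)))) := by
    change one (contrL u (D1 P b one (MB P b (indFun (TMinus P R)) (tr (.mk t₀))))) = _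
    rw [← (coassoc P b (indFun (TMinus P R)) one (tr (.mk t₀))).map_MB]
    congr 1
    generalize D1 P b _ (tr (.mk t₀)) = z
    induction z with
    | zero => simp
    | add z w hz hw => simp only [map_add, hz, hw]
    | tmul x y => simp [contrL_tmul]
  rw [h2, hsum] at h1
  obtain ⟨c₁, -, h3⟩ := Finset.exists_ne_zero_of_sum_ne_zero h1.ne'
  have h4 := left_ne_zero_of_mul (right_ne_zero_of_mul h3)
  obtain ⟨s, hs⟩ : ∃ s, Tree.mk s = c₁.comp := Quot.exists_rep _
  rw [← hs] at h4
  obtain ⟨e₂, c₂, h5, h6⟩ := exists_of_MB_ne_zero (u := u) (g := indFun (TMinus P R)) h4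
  have h7 : c₂.contracted P ∈ ({c.comp} : Set (Tree d)) := indFun_ne_zero.1 h6
  exact ⟨s, hs ▸ comp_mem_TCirc hR c₁ ht₀, e₂, c₂, fun σ hσ => indFun_ne_zero.1 (h5 σ hσ), h7⟩

/-- The hypothesis concerns the branches rather than the tree, since the branch condition passes to
the remaining edges at the root in the induction. -/
lemma others_mem (hR : R.IsNormal) {e : Bool} {t : PTree d} (c : Cut e t)
    (ht : t.BranchIn (TExCirc P R)) : ∀ σ ∈ c.others, σ ∈ TExCirc P R := by
  have key : ∀ {e : Bool} {s : PTree d} (c' : Cut e s), Tree.mk s ∈ TExCirc P R →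
      ∀ σ, σ ∈ (if e then {c'.comp} else (0 : Multiset (Tree d))) → σ ∈ TExCirc P R := by
    intro e s c' hs σ hσ
    cases e with
    | false => simp at hσ
    | true =>
      obtain rfl : σ = c'.comp := by simpa using hσ
      exact comp_mem hR hs c'
  induction c with
  | rootOut => simp [Cut.others]
  | rootIn => simp [Cut.others]
  | noiseOut l c ih => exact ih ht
  | noiseBdry l p c ih => exact ih ht
  | noiseIn l c ih => exact ih ht
  | kernOut m e c' c ih' ih =>
    intro σ hσ
    rw [Cut.others, Multiset.mem_add, Multiset.mem_add] at hσ
    rcases hσ with (hσ | hσ) | hσ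
    · exact key c' ht.1 σ hσ
    · exact ih' (branchIn_of_mem ht.1) σ hσ
    · exact ih ht.2 σ hσ
  | kernBdry m p e c' c ih' ih =>
    intro σ hσ
    rw [Cut.others, Multiset.mem_add, Multiset.mem_add] at hσ
    rcases hσ with (hσ | hσ) | hσ
    · exact key c' ht.1 σ hσ
    · exact ih' (branchIn_of_mem ht.1) σ hσ
    · exact ih ht.2 σ hσ
  | kernIn m c' c ih' ih =>
    intro σ hσ
    rw [Cut.others, Multiset.mem_add] at hσ
    exact hσ.elim (ih' (branchIn_of_mem ht.1) σ) (ih ht.2 σ)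

lemma extracted_mem (hR : R.IsNormal) {e : Bool} {t : PTree d} (c : Cut e t)
    (ht : Tree.mk t ∈ TExCirc P R) : ∀ σ ∈ c.extracted, σ ∈ TExCirc P R := by
  intro σ hσ
  rw [Cut.extracted, Multiset.mem_add] at hσ
  rcases hσ with hσ | hσ
  · cases e with
    | false => simp at hσ
    | true =>
      obtain rfl : σ = c.comp := by simpa using hσ
      exact comp_mem hR ht c
  · exact others_mem hR c (branchIn_of_mem ht) σ hσ

/-- A subforest of the branch is also a subforest of the planted tree that avoids its root. This is
needed to use admissibility on each tree of M_g τ separately. -/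
lemma I_contracted_mem (hR : R.IsNormal) {m : MIdx d} {t : PTree d}
    (ht : Tree.I m (.mk t) ∈ TExCirc P R) {e : Bool} (c : Cut e t)
    (hc : ∀ σ ∈ c.extracted, σ ∈ TExMinus P R) : Tree.I m (c.contracted P) ∈ TExCirc P R := by
  have h := contracted_mem hR (.kern m t (.root 0 0)) ht false (.kernOut m e c (.rootOut 0 0))
    (fun σ hσ => hc σ ?_)
  · rw [Cut.contracted] at h
    exact mul_one (Tree.I m (c.contracted P)) ▸ h
  · simpa [Cut.extracted, Cut.others] using hσ

end Closure

end RegStr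
end

/-! ### The negative group: its action on trees and its inverses. -/

noncomputable section

namespace RegStr

variable {d : ℕ}

/-! ### The number of edges -/

/-- The number of edges. -/
def PTree.edges : PTree d → ℕ
  | .root _ _ => 0
  | .noise _ t => t.edges + 1
  | .kern _ s t => s.edges + t.edges + 1

lemma PTree.edges_step {t t' : PTree d} (h : PTree.Step t t') : t.edges = t'.edges := by
  induction h <;> simp only [edges, *] <;> ring

namespace Tree

/-- The number of edges. -/
def edges : Tree d → ℕ := Quot.lift PTree.edges fun _ _ => PTree.edges_step

lemma edges_mul (σ τ : Tree d) : (σ * τ).edges = σ.edges + τ.edges := by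
  have hroot : ∀ (a : ℝ) (k : MIdx d) (t : PTree d), (t.addRoot a k).edges = t.edges := by
    intro a k t
    induction t with
    | root b n => rfl
    | noise l t ih => simp only [PTree.addRoot, PTree.edges, ih]
    | kern m s t _ ih => simp only [PTree.addRoot, PTree.edges, ih]
  obtain ⟨s⟩ := σ
  obtain ⟨t⟩ := τ
  change (s.mul t).edges = s.edges + t.edges
  induction s with
  | root a k => simpa [PTree.mul, PTree.edges] using hroot a k t
  | noise l s ih => simp only [PTree.mul, PTree.edges, ih]; ring
  | kern m s' s _ ih => simp only [PTree.mul, PTree.edges, ih]; ring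

lemma edges_ext (a : ℝ) : (ext a : Tree d).edges = 0 := rfl

lemma edges_X (k : MIdx d) : (X k).edges = 0 := rfl

lemma edges_Xi (l : MIdx d) : (Xi l).edges = 1 := rfl

lemma edges_I (m : MIdx d) (σ : Tree d) : (I m σ).edges = σ.edges + 1 := by
  obtain ⟨s⟩ := σ; rfl

lemma edges_pos_of_degS_neg {P : Degrees d} {σ : Tree d} (h : σ.degS P < 0) : 0 < σ.edges := by
  obtain ⟨t⟩ := σ
  cases t with
  | root a k => exact absurd h (P.deg_nonneg k).not_gt
  | noise l t => exact Nat.succ_pos _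
  | kern m s t => exact Nat.succ_pos _

end Tree

lemma Cut.edges_contracted (P : Degrees d) {e : Bool} {t : PTree d} (c : Cut e t) :
    (c.contracted P).edges + (c.extracted.map Tree.edges).sum = (Tree.mk t).edges := by
  induction c with
  | rootOut => rfl
  | rootIn a k n h => rfl
  | noiseOut l c ih =>
    simp [contracted, extracted, others, Tree.edges_mul, Tree.mk_noise, Tree.edges_Xi] at ih ⊢
    omega
  | noiseBdry l p c ih =>
    simp [contracted, extracted, others, comp, Tree.edges_mul, Tree.mk_noise, Tree.edges_Xi,
      Tree.edges_ext, Tree.edges_X] at ih ⊢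
    omega
  | noiseIn l c ih =>
    simp [contracted, extracted, others, comp, Tree.edges_mul, Tree.mk_noise, Tree.edges_Xi,
      Tree.edges_ext] at ih ⊢
    omega
  | kernOut m e c' c ih' ih =>
    simp [contracted, extracted, others, Tree.edges_mul, Tree.mk_kern, Tree.edges_I] at ih ih' ⊢
    omega
  | kernBdry m p e c' c ih' ih =>
    simp [contracted, extracted, others, comp, Tree.edges_mul, Tree.mk_kern, Tree.edges_I,
      Tree.edges_ext, Tree.edges_X] at ih ih' ⊢
    omega
  | kernIn m c' c ih' ih =>
    simp [contracted, extracted, others, comp, Tree.edges_mul, Tree.mk_kern, Tree.edges_I,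
      Tree.edges_ext] at ih ih' ⊢
    omega

/-! ### The negative action on the span of all trees -/

section Minus

open Filter

variable (P : Degrees d) (R : Rule d)

lemma eventually_of_forall_tr {β W : Type*} [AddCommGroup W] [Module ℝ W] {l : Filter β}
    {F : β → VSpace d →ₗ[ℝ] W} {G : VSpace d →ₗ[ℝ] W}
    (h : ∀ τ, ∀ᶠ b in l, F b (tr τ) = G (tr τ)) (v : VSpace d) : ∀ᶠ b in l, F b v = G v := by
  have h1 : ∀ᶠ b in l, ∀ τ ∈ v.coeff.support, F b (tr τ) = G (tr τ) :=
    (eventually_all_finset _).2 fun τ _ => h τ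
  filter_upwards [h1] with b hb
  rw [eq_sum_coeff v, Finsupp.sum, map_sum, map_sum]
  exact Finset.sum_congr rfl fun τ hτ => by rw [map_smul, map_smul, hb τ hτ]

lemma projT_tr (τ : TExCirc P R) : projT P R (tr τ.1) = Finsupp.single τ 1 := by
  classical
  ext σ
  change (tr τ.1).coeff σ.1 = _
  rw [coeff_tr, Finsupp.single_apply]
  simp only [Subtype.ext_iff]

lemma inclT_single (τ : TExCirc P R) : inclT P R (Finsupp.single τ 1) = tr τ.1 := by
  simp [inclT]

lemma projT_inclT (v : TSpace P R) : projT P R (inclT P R v) = v := by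
  refine LinearMap.congr_fun (f := projT P R ∘ₗ inclT P R) (g := LinearMap.id) ?_ v
  refine Finsupp.lhom_ext' fun τ => LinearMap.ext_ring ?_
  change projT P R (inclT P R (Finsupp.single τ 1)) = Finsupp.single τ 1
  rw [inclT_single, projT_tr]

lemma inclT_injective : Function.Injective (inclT P R) :=
  Function.LeftInverse.injective (projT_inclT P R)

variable {P R} in
lemma inclT_projT_tr {τ : Tree d} (h : τ ∈ TExCirc P R) : inclT P R (projT P R (tr τ)) = tr τ :=
  (congrArg _ (projT_tr P R ⟨τ, h⟩)).trans (inclT_single P R _)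

variable {P R} in
lemma linMap_ext_single {W : Type*} [AddCommGroup W] [Module ℝ W] {F G : TSpace P R →ₗ[ℝ] W}
    (h : ∀ τ : TExCirc P R, F (Finsupp.single τ 1) = G (Finsupp.single τ 1)) : F = G :=
  Finsupp.lhom_ext' fun τ => LinearMap.ext_ring (h τ)

variable {P R}

/-- The functional on the span of all trees determined by a character. -/
def gHat (g : GMinus P R) : VSpace d →ₗ[ℝ] ℝ := linExt fun τ => g (piMinus P R τ)

lemma gHat_tr (g : GMinus P R) (τ : Tree d) : gHat g (tr τ) = g (piMinus P R τ) := linExt_tr _ _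

lemma gHat_of_mem (g : GMinus P R) (τ : TExMinus P R) :
    gHat g (tr τ.1) = g (MvPolynomial.X τ) := by
  rw [gHat_tr, piMinus, dif_pos τ.2]

lemma gHat_of_notMem (g : GMinus P R) {τ : Tree d} (h : τ ∉ TExMinus P R) :
    gHat g (tr τ) = 0 := by
  rw [gHat_tr, piMinus, dif_neg h, map_zero]

lemma gHat_ne_zero {g : GMinus P R} {τ : Tree d} (h : gHat g (tr τ) ≠ 0) : τ ∈ TExMinus P R := by
  by_contra h'
  exact h (gHat_of_notMem g h')

lemma gHat_isNegFun (g : GMinus P R) : IsNegFun P (gHat g) := fun _ h => (gHat_ne_zero h).2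

lemma forestVal_gHat (g : GMinus P R) (F : Multiset (Tree d)) :
    forestVal (gHat g) F = g (piMinusForest P R F) := by
  rw [forestVal, piMinusForest, map_multiset_prod, Multiset.map_map]
  simp only [gHat_tr, Function.comp_def]

/-- Evaluation of the sum over all subforests. -/
lemma lid_extractSum {W : Type*} [AddCommGroup W] [Module ℝ W] (g : GMinus P R) (r : Tree d → W)
    (t : PTree d) : TensorProduct.lid ℝ W (TensorProduct.map g.toLinearMap LinearMap.id
      (extractSum P R r (.mk t))) =
    ∑ c ∈ negCuts P t, (c.2.coef * forestVal (gHat g) c.2.extracted) • r (c.2.contracted P) := by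
  have h : extractSum P R r (.mk t) = ∑ c ∈ negCuts P t, extractTerm P R r t c := by
    refine finsum_eq_sum_of_support_subset _ fun c hc => (mem_negCuts P).2 fun σ hσ => ?_
    by_contra h
    refine hc ?_
    have h0 : piMinus P R σ = 0 := dif_neg fun h' => h h'.2.1
    have : piMinusForest P R c.2.extracted = 0 :=
      Multiset.prod_eq_zero (Multiset.mem_map.2 ⟨σ, hσ, h0⟩)
    simp [extractTerm, this]
  rw [h, map_sum, map_sum]
  refine Finset.sum_congr rfl fun c _ => ?_
  simp [extractTerm, forestVal_gHat, mul_smul]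

/-- The map `M_g` on the span of all trees. -/
def MV (g : GMinus P R) : VSpace d →ₗ[ℝ] VSpace d := linExt fun τ =>
  TensorProduct.lid ℝ (VSpace d) (TensorProduct.map g.toLinearMap LinearMap.id
    (extractSum P R tr τ))

lemma MV_mk (g : GMinus P R) (t : PTree d) : MV g (tr (.mk t)) = ∑ c ∈ negCuts P t,
    (c.2.coef * forestVal (gHat g) c.2.extracted) • tr (c.2.contracted P) := by
  rw [MV, linExt_tr, lid_extractSum]

lemma lid_extractSum_eq {W : Type*} [AddCommGroup W] [Module ℝ W] (g : GMinus P R)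
    (F : VSpace d →ₗ[ℝ] W) (r : Tree d → W) (hr : ∀ τ, F (tr τ) = r τ) (τ : Tree d) :
    TensorProduct.lid ℝ W (TensorProduct.map g.toLinearMap LinearMap.id (extractSum P R r τ)) =
      F (MV g (tr τ)) := by
  obtain ⟨t⟩ := τ
  refine (lid_extractSum g r t).trans ?_
  refine Eq.trans ?_ (congrArg F (MV_mk g t)).symm
  simp [map_sum, hr]

lemma eventually_MB_MV (g : GMinus P R) (v : VSpace d) :
    ∀ᶠ b in atTop, MB P b (gHat g) v = MV g v := by
  refine eventually_of_forall_tr (fun τ => ?_) v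
  obtain ⟨t⟩ := τ
  filter_upwards [eventually_MB_eq P t] with b hb
  exact (hb (gHat g) fun σ hσ => (gHat_isNegFun g σ hσ).1).trans (MV_mk g t).symm

lemma eventually_projBox_eq (v : VSpace d) : ∀ᶠ b in atTop, projBox b v = v :=
  eventually_of_forall_tr (F := fun b => (projBox b).toLinearMap) (G := LinearMap.id)
    eventually_projBox v

lemma counit_MV (g : GMinus P R) (v : VSpace d) : counit (MV g v) = counit v + gHat g v := by
  obtain ⟨b, h1, h2⟩ := ((eventually_MB_MV g v).and (eventually_projBox_eq v)).exists
  rw [← h1, counit_MB, h2]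

lemma M_single (g : GMinus P R) (τ : TExCirc P R) :
    M P R g (Finsupp.single τ 1) = projT P R (MV g (tr τ.1)) := by
  rw [← lid_extractSum_eq g (projT P R) _ (fun _ => rfl)]
  simp [M, deltaMinus]

lemma renorm_eq (g : GMinus P R) (Pm : TSpace P R →ₗ[ℝ] Smooth d) :
    renorm P R g Pm = Pm ∘ₗ M P R g := by
  have : ∀ z : FMinus P R ⊗[ℝ] TSpace P R,
      TensorProduct.lid ℝ (Smooth d) (TensorProduct.map g.toLinearMap Pm z) =
        Pm (TensorProduct.lid ℝ (TSpace P R)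
          (TensorProduct.map g.toLinearMap LinearMap.id z)) := by
    intro z
    induction z with
    | zero => simp
    | add z w hz hw => simp only [map_add, hz, hw]
    | tmul x y => simp
  exact LinearMap.ext fun v => this _

/-- Composed with `g`, the right-hand projection of the coproduct is the functional `counit + gHat
g` on trees: the counit accounts for the identification of 𝟏^p with the empty forest. Then
`counit_MV` turns the counit part into `gHat g'`, because the counit of τ vanishes. -/
lemma gHat_prod (g g' : GMinus P R) (τ : TExMinus P R) :
    gHat (GMinus.prod P R g g') (tr τ.1) = gHat g' (tr τ.1) + gHat g (MV g' (tr τ.1)) := by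
  classical
  have h1 : ∀ z : FMinus P R ⊗[ℝ] FMinus P R,
      Algebra.TensorProduct.lmul' ℝ (S := ℝ) (Algebra.TensorProduct.map g' g z) =
        g (TensorProduct.lid ℝ (FMinus P R)
          (TensorProduct.map g'.toLinearMap LinearMap.id z)) := by
    intro z
    induction z with
    | zero => simp
    | add z w hz hw => simp only [map_add, hz, hw]
    | tmul x y => simp
  have h2 : ∀ σ, ((counit (d := d)).toLinearMap + gHat g) (tr σ) = g (piMinusRight P R σ) := by
    intro σ
    rw [LinearMap.add_apply, AlgHom.toLinearMap_apply, counit_tr, piMinusRight, gHat_tr]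
    split_ifs with h
    · obtain ⟨p, rfl⟩ := h
      rw [map_one, ← gHat_tr, show gHat g (tr (.ext p)) = 0 from (gHat_isNegFun g).root p 0,
        add_zero]
    · rw [zero_add]
  have h4 : counit (tr τ.1) = 0 := by
    rw [counit_tr, if_neg]
    rintro ⟨a, ha⟩
    have := τ.2.2.1
    rw [ha, Tree.degS_ext] at this
    exact lt_irrefl _ this
  have h5 : GMinus.prod P R g g' (MvPolynomial.X τ) =
      g (TensorProduct.lid ℝ (FMinus P R) (TensorProduct.map g'.toLinearMap LinearMap.id
        (extractSum P R (piMinusRight P R) τ.1))) := by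
    simp only [GMinus.prod, AlgHom.comp_apply, deltaMinusAlg, MvPolynomial.aeval_X, h1]
  rw [gHat_of_mem, h5]
  obtain ⟨⟨t⟩, ht⟩ := τ
  change g (TensorProduct.lid ℝ _ (TensorProduct.map _ _ (extractSum P R _ (.mk t)))) =
    gHat g' (tr (.mk t)) + gHat g (MV g' (tr (.mk t)))
  change counit (tr (.mk t)) = 0 at h4
  rw [lid_extractSum, ← zero_add (gHat g' _), ← h4, ← counit_MV, MV_mk,
    ← AlgHom.toLinearMap_apply counit, ← LinearMap.add_apply, map_sum, map_sum]
  refine Finset.sum_congr rfl fun c _ => ?_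
  rw [map_smul, map_smul, h2]

variable (hR : R.IsNormal)
include hR

lemma inclT_projT_MV (g : GMinus P R) (τ : TExCirc P R) :
    inclT P R (projT P R (MV g (tr τ.1))) = MV g (tr τ.1) := by
  obtain ⟨⟨t⟩, ht⟩ := τ
  change inclT P R (projT P R (MV g (tr (.mk t)))) = MV g (tr (.mk t))
  rw [MV_mk, map_sum, map_sum]
  refine Finset.sum_congr rfl fun c _ => ?_
  rw [map_smul, map_smul]
  by_cases h : forestVal (gHat g) c.2.extracted = 0
  · rw [h, mul_zero, zero_smul, zero_smul]
  · rw [inclT_projT_tr (contracted_mem hR t ht c.1 c.2 fun σ hσ =>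
      gHat_ne_zero (forestVal_ne_zero.1 h σ hσ))]

lemma inclT_M (g : GMinus P R) (v : TSpace P R) : inclT P R (M P R g v) = MV g (inclT P R v) := by
  refine LinearMap.congr_fun (f := inclT P R ∘ₗ M P R g) (g := MV g ∘ₗ inclT P R)
    (linMap_ext_single fun τ => ?_) v
  rw [LinearMap.comp_apply, LinearMap.comp_apply, M_single, inclT_projT_MV hR, inclT_single]

/-- The truncated law gives M_k with k = g' + g ∘ M_{g'}, and k eventually agrees with the product
character only on trees of `TExCirc`. This is enough, since every component extracted from such a
tree is again in `TExCirc` (`extracted_mem`). -/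
lemma MV_MV (g g' : GMinus P R) (τ : TExCirc P R) :
    MV g (MV g' (tr τ.1)) = MV (GMinus.prod P R g g') (tr τ.1) := by
  classical
  obtain ⟨⟨t⟩, ht⟩ := τ
  change MV g (MV g' (tr (.mk t))) = MV (GMinus.prod P R g g') (tr (.mk t))
  have hσ : ∀ σ ∈ TExCirc P R, ∀ᶠ b in atTop, compFun P b (gHat g') (gHat g) (tr σ) =
      gHat (GMinus.prod P R g g') (tr σ) := by
    intro σ hσ
    filter_upwards [eventually_MB_MV g' (tr σ)] with b hb
    by_cases hn : NegCond P σ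
    · rw [gHat_prod g g' ⟨σ, hσ, hn⟩, compFun, LinearMap.add_apply, LinearMap.comp_apply, hb]
    · rw [gHat_of_notMem _ fun h => hn h.2]
      by_contra h0
      exact hn ((gHat_isNegFun g').compFun b (gHat_isNegFun g) σ h0)
  have hall : ∀ᶠ b in atTop, ∀ c ∈ negCuts P t, ∀ σ ∈ c.2.extracted.toFinset,
      compFun P b (gHat g') (gHat g) (tr σ) = gHat (GMinus.prod P R g g') (tr σ) :=
    (eventually_all_finset _).2 fun c _ => (eventually_all_finset _).2 fun σ h =>
      hσ σ (extracted_mem hR c.2 ht σ (Multiset.mem_toFinset.1 h))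
  obtain ⟨b, ⟨h1, h2⟩, h3, h4⟩ := (((eventually_MB_MV g' (tr (.mk t))).and
    (eventually_MB_MV g (MV g' (tr (.mk t))))).and (hall.and (eventually_MB_eq P t))).exists
  -- `h4` is applied to the composite functional of the chosen box; it was obtained uniformly over
  -- functionals.
  rw [← h2, ← h1, (coassoc P b _ _ _).MB_MB, MV_mk, h4 _ fun σ hσ =>
    ((gHat_isNegFun g').compFun b (gHat_isNegFun g) σ hσ).1]
  refine Finset.sum_congr rfl fun c hc => ?_
  congr 2
  exact congrArg Multiset.prod (Multiset.map_congr rfl fun σ hσ =>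
    h3 c hc σ (Multiset.mem_toFinset.2 hσ))

lemma M_prod (g g' : GMinus P R) : M P R (GMinus.prod P R g g') = M P R g ∘ₗ M P R g' := by
  refine linMap_ext_single fun τ => inclT_injective P R ?_
  rw [LinearMap.comp_apply, inclT_M hR, inclT_M hR, inclT_M hR, inclT_single, MV_MV hR]

/-- Applying the counit to M_g τ returns the value of `g` at τ up to a term independent of `g`. -/
lemma M_injective {g g' : GMinus P R} (h : M P R g = M P R g') : g = g' := by
  refine MvPolynomial.algHom_ext fun τ => ?_
  have h1 : MV g (tr τ.1) = MV g' (tr τ.1) := by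
    have := congrArg (fun F => inclT P R (F (Finsupp.single ⟨τ.1, τ.2.1⟩ 1))) h
    simpa only [inclT_M hR, inclT_single] using this
  have h2 := counit_MV g (tr τ.1)
  rw [h1, counit_MV g', add_right_inj] at h2
  rw [← gHat_of_mem, ← gHat_of_mem, h2]

omit hR in
lemma MV_unit_tr (τ : Tree d) : MV (GMinus.unit P R) (tr τ) = tr τ := by
  obtain ⟨t⟩ := τ
  change MV (GMinus.unit P R) (tr (.mk t)) = tr (.mk t)
  rw [MV_mk, Finset.sum_eq_single ⟨false, emptyCut t⟩]
  · simp [coef_emptyCut, extracted_emptyCut, contracted_emptyCut, forestVal_zero]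
  · intro c _ hc
    have : forestVal (gHat (GMinus.unit P R)) c.2.extracted = 0 := by
      by_contra h
      obtain ⟨σ, hσ⟩ := Multiset.exists_mem_of_ne_zero fun h0 => hc (eq_emptyCut c.2 h0)
      have h1 := forestVal_ne_zero.1 h σ hσ
      refine h1 ?_
      rw [gHat_of_mem _ ⟨σ, gHat_ne_zero h1⟩]
      simp [GMinus.unit]
    rw [this, mul_zero, zero_smul]
  · intro h
    exact absurd ((mem_negCuts P).2 (by simp [extracted_emptyCut])) h

omit hR in
lemma M_unit : M P R (GMinus.unit P R) = LinearMap.id := by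
  refine linMap_ext_single fun τ => ?_
  rw [M_single, MV_unit_tr, projT_tr]
  rfl

omit hR in
/-- `M_g` is unipotent with respect to the number of edges. -/
lemma MV_sub_congr (g : GMinus P R) (τ : Tree d) {u w : VSpace d →ₗ[ℝ] ℝ}
    (h : ∀ σ : Tree d, σ.edges < τ.edges → u (tr σ) = w (tr σ)) :
    u (MV g (tr τ) - tr τ) = w (MV g (tr τ) - tr τ) := by
  classical
  obtain ⟨t⟩ := τ
  change ∀ σ : Tree d, σ.edges < (Tree.mk t).edges → _ at h
  change u (MV g (tr (.mk t)) - tr (.mk t)) = w (MV g (tr (.mk t)) - tr (.mk t))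
  have h0 : (⟨false, emptyCut t⟩ : Σ e, Cut e t) ∈ negCuts P t :=
    (mem_negCuts P).2 (by simp [extracted_emptyCut])
  rw [MV_mk, ← Finset.add_sum_erase _ _ h0]
  simp only [coef_emptyCut, extracted_emptyCut, contracted_emptyCut, forestVal_zero, one_mul,
    one_smul, add_sub_cancel_left, map_sum, map_smul]
  refine Finset.sum_congr rfl fun c hc => ?_
  rw [Finset.mem_erase] at hc
  congr 1
  refine h _ ?_
  obtain ⟨σ, hσ⟩ := Multiset.exists_mem_of_ne_zero fun h0 => hc.1 (eq_emptyCut c.2 h0)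
  have h1 := Tree.edges_pos_of_degS_neg ((mem_negCuts P).1 hc.2 σ hσ)
  have h2 := c.2.edges_contracted P
  have h3 : σ.edges ≤ (c.2.extracted.map Tree.edges).sum :=
    Multiset.le_sum_of_mem (Multiset.mem_map_of_mem _ hσ)
  omega

open Classical in
omit hR in
/-- Successive approximations of the inverse of `g`. -/
def invApprox (g : GMinus P R) : ℕ → Tree d → ℝ
  | 0 => fun _ => 0
  -- The equation g'g = 1 at a negative tree reads 0 = g(τ) + g'(M_g τ). Solving for g'(τ) leaves
  -- the previous approximation on M_g τ - τ.
  | n + 1 => fun τ => if τ ∈ TExMinus P R then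
      - gHat g (tr τ) - linExt (invApprox g n) (MV g (tr τ) - tr τ) else 0

omit hR in
lemma invApprox_of_mem (g : GMinus P R) (n : ℕ) {τ : Tree d} (h : τ ∈ TExMinus P R) :
    invApprox g (n + 1) τ = - gHat g (tr τ) - linExt (invApprox g n) (MV g (tr τ) - tr τ) :=
  if_pos h

omit hR in
lemma invApprox_of_notMem (g : GMinus P R) (n : ℕ) {τ : Tree d} (h : τ ∉ TExMinus P R) :
    invApprox g (n + 1) τ = 0 := if_neg h

-- The right side of the recursion at τ sees only trees with fewer edges, so the value at τ is final
-- once the number of iterations exceeds its number of edges.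
omit hR in
lemma invApprox_succ (g : GMinus P R) (n : ℕ) (τ : Tree d) (h : τ.edges < n) :
    invApprox g (n + 1) τ = invApprox g n τ := by
  induction n generalizing τ with
  | zero => omega
  | succ n ih =>
    by_cases hτ : τ ∈ TExMinus P R
    · rw [invApprox_of_mem g _ hτ, invApprox_of_mem g _ hτ, MV_sub_congr g τ fun σ hσ => ?_]
      rw [linExt_tr, linExt_tr, ih σ (by omega)]
    · rw [invApprox_of_notMem g _ hτ, invApprox_of_notMem g _ hτ]

omit hR in
lemma invApprox_eq (g : GMinus P R) (τ : Tree d) (n : ℕ) (h : τ.edges < n) :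
    invApprox g n τ = invApprox g (τ.edges + 1) τ := by
  induction n with
  | zero => omega
  | succ n ih =>
    rcases Nat.lt_succ_iff_lt_or_eq.1 h with h | h
    · rw [invApprox_succ g n τ h, ih h]
    · rw [h]

omit hR in
lemma exists_left_inv_minus (g : GMinus P R) :
    ∃ g', GMinus.prod P R g' g = GMinus.unit P R := by
  let g' : GMinus P R := MvPolynomial.aeval fun τ => invApprox g (τ.1.edges + 1) τ.1
  have hg' : ∀ τ n, τ.edges < n → gHat g' (tr τ) = invApprox g n τ := by
    intro τ n hn
    by_cases h : τ ∈ TExMinus P R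
    · rw [gHat_of_mem g' ⟨τ, h⟩, invApprox_eq g τ n hn]
      exact MvPolynomial.aeval_X _ _
    · rw [gHat_of_notMem g' h]
      obtain ⟨n, rfl⟩ := Nat.exists_eq_succ_of_ne_zero (by omega : n ≠ 0)
      rw [invApprox_of_notMem g n h]
  refine ⟨g', MvPolynomial.algHom_ext fun τ => ?_⟩
  rw [← gHat_of_mem, gHat_prod]
  have h1 : gHat g' (MV g (tr τ.1) - tr τ.1) =
      linExt (invApprox g τ.1.edges) (MV g (tr τ.1) - tr τ.1) :=
    MV_sub_congr g τ.1 fun σ hσ => by rw [linExt_tr, hg' σ _ hσ]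
  have h2 := hg' τ.1 _ (Nat.lt_succ_self _)
  rw [invApprox_of_mem g _ τ.2, ← h1, map_sub] at h2
  simp only [GMinus.unit, MvPolynomial.aeval_X]
  linarith

/-- A left inverse of a left inverse acts as `g` does, because operators compose associatively.
Faithfulness of g ↦ M_g then turns the left inverse into a right inverse, without coassociativity in
the group itself. -/
theorem exists_isInv_minus (g : GMinus P R) : ∃ g', GMinus.IsInv P R g g' := by
  obtain ⟨g', h⟩ := exists_left_inv_minus g
  obtain ⟨g'', h'⟩ := exists_left_inv_minus g'
  have h1 : M P R g' ∘ₗ M P R g = LinearMap.id := by rw [← M_prod hR, h, M_unit]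
  have h2 : M P R g'' ∘ₗ M P R g' = LinearMap.id := by rw [← M_prod hR, h', M_unit]
  have h3 : M P R g'' = M P R g := by
    rw [← LinearMap.comp_id (M P R g''), ← h1, ← LinearMap.comp_assoc, h2, LinearMap.id_comp]
  refine ⟨g', h, M_injective hR ?_⟩
  rw [M_prod hR, ← h3, h2, M_unit]

lemma M_comp_of_isInv {g g' : GMinus P R} (h : GMinus.IsInv P R g g') :
    M P R g' ∘ₗ M P R g = LinearMap.id := by
  rw [← M_prod hR, h.1, M_unit]

end Minus

end RegStr
end

/-! ### The positive group: its action, degree filtration and group law. -/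

noncomputable section

namespace RegStr

variable {d : ℕ}

/-! ### The positive action on the span of all trees -/

section Plus

open Filter

variable {P : Degrees d} {R : Rule d}

lemma Tree.degPlus_I_add (m k : MIdx d) (σ : Tree d) :
    (Tree.I (m + k) σ).degPlus P = (Tree.I m σ).degPlus P - P.deg k := by
  rw [degPlus_I, degPlus_I, P.deg_add]; ring

lemma mem_below_degPlus_I {m k : MIdx d} {σ : Tree d} :
    k ∈ P.below ((Tree.I m σ).degPlus P) ↔ 0 < (Tree.I (m + k) σ).degPlus P := by
  rw [P.mem_below, Tree.degPlus_I_add, sub_pos]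

/-- The functional `τ ↦ f(π_+ I_m[τ])`. -/
def fHat (f : GPlus P R) (m : MIdx d) : VSpace d →ₗ[ℝ] ℝ := linExt fun σ => f (piPlusI P R m σ)

lemma fHat_tr (f : GPlus P R) (m : MIdx d) (σ : Tree d) : fHat f m (tr σ) = f (piPlusI P R m σ) :=
  linExt_tr _ _

lemma fHat_of_pos (f : GPlus P R) {m : MIdx d} {σ : Tree d}
    (h : σ ∈ TExCirc P R ∧ 0 < (Tree.I m σ).degPlus P) :
    fHat f m (tr σ) = f (MvPolynomial.X (.inr ⟨(m, σ), h⟩)) := by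
  rw [fHat_tr, piPlusI, dif_pos h]

lemma fHat_of_not_pos (f : GPlus P R) {m : MIdx d} {σ : Tree d}
    (h : ¬ 0 < (Tree.I m σ).degPlus P) : fHat f m (tr σ) = 0 := by
  rw [fHat_tr, piPlusI, dif_neg fun h' => h h'.2, map_zero]

/-- The values of a character on `X_1, …, X_d`. -/
def xOf (f : GPlus P R) : Fin d → ℝ := fun i => f (MvPolynomial.X (.inl i))

def gamVRec (f : GPlus P R) : TreeRec d (VSpace d) where
  ext := tExt
  ext_zero := rfl
  ext_add := tExt_add
  X i := tX i + algebraMap ℝ _ (xOf f i)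
  Xi l := tr (.Xi l)
  I m σ w := integ m w + ∑ k ∈ P.below ((Tree.I m σ).degPlus P), fHat f (m + k) (tr σ) • dp k

/-- `Γ_f` on the span of all trees, an algebra morphism. -/
def GamV (f : GPlus P R) : VSpace d →ₐ[ℝ] VSpace d := (gamVRec f).hom

lemma GamV_ext (f : GPlus P R) (a : ℝ) : GamV f (tExt a) = tExt a := TreeRec.hom_ext _ _

lemma GamV_X (f : GPlus P R) (i : Fin d) : GamV f (tX i) = tX i + algebraMap ℝ _ (xOf f i) :=
  TreeRec.hom_X _ _

lemma GamV_Xi (f : GPlus P R) (l : MIdx d) : GamV f (tr (.Xi l)) = tr (.Xi l) :=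
  TreeRec.hom_Xi _ _

lemma GamV_I (f : GPlus P R) (m : MIdx d) (σ : Tree d) : GamV f (tr (.I m σ)) =
    integ m (GamV f (tr σ)) +
      ∑ k ∈ P.below ((Tree.I m σ).degPlus P), fHat f (m + k) (tr σ) • dp k :=
  TreeRec.hom_I _ _ _

/-- Evaluation of the right factor of a tensor, as an algebra morphism. -/
def evalR {W : Type*} [CommRing W] [Algebra ℝ W] (f : GPlus P R) :
    W ⊗[ℝ] TPlus P R →ₐ[ℝ] W :=
  (Algebra.TensorProduct.rid ℝ ℝ W).toAlgHom.comp
    (Algebra.TensorProduct.map (AlgHom.id ℝ W) f)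

lemma evalR_tmul {W : Type*} [CommRing W] [Algebra ℝ W] (f : GPlus P R) (w : W) (p : TPlus P R) :
    evalR f (w ⊗ₜ[ℝ] p) = f p • w := by simp [evalR]

/-- `(id ⊗ f) Δ_+ = Γ_f`. -/
lemma evalR_deltaPlusTree (f : GPlus P R) (τ : Tree d) :
    evalR f (deltaPlusTree P R τ) = GamV f (tr τ) := by
  have hint : ∀ m (z : VSpace d ⊗[ℝ] TPlus P R),
      evalR f (TensorProduct.map (integ m) LinearMap.id z) = integ m (evalR f z) := by
    intro m z
    induction z with
    | zero => simp
    | add z w hz hw => simp only [map_add, hz, hw]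
    | tmul v p => simp [evalR_tmul]
  obtain ⟨t⟩ := τ
  refine Eq.trans ?_ ((gamVRec f).hom_mk t).symm
  change evalR f (deltaPlusPre P R t) = _
  induction t with
  | root a k =>
    simp only [deltaPlusPre, TreeRec.pre, map_mul, map_prod, map_pow, map_add, evalR_tmul,
      map_one, one_smul, gamVRec, Algebra.algebraMap_eq_smul_one]
    rfl
  | noise l t ih =>
    simp only [deltaPlusPre, TreeRec.pre, map_mul, evalR_tmul, map_one, one_smul, ih]
    rfl
  | kern m s t ihs iht =>
    simp only [deltaPlusPre, TreeRec.pre, map_mul, map_add, hint, ihs, iht, map_sum, map_smul,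
      evalR_tmul]
    congr 2
    refine Finset.sum_congr rfl fun k _ => ?_
    rw [fHat_tr, dp, smul_comm]

lemma rid_map_projT (f : GPlus P R) (z : VSpace d ⊗[ℝ] TPlus P R) :
    TensorProduct.rid ℝ (TSpace P R) (TensorProduct.map LinearMap.id f.toLinearMap
      (TensorProduct.map (projT P R) LinearMap.id z)) = projT P R (evalR f z) := by
  induction z with
  | zero => simp
  | add z w hz hw => simp only [map_add, hz, hw]
  | tmul v p => simp [evalR_tmul]

lemma Gam_single (f : GPlus P R) (τ : TExCirc P R) :
    Gam P R f (Finsupp.single τ 1) = projT P R (GamV f (tr τ.1)) := by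
  simp only [Gam, deltaPlus, LinearMap.comp_apply, Finsupp.linearCombination_single, one_smul,
    LinearEquiv.coe_coe, rid_map_projT, evalR_deltaPlusTree]

/-! ### Approximation by truncated operators -/

open Classical in
/-- Truncation of a family of functionals to the box. -/
def truncFun (φ : MIdx d → VSpace d →ₗ[ℝ] ℝ) (b : MIdx d) : MIdx d → VSpace d →ₗ[ℝ] ℝ :=
  fun n => if n ≤ b then φ n else 0

lemma truncFun_of_le {φ : MIdx d → VSpace d →ₗ[ℝ] ℝ} {b n : MIdx d} (h : n ≤ b) :
    truncFun φ b n = φ n := if_pos h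

lemma truncFun_of_not_le {φ : MIdx d → VSpace d →ₗ[ℝ] ℝ} {b n : MIdx d} (h : ¬ n ≤ b) :
    truncFun φ b n = 0 := if_neg h

lemma truncFun_eq_zero {φ : MIdx d → VSpace d →ₗ[ℝ] ℝ} {b n : MIdx d} {v : VSpace d}
    (h : φ n v = 0) : truncFun φ b n v = 0 := by
  by_cases hn : n ≤ b
  · rw [truncFun_of_le hn, h]
  · rw [truncFun_of_not_le hn, LinearMap.zero_apply]

/-- `φ` may depend on the box, so that composites of truncated functionals are covered. Vanishing at
nonpositive degree must hold for all `n` at once, since the truncated sum runs over the whole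
growing box, whereas agreement is needed only on the finite Taylor range. The set `S` is present
because characters are prescribed only on branches in `TExCirc`. -/
lemma eventually_gamB_eq {S : Set (Tree d)} (hS : ∀ τ ∈ S, τ.BranchIn S) (f : GPlus P R)
    {φ : MIdx d → MIdx d → VSpace d →ₗ[ℝ] ℝ}
    (h1 : ∀ σ ∈ S, ∀ n, ∀ᶠ b in atTop, φ b n (tr σ) = fHat f n (tr σ))
    (h2 : ∀ σ ∈ S, ∀ᶠ b in atTop, ∀ n, ¬ 0 < (Tree.I n σ).degPlus P → φ b n (tr σ) = 0)
    (τ : Tree d) (hτ : τ.BranchIn S) :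
    ∀ᶠ b in atTop, gamB b (xOf f) (φ b) (tr τ) = GamV f (tr τ) := by
  induction τ using Tree.induction_gen with
  | ext a => exact .of_forall fun b => (gamB_ext b _ _ a).trans (GamV_ext f a).symm
  | X i => exact .of_forall fun b => (gamB_X b _ _ i).trans (GamV_X f i).symm
  | Xi l =>
    filter_upwards [eventually_ge_atTop l] with b hb
    rw [gamB_Xi, xiB_of_le hb, GamV_Xi]
  | I m σ ih =>
    rw [Tree.branchIn_I] at hτ
    have h3 : ∀ᶠ b in atTop, ∀ k ∈ P.below ((Tree.I m σ).degPlus P),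
        φ b (m + k) (tr σ) = fHat f (m + k) (tr σ) ∧ k ≤ b :=
      (eventually_all_finset _).2 fun k _ => (h1 σ hτ _).and (eventually_ge_atTop k)
    filter_upwards [ih (hS σ hτ), h2 σ hτ, h3, eventually_ge_atTop m] with b h4 h5 h6 h7
    rw [← integ_tr, gamB_I, integ_tr, GamV_I, h4, integB_of_le h7]
    congr 1
    symm
    rw [← Finset.sum_subset (s₁ := P.below ((Tree.I m σ).degPlus P))
      (fun k hk => Finset.mem_Iic.2 (h6 k hk).2) fun k _ hk => ?_]
    · exact Finset.sum_congr rfl fun k hk => by rw [(h6 k hk).1]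
    · rw [h5 _ fun h => hk (mem_below_degPlus_I.2 h), zero_smul]
  | mul σ τ ih1 ih2 =>
    rw [Tree.branchIn_mul] at hτ
    filter_upwards [ih1 hτ.1, ih2 hτ.2] with b h3 h4
    rw [tr_mul, map_mul, map_mul, h3, h4]

lemma Tree.branchIn_univ (τ : Tree d) : τ.BranchIn Set.univ := by
  obtain ⟨t⟩ := τ
  change t.BranchIn Set.univ
  induction t with
  | root => trivial
  | noise l t ih => exact ih
  | kern m s t _ ih => exact ⟨trivial, ih⟩

lemma eventually_truncFun (φ : MIdx d → VSpace d →ₗ[ℝ] ℝ) (n : MIdx d) :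
    ∀ᶠ b in atTop, truncFun φ b n = φ n := by
  filter_upwards [eventually_ge_atTop n] with b hb
  exact truncFun_of_le hb

lemma eventually_gamB_trunc (f : GPlus P R) (v : VSpace d) :
    ∀ᶠ b in atTop, gamB b (xOf f) (truncFun (fHat f) b) v = GamV f v := by
  refine eventually_of_forall_tr (F := fun b => (gamB b (xOf f) (truncFun (fHat f) b)).toLinearMap)
    (G := (GamV f).toLinearMap) (fun τ => ?_) v
  refine eventually_gamB_eq (S := Set.univ) (fun τ _ => τ.branchIn_univ) f (fun σ _ n => ?_)
    (fun σ _ => .of_forall fun b n hn => truncFun_eq_zero (fHat_of_not_pos f hn)) τ τ.branchIn_univ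
  filter_upwards [eventually_truncFun (fHat f) n] with b hb
  rw [hb]

/-! ### Degrees -/

variable (P) in
/-- The span of the trees with `|τ|_+ ≤ a`. -/
def lowV (a : ℝ) : Submodule ℝ (VSpace d) := Submodule.span ℝ (tr '' {ρ | ρ.degPlus P ≤ a})

lemma tr_mem_lowV {ρ : Tree d} {a : ℝ} (h : ρ.degPlus P ≤ a) : tr ρ ∈ lowV P a :=
  Submodule.subset_span ⟨ρ, h, rfl⟩

lemma map_mem_of_mem_span {W : Type*} [AddCommGroup W] [Module ℝ W] {S : Set (Tree d)}
    {N : Submodule ℝ W} {F : VSpace d →ₗ[ℝ] W} (h : ∀ ρ ∈ S, F (tr ρ) ∈ N) {v : VSpace d}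
    (hv : v ∈ Submodule.span ℝ (tr '' S)) : F v ∈ N := by
  have : Submodule.span ℝ (tr '' S) ≤ N.comap F := Submodule.span_le.2 (by
    rintro _ ⟨ρ, hρ, rfl⟩
    exact h ρ hρ)
  exact this hv

lemma mul_mem_span {S T U : Set (Tree d)} (h : ∀ σ ∈ S, ∀ τ ∈ T, σ * τ ∈ U) {v w : VSpace d}
    (hv : v ∈ Submodule.span ℝ (tr '' S)) (hw : w ∈ Submodule.span ℝ (tr '' T)) :
    v * w ∈ Submodule.span ℝ (tr '' U) := by
  refine map_mem_of_mem_span (F := LinearMap.mulRight ℝ w) (fun σ hσ => ?_) hv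
  refine map_mem_of_mem_span (F := LinearMap.mulLeft ℝ (tr σ)) (fun τ hτ => ?_) hw
  rw [LinearMap.mulLeft_apply, ← tr_mul]
  exact Submodule.subset_span ⟨_, h σ hσ τ hτ, rfl⟩

lemma mul_mem_lowV {a c : ℝ} {v w : VSpace d} (hv : v ∈ lowV P a) (hw : w ∈ lowV P c) :
    v * w ∈ lowV P (a + c) :=
  mul_mem_span (fun σ hσ τ hτ => by
    change (σ * τ).degPlus P ≤ a + c
    rw [Tree.degPlus_mul]
    exact add_le_add hσ hτ) hv hw

lemma GamV_mem_lowV (f : GPlus P R) (τ : Tree d) : GamV f (tr τ) ∈ lowV P (τ.degPlus P) := by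
  induction τ using Tree.induction_gen with
  | ext a => exact (GamV_ext f a).symm ▸ tr_mem_lowV le_rfl
  | X i =>
    refine (GamV_X f i).symm ▸ add_mem (tr_mem_lowV le_rfl) ?_
    rw [Algebra.algebraMap_eq_smul_one, ← tr_one]
    refine Submodule.smul_mem _ _ (tr_mem_lowV ?_)
    rw [Tree.degPlus_X]
    exact (Tree.degPlus_ext P 0).le.trans (P.deg_nonneg _)
  | Xi l => exact (GamV_Xi f l).symm ▸ tr_mem_lowV le_rfl
  | I m σ ih =>
    rw [GamV_I]
    refine add_mem (map_mem_of_mem_span (fun ρ hρ => ?_) ih) (sum_mem fun k hk => ?_)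
    · rw [integ_tr]
      refine tr_mem_lowV ?_
      rw [Tree.degPlus_I, Tree.degPlus_I]
      exact add_le_add_right hρ _
    · refine Submodule.smul_mem _ _ (Submodule.smul_mem _ _ (tr_mem_lowV ?_))
      rw [Tree.degPlus_X]
      exact ((P.mem_below _ _).1 hk).le
  | mul σ τ ih1 ih2 =>
    rw [tr_mul, map_mul, Tree.degPlus_mul]
    exact mul_mem_lowV ih1 ih2

lemma MV_mem_lowV (g : GMinus P R) (τ : Tree d) : MV g (tr τ) ∈ lowV P (τ.degPlus P) := by
  obtain ⟨t⟩ := τ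
  change MV g (tr (.mk t)) ∈ lowV P ((Tree.mk t).degPlus P)
  rw [MV_mk]
  exact sum_mem fun c _ => Submodule.smul_mem _ _ (tr_mem_lowV (c.2.degPlus_contracted P).le)

/-- Neither Γ_f nor M_g raises |·|_+, so the degree cutoff attached to σ remains valid for the
vectors obtained from σ. -/
lemma fHat_eq_zero (f : GPlus P R) {n : MIdx d} {σ : Tree d} {v : VSpace d}
    (hv : v ∈ lowV P (σ.degPlus P)) (h : ¬ 0 < (Tree.I n σ).degPlus P) : fHat f n v = 0 := by
  refine (Submodule.mem_bot ℝ).1 (map_mem_of_mem_span (F := fHat f n) (fun ρ hρ => ?_) hv)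
  rw [Submodule.mem_bot]
  refine fHat_of_not_pos f ?_
  rw [Tree.degPlus_I] at h ⊢
  have : ρ.degPlus P ≤ σ.degPlus P := hρ
  linarith

/-! ### Composition -/

/-- The product of characters in the shape of `convFun`. The branch must lie in `TExCirc`: otherwise
the left side is zero by definition, while the first term on the right need not vanish. -/
lemma fHat_conv (f h : GPlus P R) (n : MIdx d) {σ : Tree d} (hσ : σ ∈ TExCirc P R) :
    fHat (GPlus.conv P R f h) n (tr σ) = fHat f n (GamV h (tr σ)) +
      ∑ k ∈ P.below ((Tree.I n σ).degPlus P), dpow (xOf f) k * fHat h (n + k) (tr σ) := by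
  by_cases hn : 0 < (Tree.I n σ).degPlus P
  · have h1 : ∀ z : TPlus P R ⊗[ℝ] TPlus P R, Algebra.TensorProduct.lmul' ℝ (S := ℝ)
        (Algebra.TensorProduct.map f h z) = f (evalR h z) := by
      intro z
      induction z with
      | zero => simp
      | add z w hz hw => simp only [map_add, hz, hw]
      | tmul v p => simp [evalR_tmul, mul_comm]
    have h2 : ∀ z : VSpace d ⊗[ℝ] TPlus P R,
        f (evalR h (TensorProduct.map (linExt (piPlusI P R n)) LinearMap.id z)) =
          fHat f n (evalR h z) := by
      have h3 : ∀ v, f (linExt (piPlusI P R n) v) = fHat f n v := fun v =>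
        LinearMap.congr_fun (f := f.toLinearMap ∘ₗ linExt (piPlusI P R n)) (g := fHat f n)
          (linMap_ext fun τ => by simp [linExt_tr, fHat_tr]) v
      intro z
      induction z with
      | zero => simp
      | add z w hz hw => simp only [map_add, hz, hw]
      | tmul v p => simp [evalR_tmul, h3]
    rw [fHat_of_pos _ ⟨hσ, hn⟩]
    have h4 : deltaPlusAlg P R (MvPolynomial.X (.inr ⟨(n, σ), hσ, hn⟩)) =
        TensorProduct.map (linExt (piPlusI P R n)) LinearMap.id (deltaPlusTree P R σ) +
        ∑ k ∈ P.below ((Tree.I n σ).degPlus P), (mfact k : ℝ)⁻¹ •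
          ((∏ i, MvPolynomial.X (.inl i) ^ k i) ⊗ₜ[ℝ] piPlusI P R (n + k) σ) :=
      MvPolynomial.aeval_X _ _
    rw [GPlus.conv, AlgHom.comp_apply, AlgHom.comp_apply, h1, h4]
    simp only [map_add, h2, evalR_deltaPlusTree, map_sum, map_smul, evalR_tmul]
    congr 1
    refine Finset.sum_congr rfl fun k _ => ?_
    rw [fHat_tr, dpow]
    simp only [map_prod, map_pow, smul_eq_mul, xOf]
    ring
  -- At nonpositive degree both sides vanish: Γ_h does not raise degrees, and raising the edge
  -- decoration only lowers the degree further, so the sum is empty.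
  · rw [fHat_of_not_pos _ hn, fHat_eq_zero f (GamV_mem_lowV h σ) hn, zero_add]
    refine (Finset.sum_eq_zero fun k hk => ?_).symm
    rw [mem_below_degPlus_I, Tree.degPlus_I_add] at hk
    exact absurd (by linarith [P.deg_nonneg k]) hn

lemma xOf_conv (f h : GPlus P R) : xOf (GPlus.conv P R f h) = xOf f + xOf h := by
  ext i
  simp [xOf, GPlus.conv, deltaPlusAlg]

lemma branchIn_TExCirc : ∀ τ ∈ TExCirc P R, τ.BranchIn (TExCirc P R) := fun _ h => branchIn_of_mem h

/-- The group law. -/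
theorem GamV_conv (f h : GPlus P R) (τ : Tree d) (hτ : τ.BranchIn (TExCirc P R)) :
    GamV f (GamV h (tr τ)) = GamV (GPlus.conv P R f h) (tr τ) := by
  have hf0 : ∀ (f : GPlus P R) (b n : MIdx d), ¬ n ≤ b → truncFun (fHat f) b n = 0 :=
    fun f b n hn => truncFun_of_not_le hn
  have key := eventually_gamB_eq branchIn_TExCirc (GPlus.conv P R f h)
    (φ := fun b => convFun b (xOf f) (xOf h) (truncFun (fHat f) b) (truncFun (fHat h) b))
    (fun σ hσ n => ?_) (fun σ hσ => ?_) τ hτ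
  · obtain ⟨b, ⟨h1, h2⟩, h3⟩ := (((eventually_gamB_trunc h (tr τ)).and
      (eventually_gamB_trunc f (GamV h (tr τ)))).and key).exists
    rw [← h2, ← h1, ← h3, xOf_conv, ← gamB_comp b _ _ (hf0 f b) (hf0 h b)]
    rfl
  · have h3 : ∀ᶠ b in atTop, ∀ k ∈ P.below ((Tree.I n σ).degPlus P), n + k ≤ b :=
      (eventually_all_finset _).2 fun k _ => eventually_ge_atTop (n + k)
    filter_upwards [eventually_gamB_trunc h (tr σ), h3, eventually_ge_atTop n] with b h4 h5 h6
    rw [convFun_apply, h4, truncFun_of_le h6, fHat_conv f h n hσ]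
    congr 1
    symm
    rw [← Finset.sum_subset (s₁ := P.below ((Tree.I n σ).degPlus P))
      (fun k hk => Finset.mem_Iic.2 (le_add_self.trans (h5 k hk))) fun k _ hk => ?_]
    · exact Finset.sum_congr rfl fun k hk => by rw [truncFun_of_le (h5 k hk)]
    · rw [truncFun_eq_zero (fHat_of_not_pos h fun h' => hk (mem_below_degPlus_I.2 h')), mul_zero]
  · filter_upwards [eventually_gamB_trunc h (tr σ)] with b h4 n hn
    rw [convFun_apply, h4, truncFun_eq_zero (fHat_eq_zero f (GamV_mem_lowV h σ) hn), zero_add]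
    refine Finset.sum_eq_zero fun k _ => ?_
    rw [truncFun_eq_zero (fHat_of_not_pos h fun h' => hn ?_), mul_zero]
    rw [Tree.degPlus_I_add] at h'
    linarith [P.deg_nonneg k]

lemma GamV_unit : GamV (GPlus.unit P R) = AlgHom.id ℝ (VSpace d) := by
  refine algHom_ext_gen (fun a => ?_) (fun i => ?_) (fun l => ?_) fun m σ ih => ?_
  · rw [GamV_ext]; rfl
  · rw [GamV_X]
    simp [xOf, GPlus.unit]
  · rw [GamV_Xi]; rfl
  · rw [GamV_I, ih, Finset.sum_eq_zero fun k hk => ?_, add_zero]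
    · exact integ_tr m σ
    · suffices fHat (GPlus.unit P R) (m + k) (tr σ) = 0 by rw [this, zero_smul]
      rw [fHat_tr, piPlusI]
      split_ifs
      · simp [GPlus.unit]
      · simp

lemma counit_dp (k : MIdx d) (hk : k ≠ 0) : counit (dp k) = 0 := by
  obtain ⟨i, hi⟩ := Function.ne_iff.1 hk
  rw [dp_eq_dpow, map_dpow, dpow, Finset.prod_eq_zero (Finset.mem_univ i), smul_zero]
  rw [counit_X, zero_pow hi]

/-- A character is determined by its action. -/
lemma GamV_faithful {f h : GPlus P R}
    (H : ∀ τ : Tree d, τ.BranchIn (TExCirc P R) → GamV f (tr τ) = GamV h (tr τ)) : f = h := by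
  refine MvPolynomial.algHom_ext fun p => ?_
  obtain i | ⟨⟨m, σ⟩, hσ, hpos⟩ := p
  · have h1 := congrArg counit (H (.X (Pi.single i 1)) (Tree.branchIn_root _ _ _))
    have h2 : ∀ f : GPlus P R, counit (GamV f (tr (.X (Pi.single i 1)))) = xOf f i := by
      intro f
      refine (congrArg counit (GamV_X f i)).trans ?_
      rw [map_add, counit_X, AlgHom.commutes, zero_add]
      rfl
    rwa [h2, h2] at h1
  · have h1 := congrArg counit (H (.I m σ) ((Tree.branchIn_I _ m σ).2 hσ))
    have h2 : ∀ f : GPlus P R, counit (GamV f (tr (.I m σ))) =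
        f (MvPolynomial.X (.inr ⟨(m, σ), hσ, hpos⟩)) := by
      intro f
      have h0 : (0 : MIdx d) ∈ P.below ((Tree.I m σ).degPlus P) := by
        rw [mem_below_degPlus_I, add_zero]
        exact hpos
      -- The counit kills planted trees and X^k with k ≠ 0, so only the constant term of the Taylor
      -- sum remains, and its coefficient is the value of the character at I_m[σ].
      rw [GamV_I, map_add, counit_integ, zero_add, map_sum, Finset.sum_eq_single_of_mem 0 h0]
      · rw [map_smul, add_zero, fHat_of_pos f ⟨hσ, hpos⟩, dp_eq_dpow, dpow_zero, map_one,
          smul_eq_mul, mul_one]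
      · intro k _ hk
        rw [map_smul, counit_dp k hk, smul_zero]
    rwa [h2, h2] at h1

end Plus

end RegStr
end

/-! ### Stability under recentring, positive inverses, and the interplay of both groups. -/

noncomputable section

namespace RegStr

variable {d : ℕ}

section

open Filter

variable {P : Degrees d} {R : Rule d}

/-! ### Positive vectors -/

/-- Vectors on which all nonnegative functionals are nonnegative. -/
def PosV (v : VSpace d) : Prop := ∀ u, NonnegFun u → 0 ≤ u v

lemma posV_tr (τ : Tree d) : PosV (tr τ) := fun _ hu => hu τ

lemma PosV.add {v w : VSpace d} (hv : PosV v) (hw : PosV w) : PosV (v + w) := fun u hu => by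
  rw [map_add]
  exact add_nonneg (hv u hu) (hw u hu)

lemma PosV.smul {v : VSpace d} (hv : PosV v) {a : ℝ} (ha : 0 ≤ a) : PosV (a • v) := fun u hu => by
  rw [map_smul]
  exact mul_nonneg ha (hv u hu)

lemma PosV.sum {ι : Type*} {s : Finset ι} {F : ι → VSpace d} (h : ∀ i ∈ s, PosV (F i)) :
    PosV (∑ i ∈ s, F i) := fun u hu => by
  rw [map_sum]
  exact Finset.sum_nonneg fun i hi => h i hi u hu

lemma PosV.mul {v w : VSpace d} (hv : PosV v) (hw : PosV w) : PosV (v * w) := by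
  intro u hu
  refine hv (u ∘ₗ LinearMap.mulRight ℝ w) fun σ => ?_
  refine hw (u ∘ₗ LinearMap.mulLeft ℝ (tr σ)) fun ρ => ?_
  simp only [LinearMap.comp_apply, LinearMap.mulLeft_apply, ← tr_mul]
  exact hu _

lemma PosV.integB {v : VSpace d} (hv : PosV v) (b m : MIdx d) : PosV (integB b m v) := by
  intro u hu
  refine hv (u ∘ₗ RegStr.integB b m) fun σ => ?_
  by_cases h : m ≤ b
  · rw [LinearMap.comp_apply, integB_of_le h, integ_tr]
    exact hu _
  · rw [integB_of_not_le h]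
    simp

lemma gamB_posV {b : MIdx d} {x : Fin d → ℝ} {φ : MIdx d → VSpace d →ₗ[ℝ] ℝ} (hx : ∀ i, 0 ≤ x i)
    (hφ : ∀ n, NonnegFun (φ n)) (τ : Tree d) : PosV (gamB b x φ (tr τ)) := by
  induction τ using Tree.induction_gen with
  | ext a => exact (gamB_ext b x φ a).symm ▸ posV_tr _
  | X i =>
    refine (gamB_X b x φ i).symm ▸ (posV_tr _).add ?_
    rw [Algebra.algebraMap_eq_smul_one, ← tr_one]
    exact (posV_tr _).smul (hx i)
  | Xi l =>
    rw [gamB_Xi]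
    by_cases h : l ≤ b
    · rw [xiB_of_le h]
      exact posV_tr _
    · rw [xiB_of_not_le h]
      exact fun u _ => (map_zero u).ge
  | I m σ ih =>
    rw [← integ_tr, gamB_I]
    exact (ih.integB b m).add (.sum fun k _ =>
      ((posV_tr _).smul (by positivity)).smul (hφ _ _))
  | mul σ τ h1 h2 =>
    rw [tr_mul, map_mul]
    exact h1.mul h2

/-! ### Recentring preserves conforming trees -/

variable (R) in
/-- Conforming trees without extended decorations, with node type of the root bounded by `A`. -/
def confSet (A : Multiset (EdgeType d)) : Set (Tree d) :=
  {ρ | ρ.OZero ∧ ρ.ConfAbove R ∧ ρ.nodeType ≤ A}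

variable (R) in
def confV (A : Multiset (EdgeType d)) : Submodule ℝ (VSpace d) :=
  Submodule.span ℝ (tr '' confSet R A)

lemma tr_mem_confV {A : Multiset (EdgeType d)} {ρ : Tree d} (h : ρ ∈ confSet R A) :
    tr ρ ∈ confV R A := Submodule.subset_span ⟨ρ, h, rfl⟩

lemma mul_mem_confV {A B : Multiset (EdgeType d)} {v w : VSpace d} (hv : v ∈ confV R A)
    (hw : w ∈ confV R B) : v * w ∈ confV R (A + B) :=
  mul_mem_span (U := confSet R (A + B)) (fun σ hσ τ hτ => ⟨Tree.OZero.mul hσ.1 hτ.1,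
    (Tree.confAbove_mul R σ τ).2 ⟨hσ.2.1, hτ.2.1⟩, by
    rw [Tree.nodeType_mul]
    exact add_le_add hσ.2.2 hτ.2.2⟩) hv hw

lemma tr_X_mem_confV (A : Multiset (EdgeType d)) (k : MIdx d) : tr (.X k) ∈ confV R A :=
  tr_mem_confV ⟨Tree.OZero_X k, Tree.confAbove_X R k, Multiset.zero_le A⟩

/-- Recentring replaces some kernel branches by polynomials, which only removes edges; node types
shrink and normality keeps them in the rule. -/
lemma gamB_mem_confV (hR : R.IsNormal) (b : MIdx d) (x : Fin d → ℝ)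
    (φ : MIdx d → VSpace d →ₗ[ℝ] ℝ) (t : PTree d) (h0 : t.OZero) (h1 : t.ConformsAbove R) :
    gamB b x φ (tr (.mk t)) ∈ confV R t.nodeType := by
  induction t with
  | root a k =>
    obtain rfl : a = 0 := h0
    change gamB b x φ (tr (.X k)) ∈ confV R 0
    have hmul : ∀ v w, v ∈ confV R 0 → w ∈ confV R 0 → v * w ∈ confV R 0 :=
      fun v w hv hw => add_zero (0 : Multiset (EdgeType d)) ▸ mul_mem_confV hv hw
    have hone : (1 : VSpace d) ∈ confV R 0 := tr_X_mem_confV 0 0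
    rw [tr_X, map_prod]
    refine Finset.prod_induction _ (· ∈ confV R 0) hmul hone fun i _ => ?_
    rw [map_pow, gamB_X]
    have hi : tX i + algebraMap ℝ (VSpace d) (x i) ∈ confV R 0 := by
      refine add_mem (tr_X_mem_confV 0 _) ?_
      rw [Algebra.algebraMap_eq_smul_one]
      exact Submodule.smul_mem _ _ hone
    induction k i with
    | zero => rwa [pow_zero]
    | succ n ih => rw [pow_succ]; exact hmul _ _ ih hi
  | noise l t ih =>
    rw [Tree.mk_noise, tr_mul, map_mul, gamB_Xi, PTree.nodeType, ← Multiset.singleton_add]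
    refine mul_mem_confV ?_ (ih h0 h1.2)
    by_cases h : l ≤ b
    · rw [xiB_of_le h]
      exact tr_mem_confV ⟨Tree.OZero_Xi l, (Tree.confAbove_Xi R l).2 h1.1, le_rfl⟩
    · rw [xiB_of_not_le h]
      exact zero_mem _
  | kern m s t ihs iht =>
    rw [Tree.mk_kern, tr_mul, map_mul, ← integ_tr, gamB_I, PTree.nodeType,
      ← Multiset.singleton_add]
    refine mul_mem_confV (add_mem ?_ (sum_mem fun k _ => ?_)) (iht h0.2 h1.2)
    · refine map_mem_of_mem_span (fun ρ hρ => ?_) (ihs h0.1 h1.1.2)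
      by_cases h : m ≤ b
      · rw [integB_of_le h, integ_tr]
        exact tr_mem_confV ⟨(Tree.OZero_I m ρ).2 hρ.1, (Tree.confAbove_I R m ρ).2
          ⟨hR _ _ hρ.2.2 h1.1.1, hρ.2.1⟩, (Tree.nodeType_I m ρ).le⟩
      · rw [integB_of_not_le h]
        exact zero_mem _
    · exact Submodule.smul_mem _ _ (Submodule.smul_mem _ _ (tr_X_mem_confV _ k))

lemma indFun_singleton (ρ : Tree d) (v : VSpace d) : indFun {ρ} v = v.coeff ρ := by
  classical
  refine LinearMap.congr_fun (f := indFun {ρ}) (g := Finsupp.lapply ρ ∘ₗ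
    (MonoidAlgebra.coeffLinearEquiv ℝ).toLinearMap) (linMap_ext fun τ => ?_) v
  rw [indFun_tr]
  exact (coeff_tr τ ρ).symm

lemma mem_span_of_coeff {S : Set (Tree d)} {v : VSpace d} (h : ∀ ρ, v.coeff ρ ≠ 0 → ρ ∈ S) :
    v ∈ Submodule.span ℝ (tr '' S) := by
  rw [eq_sum_coeff v]
  exact sum_mem fun ρ hρ => Submodule.smul_mem _ _
    (Submodule.subset_span ⟨ρ, h ρ (Finsupp.mem_support_iff.1 hρ), rfl⟩)

/-- Let τ be a contraction of a conforming t₀. A tree ρ in Γ_f τ has positive coefficient in Γ_f M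
t₀, with M built from the indicator of `TMinus`; nonnegativity of `f` excludes cancellation. By
cointeraction this vector is M Γ' t₀ for a pulled back recentring Γ'. The trees in Γ' t₀ still
conform, so ρ is a contraction of one of them. -/
lemma GamV_mem_of_nonneg (hR : R.IsNormal) {f : GPlus P R} (hx : ∀ i, 0 ≤ xOf f i)
    (hf : ∀ n, NonnegFun (fHat f n)) {τ : Tree d} (hτ : τ ∈ TExCirc P R) :
    GamV f (tr τ) ∈ Submodule.span ℝ (tr '' TExCirc P R) := by
  refine mem_span_of_coeff fun ρ hρ => ?_
  obtain ⟨t₀, ht₀, e₀, c₀, hc₀, rfl⟩ := hτ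
  obtain ⟨b, h1, h2⟩ := ((eventually_gamB_trunc f (tr (c₀.contracted P))).and
    c₀.eventually_mem_boxCuts).exists
  set φ := truncFun (fHat f) b
  have hφ : ∀ n, NonnegFun (φ n) := by
    intro n
    by_cases h : n ≤ b
    · rw [show φ n = _ from truncFun_of_le h]
      exact hf n
    · rw [show φ n = _ from truncFun_of_not_le h]
      exact fun _ => le_rfl
  have h3 : ∀ σ, PosV (gamB b (xOf f) φ (tr σ)) := gamB_posV hx hφ
  have h4 : 0 < (indFun {ρ} ∘ₗ (gamB b (xOf f) φ).toLinearMap)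
      (MB P b (indFun (TMinus P R)) (tr (.mk t₀))) := by
    refine NonnegFun.MB_pos (fun σ => h3 σ _ (indFun_nonneg _)) (indFun_nonneg _) h2
      (fun σ hσ => indFun_ne_zero.2 (hc₀ σ hσ)) ?_
    refine lt_of_le_of_ne (h3 _ _ (indFun_nonneg _)) (Ne.symm ?_)
    rw [LinearMap.comp_apply, AlgHom.toLinearMap_apply, h1, indFun_singleton]
    exact hρ
  rw [LinearMap.comp_apply, AlgHom.toLinearMap_apply,
    gamB_MB P b _ (xOf f) (fun n hn => truncFun_of_not_le hn)] at h4
  by_contra hnot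
  refine h4.ne' ((Submodule.mem_bot ℝ).1 (map_mem_of_mem_span
    (F := indFun {ρ} ∘ₗ MB P b (indFun (TMinus P R))) (fun σ hσ => ?_)
    (gamB_mem_confV hR b (xOf f) (pullFun P b (indFun (TMinus P R)) φ) t₀ ht₀.1 ht₀.2.2)))
  rw [Submodule.mem_bot]
  by_contra h5
  obtain ⟨s⟩ := σ
  obtain ⟨e, c, h6, h7⟩ := exists_of_MB_ne_zero (P := P) (u := indFun {ρ}) (g := indFun (TMinus P R))
    (b := b) (t := s) h5
  have h8 : c.contracted P ∈ ({ρ} : Set (Tree d)) := indFun_ne_zero.1 h7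
  exact hnot ⟨s, ⟨hσ.1, hR _ _ hσ.2.2 ht₀.2.1, hσ.2.1⟩, e, c,
    fun σ hσ => indFun_ne_zero.1 (h6 σ hσ), h8⟩

lemma inclT_projT {v : VSpace d} (hv : v ∈ Submodule.span ℝ (tr '' TExCirc P R)) :
    inclT P R (projT P R v) = v := by
  have := map_mem_of_mem_span (F := inclT P R ∘ₗ projT P R - LinearMap.id) (N := ⊥)
    (fun ρ hρ => by simp [inclT_projT_tr hρ]) hv
  simpa [sub_eq_zero] using this

/-- `Δ_+` takes values in `𝒯 ⊗ 𝒯_+`. -/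
theorem deltaPlus_mem (hR : R.IsNormal) {τ : Tree d} (hτ : τ ∈ TExCirc P R) :
    deltaPlusTree P R τ ∈
      LinearMap.range (TensorProduct.map (inclT P R) (LinearMap.id (M := TPlus P R))) := by
  classical
  let B : Module.Basis (Tree d) ℝ (VSpace d) := .ofRepr (MonoidAlgebra.coeffLinearEquiv ℝ)
  have hB : ∀ (f : GPlus P R) (z : VSpace d ⊗[ℝ] TPlus P R) (ρ : Tree d),
      f (TensorProduct.equivFinsuppOfBasisLeft B z ρ) = (evalR f z).coeff ρ := by
    intro f z ρ
    induction z with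
    | zero => simp
    | add z w hz hw => simp only [map_add, Finsupp.add_apply, MonoidAlgebra.coeff_add, hz, hw]
    | tmul v p =>
      rw [TensorProduct.equivFinsuppOfBasisLeft_apply_tmul_apply, map_smul, evalR_tmul,
        MonoidAlgebra.coeff_smul, Finsupp.smul_apply, smul_eq_mul, smul_eq_mul, mul_comm]
      rfl
  have hproj : ∀ (f : GPlus P R) (z : VSpace d ⊗[ℝ] TPlus P R),
      evalR f (TensorProduct.map (inclT P R ∘ₗ projT P R) LinearMap.id z) =
        inclT P R (projT P R (evalR f z)) := by
    intro f z
    induction z with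
    | zero => simp
    | add z w hz hw => simp only [map_add, hz, hw]
    | tmul v p => simp [evalR_tmul]
  have key : TensorProduct.map (inclT P R ∘ₗ projT P R) LinearMap.id (deltaPlusTree P R τ) =
      deltaPlusTree P R τ := by
    refine (TensorProduct.equivFinsuppOfBasisLeft B).injective (Finsupp.ext fun ρ => ?_)
    -- The coefficient of Δ_+ τ at a tree is a polynomial in the generators, hence is determined by
    -- its values on the nonnegative orthant. Those are given by nonnegative characters, for which
    -- stability is already known.
    refine MvPolynomial.funext_set (fun _ => Set.Ici (0 : ℝ)) (fun _ => Set.Ici_infinite 0)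
      fun x hx => ?_
    let f : GPlus P R := MvPolynomial.aeval x
    have hf : ∀ p, MvPolynomial.eval x p = f p := fun p =>
      (MvPolynomial.aeval_eq_eval x ▸ rfl)
    rw [hf, hf, hB, hB, hproj, evalR_deltaPlusTree, inclT_projT]
    refine GamV_mem_of_nonneg hR (fun i => ?_) (fun n σ => ?_) hτ
    · rw [xOf, MvPolynomial.aeval_X]
      exact hx _ trivial
    · rw [fHat_tr, piPlusI]
      split_ifs
      · rw [MvPolynomial.aeval_X]
        exact hx _ trivial
      · rw [map_zero]
  refine ⟨TensorProduct.map (projT P R) LinearMap.id (deltaPlusTree P R τ), ?_⟩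
  rw [← LinearMap.comp_apply, ← TensorProduct.map_comp, LinearMap.id_comp, key]

lemma GamV_mem (hR : R.IsNormal) (f : GPlus P R) {τ : Tree d} (hτ : τ ∈ TExCirc P R) :
    GamV f (tr τ) ∈ Submodule.span ℝ (tr '' TExCirc P R) := by
  obtain ⟨w, hw⟩ := deltaPlus_mem hR hτ
  rw [← evalR_deltaPlusTree, ← hw]
  have hincl : ∀ v, inclT P R v ∈ Submodule.span ℝ (tr '' TExCirc P R) := by
    intro v
    rw [inclT, Finsupp.linearCombination_apply]
    exact sum_mem fun ρ _ => Submodule.smul_mem _ _ (Submodule.subset_span ⟨ρ.1, ρ.2, rfl⟩)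
  clear hw
  induction w with
  | zero => simp
  | add z w hz hw => rw [map_add, map_add]; exact add_mem hz hw
  | tmul v p =>
    rw [TensorProduct.map_tmul, evalR_tmul]
    exact Submodule.smul_mem _ _ (hincl v)

lemma inclT_Gam (hR : R.IsNormal) (f : GPlus P R) (v : TSpace P R) :
    inclT P R (Gam P R f v) = GamV f (inclT P R v) := by
  refine LinearMap.congr_fun (f := inclT P R ∘ₗ Gam P R f) (g := (GamV f).toLinearMap ∘ₗ inclT P R)
    (linMap_ext_single fun τ => ?_) v
  rw [LinearMap.comp_apply, LinearMap.comp_apply, Gam_single, inclT_projT (GamV_mem hR f τ.2),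
    inclT_single]
  rfl

/-- The group law is available only on trees with branches in `TExCirc`, so composing more than two
recentrings requires that their span be stable. -/
lemma GamV_branchIn (hR : R.IsNormal) (f : GPlus P R) {τ : Tree d}
    (hτ : τ.BranchIn (TExCirc P R)) :
    GamV f (tr τ) ∈ Submodule.span ℝ (tr '' {τ : Tree d | τ.BranchIn (TExCirc P R)}) := by
  have htr : ∀ {τ : Tree d}, τ.BranchIn (TExCirc P R) →
      tr τ ∈ Submodule.span ℝ (tr '' {τ : Tree d | τ.BranchIn (TExCirc P R)}) :=
    fun h => Submodule.subset_span ⟨_, h, rfl⟩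
  induction τ using Tree.induction_gen with
  | ext a => exact (GamV_ext f a).symm ▸ htr hτ
  | X i =>
    refine (GamV_X f i).symm ▸ add_mem (htr hτ) ?_
    rw [Algebra.algebraMap_eq_smul_one, ← tr_one]
    exact Submodule.smul_mem _ _ (htr (Tree.branchIn_root _ _ _))
  | Xi l => exact (GamV_Xi f l).symm ▸ htr hτ
  | I m σ ih =>
    rw [Tree.branchIn_I] at hτ
    rw [GamV_I]
    refine add_mem (map_mem_of_mem_span (fun ρ hρ => ?_) (GamV_mem hR f hτ)) (sum_mem fun k _ => ?_)
    · rw [integ_tr]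
      exact htr ((Tree.branchIn_I _ m ρ).2 hρ)
    · exact Submodule.smul_mem _ _ (Submodule.smul_mem _ _ (htr (Tree.branchIn_root _ _ _)))
  | mul σ τ h1 h2 =>
    rw [Tree.branchIn_mul] at hτ
    rw [tr_mul, map_mul]
    exact mul_mem_span (fun σ hσ τ hτ => (Tree.branchIn_mul _ σ τ).2 ⟨hσ, hτ⟩) (h1 hτ.1) (h2 hτ.2)

/-! ### Inverses of positive characters -/

/-- The coefficients of the inverse of `f` at planted trees, in terms of the action `w` of the
inverse on the branch. -/
def invVal (f : GPlus P R) (m : MIdx d) (σ : Tree d) (w : VSpace d) : ℝ :=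
  - ∑ j ∈ P.below ((Tree.I m σ).degPlus P), dpow (- xOf f) j * fHat f (m + j) w

/-- The recursion for the action of the inverse of `f`. -/
def invRec (f : GPlus P R) : TreeRec d (VSpace d) where
  ext := tExt
  ext_zero := rfl
  ext_add := tExt_add
  X i := tX i + algebraMap ℝ _ (- xOf f i)
  Xi l := tr (.Xi l)
  I m σ w := integ m w + ∑ k ∈ P.below ((Tree.I m σ).degPlus P), invVal f (m + k) σ w • dp k

/-- The right inverse of `f`. -/
def rightInv (f : GPlus P R) : GPlus P R := MvPolynomial.aeval <|
  Sum.elim (fun i => - xOf f i) fun p => invVal f p.1.1 p.1.2 ((invRec f).hom (tr p.1.2))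

lemma xOf_rightInv (f : GPlus P R) : xOf (rightInv f) = - xOf f := by
  ext i
  simp [xOf, rightInv]

lemma GamV_rightInv (f : GPlus P R) (τ : Tree d) (hτ : τ.BranchIn (TExCirc P R)) :
    GamV (rightInv f) (tr τ) = (invRec f).hom (tr τ) := by
  induction τ using Tree.induction_gen with
  | ext a => exact (GamV_ext _ a).trans (TreeRec.hom_ext (invRec f) a).symm
  | X i =>
    refine ((GamV_X _ i).trans ?_).trans (TreeRec.hom_X (invRec f) i).symm
    rw [xOf_rightInv]
    rfl
  | Xi l => exact (GamV_Xi _ l).trans (TreeRec.hom_Xi (invRec f) l).symm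
  | I m σ ih =>
    rw [Tree.branchIn_I] at hτ
    rw [GamV_I, ih (branchIn_of_mem hτ), TreeRec.hom_I]
    change _ = integ m _ + _
    congr 1
    refine Finset.sum_congr rfl fun k hk => ?_
    rw [fHat_of_pos _ ⟨hτ, mem_below_degPlus_I.1 hk⟩, rightInv, MvPolynomial.aeval_X]
    rfl
  | mul σ τ h1 h2 =>
    rw [Tree.branchIn_mul] at hτ
    rw [tr_mul, map_mul, map_mul, h1 hτ.1, h2 hτ.2]

lemma dpow_real_zero {k : MIdx d} (hk : k ≠ 0) : dpow (fun _ => (0 : ℝ)) k = 0 := by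
  obtain ⟨i, hi⟩ := Function.ne_iff.1 hk
  rw [dpow, Finset.prod_eq_zero (Finset.mem_univ i) (zero_pow hi), smul_zero]

/-- With w = Γ_{f'} σ, the product at I_m[σ] is f(I_m w) minus a double sum of x^k/k! (-x)^j/j!
f(I_{m+k+j} w). By the addition formula the exponentials in x and -x cancel, leaving only k + j = 0,
so the result is zero. -/
lemma conv_rightInv (f : GPlus P R) : GPlus.conv P R f (rightInv f) = GPlus.unit P R := by
  refine MvPolynomial.algHom_ext fun p => ?_
  obtain i | ⟨⟨m, σ⟩, hσ, hpos⟩ := p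
  · have := congrFun (xOf_conv f (rightInv f)) i
    rw [xOf_rightInv, add_neg_cancel] at this
    refine this.trans ?_
    simp [GPlus.unit]
  · rw [← fHat_of_pos _ ⟨hσ, hpos⟩, fHat_conv f _ m hσ]
    refine Eq.trans ?_ (MvPolynomial.aeval_X _ _).symm
    set w := GamV (rightInv f) (tr σ)
    have hval : ∀ n, 0 < (Tree.I n σ).degPlus P →
        fHat (rightInv f) n (tr σ) = invVal f n σ w := by
      intro n hn
      rw [fHat_of_pos _ ⟨hσ, hn⟩, rightInv, MvPolynomial.aeval_X,
        show w = _ from GamV_rightInv f σ (branchIn_of_mem hσ)]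
      rfl
    have hzero : ∀ n, ¬ 0 < (Tree.I n σ).degPlus P → fHat f n w = 0 := fun n hn =>
      fHat_eq_zero f (GamV_mem_lowV _ σ) hn
    -- Both degree-limited sums are enlarged to a common box; the added terms vanish because `f` is
    -- zero at nonpositive degree.
    obtain ⟨b, hb⟩ : ∃ b, ∀ k ∈ P.below ((Tree.I m σ).degPlus P), k ≤ b :=
      ((eventually_all_finset _).2 fun k _ => eventually_ge_atTop k).exists
    have hF : ∀ n, ¬ n ≤ b → fHat f (m + n) w = 0 := fun n hn =>
      hzero _ fun h => hn (hb n (mem_below_degPlus_I.2 h))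
    have hinner : ∀ k ∈ P.below ((Tree.I m σ).degPlus P), fHat (rightInv f) (m + k) (tr σ) =
        - ∑ j ∈ Finset.Iic b, dpow (- xOf f) j * fHat f (m + (k + j)) w := by
      intro k hk
      have hk' := mem_below_degPlus_I.1 hk
      rw [hval _ hk', invVal]
      simp only [add_assoc]
      rw [Finset.sum_subset (fun j hj => ?_) fun j _ hj => ?_]
      · refine Finset.mem_Iic.2 (hb j ?_)
        rw [P.mem_below] at hj ⊢
        rw [Tree.degPlus_I_add] at hj
        linarith [P.deg_nonneg k]
      · rw [hzero, mul_zero]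
        rw [← add_assoc]
        exact fun h => hj (mem_below_degPlus_I.2 h)
    have houter : ∑ k ∈ P.below ((Tree.I m σ).degPlus P),
        dpow (xOf f) k * fHat (rightInv f) (m + k) (tr σ) = - ∑ k ∈ Finset.Iic b,
          ∑ j ∈ Finset.Iic b, dpow (xOf f) k • dpow (- xOf f) j • fHat f (m + (k + j)) w := by
      rw [← Finset.sum_neg_distrib, ← Finset.sum_subset
        (fun k hk => Finset.mem_Iic.2 (hb k hk)) fun k _ hk => ?_]
      · refine Finset.sum_congr rfl fun k hk => ?_
        rw [hinner k hk, mul_neg, Finset.mul_sum]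
        simp only [smul_eq_mul]
      · rw [neg_eq_zero]
        refine Finset.sum_eq_zero fun j _ => ?_
        rw [hzero, smul_zero, smul_zero]
        rw [← add_assoc, Tree.degPlus_I_add]
        intro h
        exact hk (mem_below_degPlus_I.2 (by linarith [P.deg_nonneg j]))
    rw [houter, ← sum_dpow_add b _ _ (fun n => fHat f (m + n) w) hF]
    simp only [Pi.neg_apply, add_neg_cancel]
    rw [Finset.sum_eq_single_of_mem 0 (by simp) fun k _ hk => by rw [dpow_real_zero hk, zero_smul]]
    rw [dpow_zero, one_smul, add_zero, add_neg_cancel]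

/-- A right inverse exists for every character. The right inverse of the right inverse acts as `f`
does, so the right inverse is also a left inverse at the level of operators, and `GamV_faithful`
brings this back to characters. -/
theorem exists_isInv_plus (hR : R.IsNormal) (f : GPlus P R) : ∃ f', GPlus.IsInv P R f f' := by
  let S : Set (Tree d) := {τ | τ.BranchIn (TExCirc P R)}
  have heq : ∀ {F G : VSpace d →ₐ[ℝ] VSpace d}, (∀ τ ∈ S, F (tr τ) = G (tr τ)) →
      ∀ v ∈ Submodule.span ℝ (tr '' S), F v = G v := by
    intro F G h v hv
    have := map_mem_of_mem_span (F := F.toLinearMap - G.toLinearMap) (N := ⊥)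
      (fun ρ hρ => by simp [h ρ hρ]) hv
    simpa [sub_eq_zero] using this
  have hinv : ∀ (f : GPlus P R), ∀ τ ∈ S, GamV f (GamV (rightInv f) (tr τ)) = tr τ := by
    intro f τ hτ
    rw [GamV_conv f _ τ hτ, conv_rightInv, GamV_unit]
    rfl
  -- With f' and f'' the iterated right inverses, Γ_f Γ_{f'} is cancelled on the vector Γ_{f''} τ,
  -- while Γ_{f'} Γ_{f''} is cancelled on τ.
  have hff : ∀ τ ∈ S, GamV (rightInv (rightInv f)) (tr τ) = GamV f (tr τ) := by
    intro τ hτ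
    have h1 := heq (F := (GamV f).comp (GamV (rightInv f))) (G := AlgHom.id ℝ _) (hinv f) _
      (GamV_branchIn hR (rightInv (rightInv f)) hτ)
    rw [AlgHom.comp_apply, hinv _ τ hτ] at h1
    exact h1.symm
  refine ⟨rightInv f, GamV_faithful fun τ hτ => ?_, conv_rightInv f⟩
  rw [← GamV_conv _ _ τ hτ, ← hff τ hτ, hinv _ τ hτ, GamV_unit]
  rfl

lemma Gam_conv (hR : R.IsNormal) (f h : GPlus P R) :
    Gam P R (GPlus.conv P R f h) = Gam P R f ∘ₗ Gam P R h := by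
  refine linMap_ext_single fun τ => inclT_injective P R ?_
  rw [LinearMap.comp_apply, inclT_Gam hR, inclT_Gam hR, inclT_Gam hR, inclT_single,
    GamV_conv _ _ _ (branchIn_of_mem τ.2)]

lemma Gam_unit (hR : R.IsNormal) : Gam P R (GPlus.unit P R) = LinearMap.id := by
  refine linMap_ext_single fun τ => inclT_injective P R ?_
  rw [inclT_Gam hR, GamV_unit]
  rfl

lemma isInv_inv (hR : R.IsNormal) (f : GPlus P R) : GPlus.IsInv P R f (GPlus.inv P R f) := by
  have h := exists_isInv_plus hR f
  rw [GPlus.inv, dif_pos h]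
  exact h.choose_spec

/-! ### Action of negative characters on positive ones -/

/-- The positive character `f(M_g ·)`. -/
def pullG (f : GPlus P R) (g : GMinus P R) : GPlus P R := MvPolynomial.aeval <|
  Sum.elim (xOf f) fun p => fHat f p.1.1 (MV g (tr p.1.2))

lemma xOf_pullG (f : GPlus P R) (g : GMinus P R) : xOf (pullG f g) = xOf f := by
  ext i
  simp [xOf, pullG]

lemma fHat_pullG (f : GPlus P R) (g : GMinus P R) (n : MIdx d) {σ : Tree d}
    (hσ : σ ∈ TExCirc P R) : fHat (pullG f g) n (tr σ) = fHat f n (MV g (tr σ)) := by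
  by_cases hn : 0 < (Tree.I n σ).degPlus P
  · rw [fHat_of_pos _ ⟨hσ, hn⟩, pullG, MvPolynomial.aeval_X]
    rfl
  · rw [fHat_of_not_pos _ hn, fHat_eq_zero f (MV_mem_lowV g σ) hn]

/-- Cointeraction of the positive and the negative action. -/
theorem GamV_MV (f : GPlus P R) (g : GMinus P R) (τ : Tree d) (hτ : τ.BranchIn (TExCirc P R)) :
    GamV f (MV g (tr τ)) = MV g (GamV (pullG f g) (tr τ)) := by
  have key := eventually_gamB_eq branchIn_TExCirc (pullG f g)
    (φ := fun b => pullFun P b (gHat g) (truncFun (fHat f) b))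
    (fun σ hσ n => ?_) (fun σ hσ => ?_) τ hτ
  · rw [xOf_pullG] at key
    obtain ⟨b, ⟨⟨h1, h2⟩, h3⟩, h4⟩ := ((((eventually_MB_MV g (tr τ)).and
      (eventually_gamB_trunc f (MV g (tr τ)))).and
      (eventually_MB_MV g (GamV (pullG f g) (tr τ)))).and key).exists
    rw [← h2, ← h1, ← h3, ← h4, gamB_MB P b _ _ fun n hn => truncFun_of_not_le hn]
  · filter_upwards [eventually_MB_MV g (tr σ), eventually_ge_atTop n] with b h1 h2
    rw [pullFun, LinearMap.comp_apply, h1, truncFun_of_le h2, fHat_pullG f g n hσ]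
  · filter_upwards [eventually_MB_MV g (tr σ)] with b h1 n hn
    rw [pullFun, LinearMap.comp_apply, h1, truncFun_eq_zero (fHat_eq_zero f (MV_mem_lowV g σ) hn)]

lemma Gam_M (hR : R.IsNormal) (f : GPlus P R) (g : GMinus P R) :
    Gam P R f ∘ₗ M P R g = M P R g ∘ₗ Gam P R (pullG f g) := by
  refine linMap_ext_single fun τ => inclT_injective P R ?_
  rw [LinearMap.comp_apply, LinearMap.comp_apply, inclT_Gam hR, inclT_M hR, inclT_M hR,
    inclT_Gam hR, inclT_single, GamV_MV _ _ _ (branchIn_of_mem τ.2)]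

/-! ### The negative action on monomials and planted trees -/

lemma MB_tr_X_mul {g : VSpace d →ₗ[ℝ] ℝ} (hg : IsNegFun P g) (b k : MIdx d) (v : VSpace d) :
    MB P b g (tr (.X k) * v) = tr (.X k) * MB P b g v := by
  have h1 : ∀ (i : Fin d) (n : ℕ) (v : VSpace d),
      MB P b g (tX i ^ n * v) = tX i ^ n * MB P b g v := by
    intro i n
    induction n with
    | zero => simp
    | succ n ih => intro v; rw [pow_succ, mul_assoc, ih, hg.MB_X_mul, mul_assoc]
  have h2 : ∀ (s : Finset (Fin d)) (v : VSpace d), MB P b g ((∏ i ∈ s, tX i ^ k i) * v) =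
      (∏ i ∈ s, tX i ^ k i) * MB P b g v := by
    classical
    intro s
    induction s using Finset.induction_on with
    | empty => simp
    | insert i s hi ih => intro v; rw [Finset.prod_insert hi, mul_assoc, h1, ih, mul_assoc]
  rw [tr_X, h2]

lemma MV_tr_X_mul (g : GMinus P R) (k : MIdx d) (v : VSpace d) :
    MV g (tr (.X k) * v) = tr (.X k) * MV g v := by
  obtain ⟨b, h1, h2⟩ :=
    ((eventually_MB_MV g v).and (eventually_MB_MV g (tr (.X k) * v))).exists
  rw [← h1, ← h2, MB_tr_X_mul (gHat_isNegFun g)]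

lemma MV_one (g : GMinus P R) : MV g 1 = 1 := by
  obtain ⟨b, h⟩ := (eventually_MB_MV g 1).exists
  rw [← h]
  exact (gHat_isNegFun g).MB_ext b 0

lemma MV_integ (g : GMinus P R) (m : MIdx d) (v : VSpace d) :
    MV g (integ m v) = integ m (MV g v) := by
  obtain ⟨b, ⟨h1, h2⟩, h3⟩ := (((eventually_MB_MV g v).and
    (eventually_MB_MV g (integ m v))).and (eventually_ge_atTop m)).exists
  have := (gHat_isNegFun g).MB_ext_mul_integ b 0 m v
  rwa [tExt_zero, one_mul, one_mul, h1, h2, integB_of_le h3] at this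

lemma MV_Xi (g : GMinus P R) (l : MIdx d) : MV g (tr (.Xi l)) = tr (.Xi l) := by
  obtain ⟨b, h1, h2⟩ := ((eventually_MB_MV g (tr (.Xi l))).and (eventually_ge_atTop l)).exists
  have := (gHat_isNegFun g).MB_ext_mul_Xi b 0 l
  rwa [tExt_zero, one_mul, one_mul, h1, xiB_of_le h2] at this

/-- Multiplication by X^k commutes with the extraction operator of the indicator of `TMinus`, so by
positivity X^k τ is a contraction of X^k t₀ whenever τ is one of t₀. Polynomial factors leave node
types unchanged. -/
lemma X_mul_mem (k : MIdx d) {τ : Tree d} (hτ : τ ∈ TExCirc P R) :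
    .X k * τ ∈ TExCirc P R := by
  obtain ⟨t₀, ht₀, e₀, c₀, hc₀, rfl⟩ := hτ
  obtain ⟨b, hb⟩ := c₀.eventually_mem_boxCuts.exists
  obtain ⟨s, hs⟩ : ∃ s, Tree.mk s = .X k * .mk t₀ := Quot.exists_rep _
  have h1 : 0 < (indFun {.X k * c₀.contracted P} ∘ₗ LinearMap.mulLeft ℝ (tr (.X k)))
      (MB P b (indFun (TMinus P R)) (tr (.mk t₀))) := by
    refine NonnegFun.MB_pos (fun σ => ?_) (indFun_nonneg _) hb
      (fun σ hσ => indFun_ne_zero.2 (hc₀ σ hσ)) ?_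
    · rw [LinearMap.comp_apply, LinearMap.mulLeft_apply, ← tr_mul]
      exact indFun_nonneg _ _
    · rw [LinearMap.comp_apply, LinearMap.mulLeft_apply, ← tr_mul]
      exact indFun_pos rfl
  rw [LinearMap.comp_apply, LinearMap.mulLeft_apply, ← MB_tr_X_mul isNegFun_ind_TMinus, ← tr_mul,
    ← hs] at h1
  obtain ⟨e, c, h2, h3⟩ := exists_of_MB_ne_zero h1.ne'
  have h4 : c.contracted P ∈ ({.X k * c₀.contracted P} : Set (Tree d)) := indFun_ne_zero.1 h3
  refine ⟨s, ?_, e, c, fun σ hσ => indFun_ne_zero.1 (h2 σ hσ), h4⟩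
  rw [hs]
  refine ⟨(Tree.OZero_X k).mul ht₀.1, ?_, (Tree.confAbove_mul R (.X k) (.mk t₀)).2
    ⟨Tree.confAbove_X R k, ht₀.2.2⟩⟩
  rw [Tree.nodeType_mul, Tree.nodeType_X, zero_add]
  exact ht₀.2.1

end

end RegStr
end

/-! ### Analysis: convolution, admissibility, characters and bounds of the renormalised map. -/

noncomputable section

namespace RegStr

variable {d : ℕ}

/-! ### Derivatives and convolution -/

lemma contDiff_smooth (f : Smooth d) : ContDiff ℝ ∞ (f : Rd d → ℝ) := f.2

lemma contDiff_partialDeriv (i : Fin d) {f : Rd d → ℝ} (hf : ContDiff ℝ ∞ f) :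
    ContDiff ℝ ∞ (partialDeriv i f) :=
  (hf.fderiv_right (m := ∞) (by simp)).clm_apply contDiff_const

/-- Partial derivatives as linear maps of smooth functions. -/
def partialL (i : Fin d) : Smooth d →ₗ[ℝ] Smooth d where
  toFun f := ⟨partialDeriv i f, contDiff_partialDeriv i f.2⟩
  map_add' f g := by
    ext x
    have hf := (contDiff_smooth f).differentiable (by simp)
    have hg := (contDiff_smooth g).differentiable (by simp)
    simp [partialDeriv, fderiv_add (hf x) (hg x)]
  map_smul' a f := by
    ext x
    have hf := (contDiff_smooth f).differentiable (by simp)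
    simp [partialDeriv, fderiv_const_smul (hf x)]

lemma exists_mderivL (l : MIdx d) :
    ∃ L : Smooth d →ₗ[ℝ] Smooth d, ∀ f : Smooth d, mderiv l f = L f := by
  have h1 : ∀ (i : Fin d) (n : ℕ), ∃ L : Smooth d →ₗ[ℝ] Smooth d,
      ∀ f : Smooth d, (partialDeriv i)^[n] f = L f := by
    intro i n
    induction n with
    | zero => exact ⟨LinearMap.id, fun f => rfl⟩
    | succ n ih =>
      obtain ⟨L, hL⟩ := ih
      exact ⟨L ∘ₗ partialL i, fun f => hL (partialL i f)⟩
  have h2 : ∀ s : List (Fin d), ∃ L : Smooth d →ₗ[ℝ] Smooth d,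
      ∀ f : Smooth d, s.foldr (fun i h => (partialDeriv i)^[l i] h) f = L f := by
    intro s
    induction s with
    | nil => exact ⟨LinearMap.id, fun f => rfl⟩
    | cons i s ih =>
      obtain ⟨L, hL⟩ := ih
      obtain ⟨L', hL'⟩ := h1 i (l i)
      exact ⟨L' ∘ₗ L, fun f => by rw [List.foldr_cons, hL, hL']; rfl⟩
  exact h2 _

-- The kernel is supported in the unit ball, so only the values of `f` on a compact ball around x
-- matter, where it is bounded.
open MeasureTheory in
lemma IsKernel.integrable_mul {K : Rd d → ℝ} (hK : IsKernel K) (x : Rd d) {f : Rd d → ℝ}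
    (hf : Continuous f) : Integrable fun y => K (x - y) * f y := by
  have h1 : Integrable fun y => K (x - y) := hK.integrable.comp_sub_left x
  obtain ⟨C, hC⟩ := (isCompact_closedBall x 1).exists_bound_of_continuousOn hf.continuousOn
  refine (h1.norm.mul_const C).mono' (h1.aestronglyMeasurable.mul hf.aestronglyMeasurable)
    (.of_forall fun y => ?_)
  rw [norm_mul]
  by_cases hy : K (x - y) = 0
  · simp [hy]
  · refine mul_le_mul_of_nonneg_left (hC y ?_) (norm_nonneg _)
    have := (hK.support hy).2
    rw [Metric.mem_closedBall, dist_eq_norm, norm_sub_rev]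
    exact this.le

/-- Convolution with the kernel as a linear functional. -/
lemma IsKernel.exists_kconvL {K : Rd d → ℝ} (hK : IsKernel K) (m : MIdx d) (x : Rd d) :
    ∃ L : Smooth d →ₗ[ℝ] ℝ, ∀ f : Smooth d, kconv K m f x = L f := by
  obtain ⟨D, hD⟩ := exists_mderivL m
  have hint : ∀ f : Smooth d,
      MeasureTheory.Integrable fun y => K (x - y) * (D f : Rd d → ℝ) y := fun f =>
    hK.integrable_mul x (contDiff_smooth (D f)).continuous
  refine ⟨
    { toFun := fun f => ∫ y, K (x - y) * (D f : Rd d → ℝ) y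
      map_add' := fun f g => ?_
      map_smul' := fun a f => ?_ }, fun f => by rw [kconv, hD]; rfl⟩
  · rw [← MeasureTheory.integral_add (hint f) (hint g)]
    simp [mul_add]
  · rw [RingHom.id_apply, smul_eq_mul, ← MeasureTheory.integral_const_mul]
    simp [mul_left_comm]

section Renormalisation

variable {P : Degrees d} {R : Rule d} {K : Rd d → ℝ}

lemma eqOn_span {W : Type*} [AddCommGroup W] [Module ℝ W] {S : Set (Tree d)}
    {F G : VSpace d →ₗ[ℝ] W} (h : ∀ ρ ∈ S, F (tr ρ) = G (tr ρ)) {v : VSpace d}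
    (hv : v ∈ Submodule.span ℝ (tr '' S)) : F v = G v := by
  have := map_mem_of_mem_span (F := F - G) (N := ⊥) (fun ρ hρ => by simp [h ρ hρ]) hv
  simpa [sub_eq_zero] using this

/-- The last condition ensures that admissibility may be used at I_m[ρ] for each tree ρ of M_g τ
whenever I_m[τ] is an extended tree. -/
lemma MV_mem (hR : R.IsNormal) (g : GMinus P R) {τ : Tree d} (hτ : τ ∈ TExCirc P R) :
    MV g (tr τ) ∈ Submodule.span ℝ (tr '' {ρ | ρ ∈ TExCirc P R ∧ ρ.degPlus P = τ.degPlus P ∧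
      ∀ m, Tree.I m τ ∈ TExCirc P R → Tree.I m ρ ∈ TExCirc P R}) := by
  obtain ⟨t⟩ := τ
  change MV g (tr (.mk t)) ∈ _
  rw [MV_mk]
  refine sum_mem fun c _ => ?_
  by_cases h : forestVal (gHat g) c.2.extracted = 0
  · rw [h, mul_zero, zero_smul]
    exact zero_mem _
  · have h1 : ∀ σ ∈ c.2.extracted, σ ∈ TExMinus P R := fun σ hσ =>
      gHat_ne_zero (forestVal_ne_zero.1 h σ hσ)
    exact Submodule.smul_mem _ _ (Submodule.subset_span ⟨_, ⟨contracted_mem hR t hτ c.1 c.2 h1,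
      c.2.degPlus_contracted P, fun m hm => I_contracted_mem hR hm c.2 h1⟩, rfl⟩)

lemma evalV_renorm (g : GMinus P R) (Pm : TSpace P R →ₗ[ℝ] Smooth d) {τ : Tree d}
    (hτ : τ ∈ TExCirc P R) :
    evalV P R (renorm P R g Pm) (tr τ) = evalV P R Pm (MV g (tr τ)) := by
  rw [evalV, evalV, renorm_eq, LinearMap.comp_apply, ← M_single g ⟨τ, hτ⟩, ← projT_tr]

/-- Evaluation at a point as a linear functional. -/
def evalAt (Pm : TSpace P R →ₗ[ℝ] Smooth d) (x : Rd d) : VSpace d →ₗ[ℝ] ℝ :=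
  LinearMap.proj x ∘ₗ (Smooth d).subtype ∘ₗ Pm ∘ₗ projT P R

lemma evalAt_apply (Pm : TSpace P R →ₗ[ℝ] Smooth d) (x : Rd d) (v : VSpace d) :
    evalAt Pm x v = evalV P R Pm v x := rfl

/-- M_g fixes 1 and Ξ_l and commutes with X^k and I_m, because the components extracted by a
negative character are unplanted and carry no polynomial at their root. Each condition for Π^g = Π
M_g thus reduces linearly to the same condition for Π, with the same noise. -/
theorem isAdmissible_renorm (hR : R.IsNormal) (hK : IsKernel K) (g : GMinus P R)
    {Pm : TSpace P R →ₗ[ℝ] Smooth d} (h : IsAdmissible P R K Pm) :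
    IsAdmissible P R K (renorm P R g Pm) := by
  obtain ⟨ξ, hξ, hX, h1, hXi, hI⟩ := h
  refine ⟨ξ, hξ, fun τ hτ k x => ?_, fun h x => ?_, fun l hl => ?_, fun τ hτ m hm => ?_⟩
  · rw [evalV_renorm g Pm (X_mul_mem k hτ), evalV_renorm g Pm hτ, tr_mul, MV_tr_X_mul]
    refine eqOn_span (F := evalAt Pm x ∘ₗ LinearMap.mulLeft ℝ (tr (.X k)))
      (G := mpow x k • evalAt Pm x) (fun ρ hρ => ?_) (MV_mem hR g hτ)
    rw [LinearMap.comp_apply, LinearMap.mulLeft_apply, ← tr_mul]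
    exact hX ρ hρ.1 k x
  · rw [evalV_renorm g Pm h, tr_one, MV_one]
    exact h1 h x
  · rw [evalV_renorm g Pm hl, MV_Xi, hXi l hl]
  · rw [evalV_renorm g Pm hm, evalV_renorm g Pm hτ, ← integ_tr, MV_integ]
    ext x
    obtain ⟨L, hL⟩ := hK.exists_kconvL m x
    rw [evalV, evalV, hL]
    refine eqOn_span (F := evalAt Pm x ∘ₗ integ m) (G := L ∘ₗ Pm ∘ₗ projT P R) (fun ρ hρ => ?_)
      (MV_mem hR g hτ)
    rw [LinearMap.comp_apply, integ_tr, evalAt_apply, hI ρ hρ.1 m (hρ.2.2 m hm), evalV, hL]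
    rfl

/-- The positive characters of the renormalised map. -/
theorem posChar_renorm (hR : R.IsNormal) (hK : IsKernel K) (g : GMinus P R)
    (Pm : TSpace P R →ₗ[ℝ] Smooth d) (x : Rd d) :
    posChar P R K (renorm P R g Pm) x = pullG (posChar P R K Pm x) g := by
  set f := posChar P R K Pm x with hf
  set f' := posChar P R K (renorm P R g Pm) x with hf'
  have hx : xOf f' = xOf (pullG f g) := by
    rw [xOf_pullG]
    ext i
    rw [xOf, xOf, hf, hf', posChar_inl, posChar_inl]
  -- The character at I_m[σ] depends only on the recentred map at σ, so agreement of the two actions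
  -- on a branch yields agreement of the characters one level higher.
  have hstep : ∀ σ (hσ : σ ∈ TExCirc P R), GamV f' (tr σ) = GamV (pullG f g) (tr σ) →
      ∀ m (hm : 0 < (Tree.I m σ).degPlus P),
      f' (MvPolynomial.X (.inr ⟨(m, σ), hσ, hm⟩)) = fHat f m (MV g (tr σ)) := by
    intro σ hσ hG m hm
    rw [hf', posChar_inr P R K (renorm P R g Pm) x m ⟨σ, hσ⟩ hm]
    choose L hL using fun l => hK.exists_kconvL (m + l) x
    -- The relation Π^g_x σ = Π_x M_g σ at the branch, from the inductive agreement and the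
    -- cointeraction.
    have h1 : recentred P R K (renorm P R g Pm) x (Finsupp.single ⟨σ, hσ⟩ 1) =
        Pm (Gam P R f (projT P R (MV g (tr σ)))) := by
      rw [recentred, LinearMap.comp_apply, ← hf', Gam_single, hG,
        ← Gam_single (pullG f g) ⟨σ, hσ⟩, renorm_eq, LinearMap.comp_apply, ← M_single g ⟨σ, hσ⟩]
      exact congrArg Pm (LinearMap.congr_fun (Gam_M hR f g) _).symm
    simp only [h1, hL]
    have h2 := eqOn_span (F := - ∑ l ∈ P.below ((Tree.I m σ).degPlus P),
      (mpow (-x) l / mfact l) • (L l ∘ₗ Pm ∘ₗ Gam P R f ∘ₗ projT P R)) (G := fHat f m)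
      (fun ρ hρ => ?_) (MV_mem hR g hσ)
    · rw [← h2]
      simp [LinearMap.sum_apply]
    -- Every tree of M_g σ has the degree of σ, so its Taylor sum has the same range and the
    -- defining formula can be applied to each tree separately.
    · have hdeg : (Tree.I m ρ).degPlus P = (Tree.I m σ).degPlus P := by
        rw [Tree.degPlus_I, Tree.degPlus_I, hρ.2.1]
      have hm' : 0 < (Tree.I m ρ).degPlus P := hdeg ▸ hm
      rw [fHat_of_pos f ⟨hρ.1, hm'⟩, hf, posChar_inr P R K Pm x m ⟨ρ, hρ.1⟩ hm', hdeg]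
      simp only [hL, recentred, LinearMap.neg_apply, LinearMap.sum_apply, LinearMap.smul_apply,
        LinearMap.comp_apply, smul_eq_mul, ← hf, projT_tr P R ⟨ρ, hρ.1⟩]
  have hGam : ∀ τ : Tree d, τ.BranchIn (TExCirc P R) →
      GamV f' (tr τ) = GamV (pullG f g) (tr τ) := by
    intro τ hτ
    induction τ using Tree.induction_gen with
    | ext a => exact (GamV_ext f' a).trans (GamV_ext _ a).symm
    | X i =>
      refine (GamV_X f' i).trans (Eq.trans ?_ (GamV_X _ i).symm)
      rw [hx]
    | Xi l => exact (GamV_Xi f' l).trans (GamV_Xi _ l).symm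
    | I m σ ih =>
      rw [Tree.branchIn_I] at hτ
      have ih := ih (branchIn_of_mem hτ)
      rw [GamV_I, GamV_I, ih]
      congr 1
      refine Finset.sum_congr rfl fun k hk => ?_
      have hk := mem_below_degPlus_I.1 hk
      rw [fHat_pullG f g _ hτ, fHat_of_pos f' ⟨hτ, hk⟩, hstep σ hτ ih _ hk]
    | mul σ τ h1 h2 =>
      rw [Tree.branchIn_mul] at hτ
      rw [tr_mul, map_mul, map_mul, h1 hτ.1, h2 hτ.2]
  exact GamV_faithful hGam

theorem recentred_renorm (hR : R.IsNormal) (hK : IsKernel K) (g : GMinus P R)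
    (Pm : TSpace P R →ₗ[ℝ] Smooth d) (x : Rd d) :
    recentred P R K (renorm P R g Pm) x = recentred P R K Pm x ∘ₗ M P R g := by
  rw [recentred, recentred, posChar_renorm hR hK, renorm_eq, LinearMap.comp_assoc, ← Gam_M hR,
    LinearMap.comp_assoc]

/-- Since Γ_f M_g = M_g Γ_{f^g}, the inverse recentrings satisfy the same intertwining relation.
Moving M_g through both factors of Γ^g_{xy} conjugates Γ_{xy}. -/
theorem GamXY_renorm (hR : R.IsNormal) (hK : IsKernel K) {g g' : GMinus P R}
    (hg : GMinus.IsInv P R g g') (Pm : TSpace P R →ₗ[ℝ] Smooth d) (x y : Rd d) :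
    GamXY P R K (renorm P R g Pm) x y = M P R g' ∘ₗ GamXY P R K Pm x y ∘ₗ M P R g := by
  rw [GamXY, GamXY, posChar_renorm hR hK, posChar_renorm hR hK, Gam_conv hR, Gam_conv hR]
  set f := posChar P R K Pm x
  set h := posChar P R K Pm y
  have h1 : Gam P R (GPlus.inv P R f) ∘ₗ Gam P R f = LinearMap.id := by
    rw [← Gam_conv hR, (isInv_inv hR f).1, Gam_unit hR]
  have h2 : Gam P R (pullG f g) ∘ₗ Gam P R (GPlus.inv P R (pullG f g)) = LinearMap.id := by
    rw [← Gam_conv hR, (isInv_inv hR _).2, Gam_unit hR]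
  have h3 : Gam P R (GPlus.inv P R f) ∘ₗ M P R g =
      M P R g ∘ₗ Gam P R (GPlus.inv P R (pullG f g)) := by
    calc Gam P R (GPlus.inv P R f) ∘ₗ M P R g
        = Gam P R (GPlus.inv P R f) ∘ₗ (M P R g ∘ₗ Gam P R (pullG f g)) ∘ₗ
            Gam P R (GPlus.inv P R (pullG f g)) := by
          rw [LinearMap.comp_assoc, h2, LinearMap.comp_id]
      _ = (Gam P R (GPlus.inv P R f) ∘ₗ Gam P R f) ∘ₗ M P R g ∘ₗ
            Gam P R (GPlus.inv P R (pullG f g)) := by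
          rw [← Gam_M hR, LinearMap.comp_assoc, LinearMap.comp_assoc]
      _ = _ := by rw [h1, LinearMap.id_comp]
  rw [LinearMap.comp_assoc, Gam_M hR h, ← LinearMap.comp_assoc (Gam P R (pullG h g)), h3,
    LinearMap.comp_assoc, ← LinearMap.comp_assoc _ (M P R g), M_comp_of_isInv hR hg,
    LinearMap.id_comp]

lemma M_single_degPlus (hR : R.IsNormal) (g : GMinus P R) (τ σ : TExCirc P R)
    (h : M P R g (Finsupp.single τ 1) σ ≠ 0) : σ.1.degPlus P = τ.1.degPlus P := by
  classical
  by_contra hne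
  refine h ?_
  have := eqOn_span (F := Finsupp.lapply σ ∘ₗ projT P R) (G := 0) (fun ρ hρ => ?_)
    (MV_mem hR g τ.2)
  · rw [M_single]
    exact this
  · rw [LinearMap.comp_apply, projT_tr P R ⟨ρ, hρ.1⟩, Finsupp.lapply_apply,
      Finsupp.single_apply, if_neg, LinearMap.zero_apply]
    rintro rfl
    exact hne hρ.2.1

lemma eq_sum_single (v : TSpace P R) : v = ∑ σ ∈ v.support, v σ • Finsupp.single σ 1 := by
  conv_lhs => rw [← Finsupp.sum_single v]
  simp [Finsupp.sum]

open MeasureTheory in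
/-- Pairing with a rescaled test function, as a linear functional. -/
lemma exists_testL (P : Degrees d) {φ : Rd d → ℝ} (hc : Continuous φ)
    (hs : tsupport φ ⊆ Metric.closedBall 0 1) {lam : ℝ} (h0 : 0 < lam) (h1 : lam ≤ 1) (x : Rd d) :
    ∃ L : Smooth d →ₗ[ℝ] ℝ, ∀ f : Smooth d,
      ∫ z, (f : Rd d → ℝ) z * rescale P φ lam x z = L f := by
  have hcont : Continuous (rescale P φ lam x) := by
    unfold rescale
    refine continuous_const.mul (hc.comp ?_)
    exact (PiLp.continuous_toLp 2 _).comp (by fun_prop)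
  have hsupp : HasCompactSupport (rescale P φ lam x) := by
    refine HasCompactSupport.intro (isCompact_closedBall x 1) fun z hz => ?_
    by_contra h
    refine hz ?_
    set w : Rd d := WithLp.toLp 2 fun i => lam ^ (-P.scaling i) * (z i - x i) with hw
    have hφ : φ w ≠ 0 := right_ne_zero_of_mul h
    have hw1 : ‖w‖ ≤ 1 := by
      simpa using hs (subset_tsupport φ hφ)
    rw [Metric.mem_closedBall, dist_eq_norm]
    refine le_trans ?_ hw1
    rw [EuclideanSpace.norm_eq, EuclideanSpace.norm_eq]
    refine Real.sqrt_le_sqrt (Finset.sum_le_sum fun i _ => ?_)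
    refine pow_le_pow_left₀ (norm_nonneg _) ?_ 2
    -- For λ ≤ 1 and positive scaling exponents the rescaling dilates each coordinate of z - x, so
    -- the support of the rescaled function stays in the unit ball around x.
    have h2 : (1 : ℝ) ≤ lam ^ (-P.scaling i) :=
      Real.one_le_rpow_of_pos_of_le_one_of_nonpos h0 h1
        (neg_nonpos.2 (zero_le_one.trans (P.one_le_scaling i)))
    change ‖z i - x i‖ ≤ ‖lam ^ (-P.scaling i) * (z i - x i)‖
    rw [norm_mul]
    exact le_mul_of_one_le_left (norm_nonneg _) (h2.trans (Real.le_norm_self _))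
  have hint : ∀ f : Smooth d, Integrable fun z => (f : Rd d → ℝ) z * rescale P φ lam x z :=
    fun f => ((contDiff_smooth f).continuous.mul hcont).integrable_of_hasCompactSupport hsupp.mul_left
  refine ⟨
    { toFun := fun f => ∫ z, (f : Rd d → ℝ) z * rescale P φ lam x z
      map_add' := fun f g => ?_
      map_smul' := fun a f => ?_ }, fun f => rfl⟩
  · rw [← integral_add (hint f) (hint g)]
    simp [add_mul]
  · rw [RingHom.id_apply, smul_eq_mul, ← integral_const_mul]
    simp [mul_assoc]

lemma normAt_eq_sum (γ : ℝ) (v : TSpace P R) {s : Finset (TExCirc P R)} (hs : v.support ⊆ s) :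
    normAt P R γ v = ∑ σ ∈ s, if σ.1.degPlus P = γ then |v σ| else 0 :=
  Finsupp.sum_of_support_subset v hs _ fun σ _ => by simp

lemma normAt_nonneg (γ : ℝ) (v : TSpace P R) : 0 ≤ normAt P R γ v :=
  Finset.sum_nonneg fun σ _ => by dsimp only; split_ifs <;> positivity

lemma normAt_smul (γ a : ℝ) (v : TSpace P R) : normAt P R γ (a • v) = |a| * normAt P R γ v := by
  rw [normAt_eq_sum γ (a • v) Finsupp.support_smul, normAt_eq_sum γ v subset_rfl, Finset.mul_sum]
  refine Finset.sum_congr rfl fun σ _ => ?_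
  split_ifs <;> simp [abs_mul]

lemma normAt_add_le (γ : ℝ) (v w : TSpace P R) :
    normAt P R γ (v + w) ≤ normAt P R γ v + normAt P R γ w := by
  classical
  rw [normAt_eq_sum γ (v + w) Finsupp.support_add, normAt_eq_sum γ v Finset.subset_union_left,
    normAt_eq_sum γ w Finset.subset_union_right, ← Finset.sum_add_distrib]
  refine Finset.sum_le_sum fun σ _ => ?_
  split_ifs
  · exact abs_add_le _ _
  · simp

lemma normAt_sum_le {ι : Type*} (γ : ℝ) (s : Finset ι) (a : ι → ℝ) (v : ι → TSpace P R) :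
    normAt P R γ (∑ i ∈ s, a i • v i) ≤ ∑ i ∈ s, |a i| * normAt P R γ (v i) := by
  classical
  induction s using Finset.induction_on with
  | empty => simp [normAt]
  | insert i s hi ih =>
    rw [Finset.sum_insert hi, Finset.sum_insert hi]
    refine (normAt_add_le γ _ _).trans ?_
    rw [normAt_smul]
    exact add_le_add le_rfl ih

/-- Δ_+ v is one fixed finite tensor and only its right factors are evaluated by the character. The
trees occurring in Γ_{xy} v are therefore confined to a finite set independent of x and y. -/
lemma exists_support_Gam (v : TSpace P R) :
    ∃ s : Finset (TExCirc P R), ∀ f : GPlus P R, (Gam P R f v).support ⊆ s := by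
  classical
  have h : ∀ z : TSpace P R ⊗[ℝ] TPlus P R, ∃ s : Finset (TExCirc P R), ∀ f : GPlus P R,
      (TensorProduct.rid ℝ (TSpace P R)
        (TensorProduct.map LinearMap.id f.toLinearMap z)).support ⊆ s := by
    intro z
    induction z with
    | zero => exact ⟨∅, by simp⟩
    | add z w hz hw =>
      obtain ⟨s, hs⟩ := hz
      obtain ⟨s', hs'⟩ := hw
      refine ⟨s ∪ s', fun f => ?_⟩
      rw [map_add, map_add]
      exact Finsupp.support_add.trans (Finset.union_subset_union (hs f) (hs' f))
    | tmul v p =>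
      refine ⟨v.support, fun f => ?_⟩
      rw [TensorProduct.map_tmul, TensorProduct.rid_tmul]
      exact Finsupp.support_smul
  exact h (deltaPlus P R v)

/-- M_g preserves |·|_+ and so acts within each degree. On vectors with support in a fixed finite
set its norms are bounded by the sum of those of its columns, uniformly in the degree. -/
lemma normAt_M_le (hR : R.IsNormal) (g : GMinus P R) (s : Finset (TExCirc P R)) :
    ∃ C : ℝ, 0 ≤ C ∧ ∀ v : TSpace P R, v.support ⊆ s → ∀ γ,
      normAt P R γ (M P R g v) ≤ C * normAt P R γ v := by
  have hN : ∀ ρ : TExCirc P R, 0 ≤ normAt P R (ρ.1.degPlus P) (M P R g (Finsupp.single ρ 1)) :=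
    fun ρ => normAt_nonneg _ _
  refine ⟨∑ ρ ∈ s, normAt P R (ρ.1.degPlus P) (M P R g (Finsupp.single ρ 1)),
    Finset.sum_nonneg fun ρ _ => hN ρ, fun v hv γ => ?_⟩
  have h1 : M P R g v = ∑ ρ ∈ v.support, v ρ • M P R g (Finsupp.single ρ 1) := by
    conv_lhs => rw [eq_sum_single v, map_sum]
    simp only [map_smul]
  have h2 : normAt P R γ v = ∑ ρ ∈ v.support, if ρ.1.degPlus P = γ then |v ρ| else 0 :=
    normAt_eq_sum γ v subset_rfl
  rw [h1, h2, Finset.mul_sum]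
  refine (normAt_sum_le γ _ _ _).trans (Finset.sum_le_sum fun ρ hρ => ?_)
  split_ifs with hγ
  · rw [mul_comm, ← hγ]
    exact mul_le_mul_of_nonneg_right
      (Finset.single_le_sum (f := fun ρ : TExCirc P R =>
        normAt P R (ρ.1.degPlus P) (M P R g (Finsupp.single ρ 1))) (fun ρ _ => hN ρ) (hv hρ))
      (abs_nonneg _)
  · rw [mul_zero]
    refine (mul_eq_zero_of_right _ (Finset.sum_eq_zero fun σ hσ => if_neg fun h => hγ ?_)).le
    rw [← h, M_single_degPlus hR g ρ σ (Finsupp.mem_support_iff.1 hσ)]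

/-- With Π^g_x = Π_x M_g and Γ^g_{xy} = M_{g'} Γ_{xy} M_g, the bounds for τ follow by summing those
of the finitely many trees of M_g τ, all with the exponent of τ. The outer M_{g'} costs a constant
uniform in x and y by `exists_support_Gam` and `normAt_M_le`. -/
theorem isModel_renorm (hR : R.IsNormal) (hK : IsKernel K) (r : ℕ) (g : GMinus P R)
    {Pm : TSpace P R →ₗ[ℝ] Smooth d}
    (h : IsModel P R r (recentred P R K Pm) (GamXY P R K Pm)) :
    IsModel P R r (recentred P R K (renorm P R g Pm)) (GamXY P R K (renorm P R g Pm)) where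
  bound_Pi τ S hS := by
    choose C hC using fun σ : TExCirc P R => h.bound_Pi σ S hS
    set v := M P R g (Finsupp.single τ 1) with hv
    refine ⟨∑ σ ∈ v.support, |v σ| * C σ, fun x hx lam h0 h1 φ hφ => ?_⟩
    obtain ⟨L, hL⟩ := exists_testL P (ContDiff.continuous hφ.1) hφ.2.1 h0 h1 x
    rw [recentred_renorm hR hK, LinearMap.comp_apply, ← hv, hL]
    conv_lhs => rw [eq_sum_single v]
    simp only [map_sum, map_smul]
    refine (Finset.abs_sum_le_sum_abs _ _).trans ?_
    rw [Finset.sum_mul]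
    refine Finset.sum_le_sum fun σ hσ => ?_
    rw [smul_eq_mul, abs_mul, mul_assoc, ← hL,
      ← M_single_degPlus hR g τ σ (Finsupp.mem_support_iff.1 hσ)]
    exact mul_le_mul_of_nonneg_left (hC σ x hx lam h0 h1 φ hφ) (abs_nonneg _)
  bound_Gam τ S hS := by
    choose C hC using fun σ : TExCirc P R => h.bound_Gam σ S hS
    set v := M P R g (Finsupp.single τ 1) with hv
    obtain ⟨g', hg'⟩ := exists_isInv_minus hR g
    obtain ⟨s, hs⟩ := exists_support_Gam v
    obtain ⟨B, hB, hB'⟩ := normAt_M_le hR g' s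
    refine ⟨B * ∑ σ ∈ v.support, |v σ| * C σ, fun x hx y hy γ hγ => ?_⟩
    rw [GamXY_renorm hR hK hg', LinearMap.comp_apply, LinearMap.comp_apply, ← hv, mul_assoc]
    refine (hB' _ (hs _) γ).trans (mul_le_mul_of_nonneg_left ?_ hB)
    conv_lhs => rw [eq_sum_single v]
    simp only [map_sum, map_smul]
    refine (normAt_sum_le γ _ _ _).trans ?_
    rw [Finset.sum_mul]
    refine Finset.sum_le_sum fun σ hσ => ?_
    have hdeg := M_single_degPlus hR g τ σ (Finsupp.mem_support_iff.1 hσ)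
    rw [mul_assoc, ← hdeg]
    exact mul_le_mul_of_nonneg_left (hC σ x hx y hy γ (hdeg ▸ hγ)) (abs_nonneg _)

lemma wellDefined (hR : R.IsNormal) : WellDefined P R where
  contracted_mem := contracted_mem hR
  branch_mem := branch_mem
  deltaPlus_mem _ hτ := deltaPlus_mem hR hτ
  exists_inv := exists_isInv_plus hR

end Renormalisation

end RegStr
end

/-! ### The main theorem. -/

open RegStr
theorem mainTheorem3 {d : ℕ} (P : Degrees d) (R : Rule d) (hnormal : R.IsNormal)
    (hsub : R.IsSubcritical P) (hcomplete : R.IsComplete P)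
    (K : Rd d → ℝ) (hK : IsKernel K)
    (r : ℕ) (hr : ∀ α ∈ indexSet P R, 1 - α < (r : ℝ))
    (g : GMinus P R) (Pm : TSpace P R →ₗ[ℝ] Smooth d) (hPm : IsPreModel P R K r Pm) :
    WellDefined P R ∧
    IsPreModel P R K r (renorm P R g Pm) ∧
    (∀ x : Rd d, recentred P R K (renorm P R g Pm) x = recentred P R K Pm x ∘ₗ M P R g) ∧
    (∃ g' : GMinus P R, GMinus.IsInv P R g g') ∧
    (∀ g' : GMinus P R, GMinus.IsInv P R g g' → ∀ x y : Rd d,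
      GamXY P R K (renorm P R g Pm) x y = M P R g' ∘ₗ GamXY P R K Pm x y ∘ₗ M P R g) :=
  ⟨wellDefined hnormal,
    ⟨isAdmissible_renorm hnormal hK g hPm.1, isModel_renorm hnormal hK r g hPm.2⟩,
    recentred_renorm hnormal hK g Pm, exists_isInv_minus hnormal g,
    fun _ hg' => GamXY_renorm hnormal hK hg' Pm⟩
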